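/- Use coordinates $(x_1,x_2,z)$ on $\mathbb{R}^3$. **Gehring ropelength.** A *generalized link* $L$ is a finite family of disjoint rectifiable curves, closed or arcs, where each endpoint $x$ of an arc is constrained to an affine subspace $M_x$, and where $L$ must stay in $\{g_j\ge 0\}$ for finitely many obstacles $\{g_j<0\}$ ($g_j$ of class $C^1$ with regular value $0$). Its Gehring thickness $\mathrm{GThi}(L)$ is the minimal distance between points on different components, pairs attaining it are the Gehring struts, and $O(L)=\min_j\min_{x\in L}g_j(x)$. A continuous vector field $\xi$ along $L$ is *compatible* if it is tangent to $M_x$ at each endpoint $x$. For $L$ of finite total curvature, $\delta_\xi\mathrm{Len}=-\int_L\langle\xi,d\mathcal K\rangle$ is the first variation of length, $\mathcal K$ being the curvature force, a vector-valued Radon measure along $L$. $L$ is *strongly critical* (for minimizing length when constrained by $\mathrm{GThi}$) if there is $\varepsilon>0$ such that $\min(\delta^+_\xi\mathrm{GThi}(L),\delta^+_\xi O(L))\le-\varepsilon$ for all compatible $\xi$ with $\delta_\xi\mathrm{Len}=-1$, where $\delta^+_\xi$ is the one-sided derivative at $t=0^+$ along $L+t\xi$. **Clasp arcs.** Let $0<\tau\le1$,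 $\theta=\arcsin\tau$. For $0\le u\le\tau$ put $$x(u)=\sqrt{\frac{u^2(1-(\tau-u)^2)}{1-u^2(\tau-u)^2}},\qquad x(-u)=-x(u),$$ and let $Z(\varphi)$, for $|\varphi|\le\theta$, be the height determined by $Z(0)=0$ and $dZ=\tan\varphi\;d\big(x(\sin\varphi)\big)$. The curve $\varphi\mapsto(x(\sin\varphi),Z(\varphi))$ is the $\tau$-clasp arc; its tip is at $\varphi=0$. Put $G=Z(\theta)+\sqrt{1-\tau^2}$. **The configuration $L(\tau,d,c)$**, for $d\ge1$ and $c\ge\tau(d/2+G)$. The arc $\gamma$ lies in the $x_2z$-plane: it consists of the clasp arc $(0,x(\sin\varphi),d/2+Z(\varphi))$, $|\varphi|\le\theta$, with tip $(0,0,d/2)$, continued tangentially at both ends by straight segments of length $c-\tau(d/2+G)$ up to the two planes $\pm\sqrt{1-\tau^2}\,x_2+\tau z=c$ (the ceiling), to which its endpoints are constrained. The arc $\beta$, attached to the floor, is the mirror image of $\gamma$ in the plane $z=0$, with the mirror-image constraints. The closed curve $\alpha$ lies in the $x_1z$-plane and is symmetric in the plane $z=0$; its part in $z\ge0$ consists of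 the clasp arc $(x(\sin\varphi),0,d/2+G-Z(\varphi))$, $|\varphi|\le\theta$, of the arcs $(\sin s,0,d/2+\cos s)$, $\theta\le|s|\le\pi/2$, of the unit circle around the tip of $\gamma$ (reduced to points if $\tau=1$), and of the vertical segments from $(\pm1,0,d/2)$ to $(\pm1,0,0)$. The regions beyond the four planes are obstacles. **Theorem.** 1. If $0<\tau<1$ and $c\ge\tau(1/2+G)$, then $L(\tau,1,c)$ is a generalized link with $\mathrm{GThi}=1$ and is strongly critical for Gehring ropelength. The tips of $\beta$ and $\gamma$ form a Gehring strut, which is isolated in the set of struts. 2. If $\tau=1$, then for every $d\ge1$ and every $c\ge d/2+G$, $L(1,d,c)$ is a generalized link with $\mathrm{GThi}=1$ and is strongly critical for Gehring ropelength. For fixed floor and ceiling $z=\pm c$ these form a one-parameter family with parameter $d$, in which the total length is constant, whereas the length of $\alpha$ varies: $\mathrm{Len}(\alpha_{d'})-\mathrm{Len}(\alpha_d)=2(d'-d)$. -/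

import Mathlib

open MeasureTheory Set
open scoped RealInnerProductSpace

noncomputable section

/-- Euclidean three-space, with coordinates `(x₁, x₂, z)`. -/
abbrev E3 : Type := EuclideanSpace ℝ (Fin 3)

/-! ### Generalized links -/

/-- A component of a generalized link: a curve parametrized on `[left, right]` (the values of `path`
elsewhere are irrelevant), either closed, or an arc whose two endpoints are constrained to the
affine subspaces `leftPlane` and `rightPlane` (which play no role for a closed component). -/
structure Strand where
  left : ℝ
  right : ℝ
  path : ℝ → E3
  isClosed : Prop
  leftPlane : AffineSubspace ℝ E3
  rightPlane : AffineSubspace ℝ E3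

/-- The parameter interval of a component. -/
def Strand.dom (C : Strand) : Set ℝ := Icc C.left C.right

/-- The length `∫ ‖c'‖` of a (Lipschitz) parametrized curve `c`. -/
def Strand.length (C : Strand) : ℝ := ∫ s in C.dom, ‖deriv C.path s‖

/-- The data of a generalized link: components indexed by `ι`, and obstacles `{p | g j p < 0}`
indexed by `κ`. -/
structure GeneralizedLink (ι κ : Type) where
  strand : ι → Strand
  obstacle : κ → E3 → ℝ

namespace GeneralizedLink

variable {ι κ : Type}

/-- The conditions under which the data describe a generalized link: Lipschitz parametrized curves
that are regular almost everywhere, closed or with endpoints obeying their constraints, with disjoint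
components, and obstacles given by `C¹` functions with regular value `0` and avoided by the link. -/
structure IsValid (L : GeneralizedLink ι κ) : Prop where
  left_lt_right : ∀ i, (L.strand i).left < (L.strand i).right
  lipschitz : ∀ i, ∃ K, LipschitzOnWith K (L.strand i).path (L.strand i).dom
  regular : ∀ i, ∀ᵐ s : ℝ, s ∈ (L.strand i).dom → deriv (L.strand i).path s ≠ 0
  closes_up : ∀ i, (L.strand i).isClosed →
    (L.strand i).path (L.strand i).left = (L.strand i).path (L.strand i).right
  left_mem : ∀ i, ¬ (L.strand i).isClosed →
    (L.strand i).path (L.strand i).left ∈ (L.strand i).leftPlane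
  right_mem : ∀ i, ¬ (L.strand i).isClosed →
    (L.strand i).path (L.strand i).right ∈ (L.strand i).rightPlane
  disjoint : ∀ i j, i ≠ j →
    Disjoint ((L.strand i).path '' (L.strand i).dom) ((L.strand j).path '' (L.strand j).dom)
  contDiff_obstacle : ∀ j, ContDiff ℝ 1 (L.obstacle j)
  regular_obstacle : ∀ j p, L.obstacle j p = 0 → fderiv ℝ (L.obstacle j) p ≠ 0
  avoids : ∀ j i, ∀ s ∈ (L.strand i).dom, 0 ≤ L.obstacle j ((L.strand i).path s)

/-- Total length. -/
def length [Fintype ι] (L : GeneralizedLink ι κ) : ℝ := ∑ i, (L.strand i).length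

/-- The Gehring thickness: the minimal distance between points on different components. -/
def gThi (L : GeneralizedLink ι κ) : ℝ :=
  sInf {r | ∃ i j, i ≠ j ∧ ∃ s ∈ (L.strand i).dom, ∃ t ∈ (L.strand j).dom,
    r = dist ((L.strand i).path s) ((L.strand j).path t)}

/-- The Gehring struts, as ordered pairs of points (each unordered strut occurs in both orders). -/
def gStrut (L : GeneralizedLink ι κ) : Set (E3 × E3) :=
  {p | ∃ i j, i ≠ j ∧ ∃ s ∈ (L.strand i).dom, ∃ t ∈ (L.strand j).dom,
    p = ((L.strand i).path s, (L.strand j).path t) ∧ dist p.1 p.2 = L.gThi}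

/-- The obstacle function `O(L)`: the minimum of all the obstacle functions along the link. -/
def obstacleMin (L : GeneralizedLink ι κ) : ℝ :=
  sInf {r | ∃ j i, ∃ s ∈ (L.strand i).dom, r = L.obstacle j ((L.strand i).path s)}

/-- The space of compatible vector fields: `ξ` is continuous along the link, and tangent to the
constraint subspaces at the endpoints of arcs. -/
def Compatible (L : GeneralizedLink ι κ) (ξ : ι → ℝ → E3) : Prop :=
  ∀ i, ContinuousOn (ξ i) (L.strand i).dom ∧
    ((L.strand i).isClosed → ξ i (L.strand i).left = ξ i (L.strand i).right) ∧
    (¬ (L.strand i).isClosed →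
      ξ i (L.strand i).left ∈ (L.strand i).leftPlane.direction ∧
      ξ i (L.strand i).right ∈ (L.strand i).rightPlane.direction)

/-- The variation `L + t ξ` of a link. -/
def vary (L : GeneralizedLink ι κ) (ξ : ι → ℝ → E3) (t : ℝ) : GeneralizedLink ι κ where
  strand i := { L.strand i with path := fun s => (L.strand i).path s + t • ξ i s }
  obstacle := L.obstacle

/-- The pairing `∫_L ⟨ξ, 𝒦⟩` of a vector field with a vector-valued measure along the link; the
latter is written in polar form, with density `ν i` with respect to a positive measure `μ i`. -/
def forcePairing [Fintype ι] (L : GeneralizedLink ι κ) (μ : ι → Measure ℝ) (ν ξ : ι → ℝ → E3) : ℝ :=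
  ∑ i, ∫ s in (L.strand i).dom, ⟪ξ i s, ν i s⟫ ∂(μ i)

/-- `L` has finite total curvature and the vector-valued Radon measure `𝒦 = ν μ` is its curvature
force: the derivative of length in the direction of a compatible `ξ` is `-∫_L ⟨ξ, 𝒦⟩`. This is
tested on the Lipschitz fields `ξ`, for which the length of `L + t ξ` makes sense; they are uniformly
dense in the continuous ones, so that the pairing with compatible fields is determined by `L`. -/
def IsCurvatureForce [Fintype ι] (L : GeneralizedLink ι κ) (μ : ι → Measure ℝ)
    (ν : ι → ℝ → E3) : Prop :=
  (∀ i, IsFiniteMeasure (μ i) ∧ Integrable (ν i) (μ i)) ∧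
  ∀ ξ : ι → ℝ → E3, L.Compatible ξ →
    (∀ i, ∃ K, LipschitzOnWith K (ξ i) (L.strand i).dom) →
    HasDerivAt (fun t => (L.vary ξ t).length) (-L.forcePairing μ ν ξ) 0

/-- Strong criticality for minimizing length when constrained by Gehring thickness: there is `ε > 0`
such that for every compatible `ξ` with `δ_ξ Len = -1`, the one-sided first variations of `gThi` and
of `O` in direction `ξ` (which are part of the claim) satisfy
`min (δ⁺_ξ gThi) (δ⁺_ξ O) ≤ -ε`. -/
def IsStronglyCritical [Fintype ι] (L : GeneralizedLink ι κ) : Prop :=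
  ∃ (μ : ι → Measure ℝ) (ν : ι → ℝ → E3), L.IsCurvatureForce μ ν ∧
    ∃ ε : ℝ, 0 < ε ∧ ∀ ξ : ι → ℝ → E3, L.Compatible ξ → -L.forcePairing μ ν ξ = -1 →
      ∃ p q : ℝ,
        HasDerivWithinAt (fun t => (L.vary ξ t).gThi) p (Ici 0) 0 ∧
        HasDerivWithinAt (fun t => (L.vary ξ t).obstacleMin) q (Ici 0) 0 ∧
        min p q ≤ -ε

end GeneralizedLink

/-! ### The clasp arcs -/

/-- The horizontal coordinate of a `τ`-clasp arc, as a function of the vertical component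
`u ∈ [-τ, τ]` of its unit tangent vector: contact points of the two arcs satisfy `|u₁| + |u₂| = τ`,
and `x₁² = u₁² (1 - u₂²) / (1 - u₁² u₂²)`. -/
def claspX (τ u : ℝ) : ℝ :=
  u * √((1 - (τ - |u|) ^ 2) / (1 - u ^ 2 * (τ - |u|) ^ 2))

/-- The height above its tip of the point of a `τ`-clasp arc where the tangent makes angle `φ` with
the horizontal. As `u = sin φ`, the defining relation `dz / dx = u / √(1 - u²) = tan φ` reads
`dz = tan φ · x'(u) cos φ dφ = sin φ · x'(sin φ) dφ`. -/
def claspZ (τ φ : ℝ) : ℝ :=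
  ∫ ψ in (0 : ℝ)..φ, Real.sin ψ * deriv (claspX τ) (Real.sin ψ)

/-- The vertical distance between the tips of the two arcs of a `τ`-clasp (the tip of one arc is at
distance one from the two points of the other arc where `u = ±τ`). -/
def claspGap (τ : ℝ) : ℝ := claspZ τ (Real.arcsin τ) + √(1 - τ ^ 2)

/-! ### The chained clasp -/

/-- Reflection in the horizontal plane `z = 0`. -/
def reflZ (p : E3) : E3 := !₂[p 0, p 1, -p 2]

/-- The arc `γ`, in the `x₂z`-plane, with lowest point `(0, 0, d/2)`: a `τ`-clasp arc (parametrized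
by the angle of its tangent) continued by straight segments (parametrized by arclength). -/
def gammaPath (τ d s : ℝ) : E3 :=
  if |s| ≤ Real.arcsin τ then !₂[0, claspX τ (Real.sin s), d / 2 + claspZ τ s]
  else !₂[0,
    SignType.sign s * (τ + (|s| - Real.arcsin τ) * √(1 - τ ^ 2)),
    d / 2 + claspZ τ (Real.arcsin τ) + (|s| - Real.arcsin τ) * τ]

/-- The upper half of `α`, in the `x₁z`-plane, from `(-1, 0, 0)` to `(1, 0, 0)`: in the middle a
`τ`-clasp arc, on both sides of it arcs of the unit circle around the tip `(0, 0, d/2)` of `γ`, and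
outside these vertical segments. -/
def alphaUpper (τ d s : ℝ) : E3 :=
  if |s| ≤ Real.arcsin τ then
    !₂[claspX τ (Real.sin s), 0, d / 2 + claspGap τ - claspZ τ s]
  else if |s| ≤ Real.pi / 2 then
    !₂[Real.sin s, 0, d / 2 + Real.cos s]
  else
    !₂[SignType.sign s, 0, d / 2 - (|s| - Real.pi / 2)]

/-- The closed curve `α`, parametrized on `[-h, 3h]` where `h = π/2 + d/2`: its upper half followed
by the mirror image of the upper half. -/
def alphaPath (τ d s : ℝ) : E3 :=
  if s ≤ Real.pi / 2 + d / 2 then alphaUpper τ d s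
  else reflZ (alphaUpper τ d (2 * (Real.pi / 2 + d / 2) - s))

/-- Outer unit normals of the four walls, at angle `arcsin τ` with the horizontal; the signs of `σ`
and `ρ` distinguish the four walls (`ρ = 1` for the ceiling, `ρ = -1` for the floor). -/
def wallNormal (τ σ ρ : ℝ) : E3 := !₂[0, σ * √(1 - τ ^ 2), ρ * τ]

/-- The plane at distance `c` from the origin with unit normal `n`. -/
def wallPlane (n : E3) (c : ℝ) : AffineSubspace ℝ E3 :=
  AffineSubspace.mk' (c • n) (Submodule.span ℝ {n})ᗮ

/-- The function that is negative beyond the wall with unit normal `n` at distance `c`. -/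
def wallFun (n : E3) (c : ℝ) (p : E3) : ℝ := c - ⟪n, p⟫

/-- The length of the straight ends of `β` and `γ`, when the walls are at distance `c` from the
origin. -/
def endLength (τ d c : ℝ) : ℝ := c - τ * (d / 2 + claspGap τ)

/-- The configuration of the chained clasp with walls at distance `c` from the origin and with the
tips of `β` and `γ` at distance `d`. The components are `α` (index `0`), `β` (index `1`, attached to
the floor) and `γ` (index `2`, attached to the ceiling). The region beyond the walls is an
obstacle. -/
def chainedClasp (τ d c : ℝ) : GeneralizedLink (Fin 3) (Fin 4) where
  strand :=
    ![{ left := -(Real.pi / 2 + d / 2)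
        right := 3 * (Real.pi / 2 + d / 2)
        path := alphaPath τ d
        isClosed := True
        leftPlane := ⊤
        rightPlane := ⊤ },
      { left := -(Real.arcsin τ + endLength τ d c)
        right := Real.arcsin τ + endLength τ d c
        path := fun s => reflZ (gammaPath τ d s)
        isClosed := False
        leftPlane := wallPlane (wallNormal τ (-1) (-1)) c
        rightPlane := wallPlane (wallNormal τ 1 (-1)) c },
      { left := -(Real.arcsin τ + endLength τ d c)
        right := Real.arcsin τ + endLength τ d c
        path := gammaPath τ d
        isClosed := False
        leftPlane := wallPlane (wallNormal τ (-1) 1) c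
        rightPlane := wallPlane (wallNormal τ 1 1) c }]
  obstacle :=
    ![wallFun (wallNormal τ (-1) (-1)) c, wallFun (wallNormal τ 1 (-1)) c,
      wallFun (wallNormal τ (-1) 1) c, wallFun (wallNormal τ 1 1) c]

end

/-!
Strong criticality is certified by a balance of forces. If the forces transmitted by positive masses
on the Gehring struts cancel the curvature force `𝒦`, then `∫ ⟨ξ, 𝒦⟩` is at most `-p` times the
total mass, for every `p ≤ 0` that bounds below the rates at which the lengths of the struts change
in the direction `ξ`. By compactness the least such rate is `δ⁺ GThi`, which is therefore bounded
away from zero when `δ Len = -1`. The arcs meet the walls at right angles, so that the tensions at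
their ends do no work on compatible fields.

The contact points of the clasp arcs of `α` and `γ` are the pairs with `|sin s| + |sin t| = τ`. The
four struts joining the points at `±s` with those at `±t` carry equal masses: with `u = |sin s|`,
`v = |sin t|` and `H` the difference in height, the formula for the clasp arcs amounts to
`u / √(1 - u²) = x(u) / H` and `v / √(1 - v²) = x(v) / H`, so that a mass with density `du / (2 H)`
on each of them balances the curvature of both arcs. The circle arcs of `α` are balanced by struts
to the tip of `γ`. They exert on this tip a downward force `2 (1 - τ)`, which is carried by the
strut between the tips of `β` and `γ`; it vanishes when `τ = 1`, in which case the tips may be moved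
apart.
-/

open MeasureTheory Set Filter Topology
open scoped RealInnerProductSpace

noncomputable section

/-! ### Differentiating a minimum over a compact family -/

section Danskin

variable {X : Type*} [TopologicalSpace X] [CompactSpace X] {F F' : ℝ → X → ℝ}

theorem eventually_forall_add_mul_le (hF : Continuous F.uncurry) (hF' : Continuous F'.uncurry)
    (hderiv : ∀ t k, HasDerivAt (F · k) (F' t k) t) {m p : ℝ} (hm : ∀ k, m ≤ F 0 k)
    (hp : ∀ k, F 0 k = m → p < F' 0 k) :
    ∀ᶠ t in 𝓝[≥] (0 : ℝ), ∀ k, m + t * p ≤ F t k := by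
  have hlocal : ∀ k ∈ (univ : Set X), ∀ᶠ z : ℝ × X in 𝓝 (0, k),
      0 ≤ z.1 → m + z.1 * p ≤ F z.1 z.2 := by
    intro k _
    rcases (hm k).lt_or_eq with hk | hk
    · have hlt : ∀ᶠ z : ℝ × X in 𝓝 (0, k), m + z.1 * p < F z.1 z.2 :=
        (by fun_prop : Continuous fun z : ℝ × X => m + z.1 * p).continuousAt.eventually_lt
          hF.continuousAt (by simpa using hk)
      exact hlt.mono fun z hz _ => hz.le
    · have hlt : ∀ᶠ z : ℝ × X in 𝓝 (0, k), p < F' z.1 z.2 :=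
        hF'.continuousAt.eventually_const_lt (hp k hk.symm)
      obtain ⟨⟨δ, U⟩, ⟨hδ, hU⟩, hbox⟩ :=
        (Metric.nhds_basis_ball.prod_nhds (𝓝 k).basis_sets).mem_iff.1 hlt
      filter_upwards [prod_mem_nhds (Metric.ball_mem_nhds 0 hδ) hU] with ⟨t, l⟩ ⟨ht, hl⟩ ht0
      have hslope : p * (t - 0) ≤ F t l - F 0 l := by
        refine (convex_ball (0 : ℝ) δ).mul_sub_le_image_sub_of_le_deriv
          (fun s _ => (hderiv s l).continuousAt.continuousWithinAt)
          (fun s _ => (hderiv s l).differentiableAt.differentiableWithinAt)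
          (fun s hs => ?_) 0 (Metric.mem_ball_self hδ) t ht ht0
        rw [(hderiv s l).deriv]
        exact (hbox ⟨interior_subset hs, hl⟩ : (s, l) ∈ {z : ℝ × X | p < F' z.1 z.2}).le
      linarith [hm l]
  have hnhds := isCompact_univ.eventually_forall_of_forall_eventually
    (P := fun t k => 0 ≤ t → m + t * p ≤ F t k) hlocal
  filter_upwards [nhdsWithin_le_nhds hnhds, self_mem_nhdsWithin] with t ht ht0 k
  exact ht k (mem_univ k) ht0

/-- **Danskin's theorem**. -/
theorem exists_hasDerivWithinAt_iInf (hF : Continuous F.uncurry)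
    (hF' : Continuous F'.uncurry) (hderiv : ∀ t k, HasDerivAt (F · k) (F' t k) t) :
    ∃ p, HasDerivWithinAt (fun t => ⨅ k, F t k) p (Ici 0) 0 ∧
      ∀ k, F 0 k = ⨅ k, F 0 k → p ≤ F' 0 k := by
  rcases isEmpty_or_nonempty X with hX | hX
  · exact ⟨0, by simp [Real.iInf_of_isEmpty, hasDerivWithinAt_const], isEmptyElim⟩
  have hFt (t : ℝ) : Continuous (F t) := hF.comp (Continuous.prodMk_right t)
  have hbdd (t : ℝ) : BddBelow (range (F t)) := (isCompact_range (hFt t)).bddBelow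
  obtain ⟨k₀, -, hk₀⟩ := isCompact_univ.exists_isMinOn univ_nonempty (hFt 0).continuousOn
  have hmin (k) : F 0 k₀ ≤ F 0 k := hk₀ (mem_univ k)
  have hinf : ⨅ k, F 0 k = F 0 k₀ := (ciInf_le (hbdd 0) k₀).antisymm (le_ciInf hmin)
  have hactive : IsCompact {k | F 0 k = F 0 k₀} :=
    (isClosed_eq (hFt 0) continuous_const).isCompact
  obtain ⟨k₁, hk₁ : F 0 k₁ = F 0 k₀, hk₁min⟩ := hactive.exists_isMinOn ⟨k₀, rfl⟩
    (hF'.comp (Continuous.prodMk_right 0)).continuousOn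
  have hslope (k) (hk : F 0 k = F 0 k₀) : F' 0 k₁ ≤ F' 0 k := hk₁min hk
  refine ⟨F' 0 k₁, ?_, fun k hk => hslope k (hk.trans hinf)⟩
  rw [hasDerivWithinAt_iff_isLittleO, Asymptotics.isLittleO_iff]
  intro ε hε
  have hupper := (Asymptotics.isLittleO_iff.1 (hderiv 0 k₁).isLittleO) hε
  have hlower := eventually_forall_add_mul_le hF hF' hderiv hmin
    (p := F' 0 k₁ - ε) fun k hk => (sub_lt_self _ hε).trans_le (hslope k hk)
  filter_upwards [nhdsWithin_le_nhds hupper, hlower, self_mem_nhdsWithin] with t hup hlow ht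
  have hle : ⨅ k, F t k ≤ F t k₁ := ciInf_le (hbdd t) k₁
  have hge : F 0 k₀ + t * (F' 0 k₁ - ε) ≤ ⨅ k, F t k := le_ciInf hlow
  simp only [hinf, hk₁, sub_zero, smul_eq_mul, Real.norm_eq_abs, abs_of_nonneg (mem_Ici.1 ht),
    abs_le] at hup ⊢
  constructor <;> linarith [hup.2]

theorem iInf_sqrt {f : X → ℝ} (hf : Continuous f) : ⨅ k, √(f k) = √(⨅ k, f k) := by
  rcases isEmpty_or_nonempty X with hX | hX
  · simp [Real.iInf_of_isEmpty]
  exact (Real.sqrt_monotone.map_ciInf_of_continuousAt Real.continuous_sqrt.continuousAt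
    (isCompact_range hf).bddBelow).symm

end Danskin

theorem continuous_uncurry_sigma {α β ι : Type*} {Y : ι → Type*} [TopologicalSpace α]
    [TopologicalSpace β] [∀ i, TopologicalSpace (Y i)] {f : α → (Σ i, Y i) → β}
    (hf : ∀ i, Continuous fun z : α × Y i => f z.1 ⟨i, z.2⟩) : Continuous f.uncurry := by
  have hdistrib : Continuous fun w : Σ i, Y i × α => f w.2.2 ⟨w.1, w.2.1⟩ :=
    continuous_sigma fun i => (hf i).comp continuous_swap
  exact (hdistrib.comp Homeomorph.sigmaProdDistrib.continuous).comp continuous_swap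

namespace GeneralizedLink

variable {ι κ : Type} (L : GeneralizedLink ι κ)

/-- Pairs of (parameters of) points on different components: the index set of the minimum that
defines the thickness. -/
abbrev PointPair : Type :=
  Σ p : {p : ι × ι // p.1 ≠ p.2}, (L.strand p.1.1).dom × (L.strand p.1.2).dom

/-- Points of the link, once for each obstacle: the index set of the minimum that defines the
obstacle function. -/
abbrev ObstaclePoint : Type := Σ p : κ × ι, (L.strand p.2).dom

instance (i : ι) : CompactSpace (L.strand i).dom :=
  inferInstanceAs (CompactSpace (Icc _ _))

variable {L}

/-- The difference of the values of a vector-valued function on the link at a pair of points. -/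
def PointPair.diff (η : ι → ℝ → E3) (k : L.PointPair) : E3 :=
  η k.1.1.1 k.2.1 - η k.1.1.2 k.2.2

theorem PointPair.continuous_diff {η : ι → ℝ → E3}
    (hη : ∀ i, ContinuousOn (η i) (L.strand i).dom) :
    Continuous (PointPair.diff η : L.PointPair → E3) :=
  continuous_sigma fun p => ((hη p.1.1).domRestrict.comp continuous_fst).sub
    ((hη p.1.2).domRestrict.comp continuous_snd)

theorem gThi_vary_eq_iInf (ξ : ι → ℝ → E3) (t : ℝ) :
    (L.vary ξ t).gThi =
      ⨅ k : L.PointPair, ‖PointPair.diff (fun i => (L.strand i).path) k +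
        t • PointPair.diff ξ k‖ := by
  have hdist (i j : ι) (s s' : ℝ) :
      dist (((L.vary ξ t).strand i).path s) (((L.vary ξ t).strand j).path s') =
        ‖(L.strand i).path s - (L.strand j).path s' + t • (ξ i s - ξ j s')‖ := by
    rw [dist_eq_norm]
    congr 1
    simp only [vary]
    module
  refine congrArg sInf (Set.ext fun r => ⟨?_, ?_⟩)
  · rintro ⟨i, j, hij, s, hs, s', hs', rfl⟩
    exact ⟨⟨⟨(i, j), hij⟩, ⟨s, hs⟩, ⟨s', hs'⟩⟩, (hdist i j s s').symm⟩
  · rintro ⟨⟨⟨⟨i, j⟩, hij⟩, ⟨s, hs⟩, ⟨s', hs'⟩⟩, rfl⟩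
    exact ⟨i, j, hij, s, hs, s', hs', (hdist i j s s').symm⟩

/-- Along the vector field `ξ`, every strut of `L` lengthens at rate at least `p`; the inequality is
multiplied through by the length of the strut. -/
def IsStrutRateBound (L : GeneralizedLink ι κ) (ξ : ι → ℝ → E3) (p : ℝ) : Prop :=
  ∀ i j s t, i ≠ j → s ∈ (L.strand i).dom → t ∈ (L.strand j).dom →
    dist ((L.strand i).path s) ((L.strand j).path t) = L.gThi →
    p * L.gThi ≤ ⟪(L.strand i).path s - (L.strand j).path t, ξ i s - ξ j t⟫

theorem exists_hasDerivWithinAt_gThi [Finite ι]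
    (hpath : ∀ i, ContinuousOn (L.strand i).path (L.strand i).dom) (hpos : 0 < L.gThi)
    {ξ : ι → ℝ → E3} (hξ : ∀ i, ContinuousOn (ξ i) (L.strand i).dom) :
    ∃ p, HasDerivWithinAt (fun t => (L.vary ξ t).gThi) p (Ici 0) 0 ∧ L.IsStrutRateBound ξ p := by
  have hvary0 : (L.vary ξ 0).gThi = L.gThi := by simp [vary]
  set x : L.PointPair → E3 := PointPair.diff fun i => (L.strand i).path
  set v : L.PointPair → E3 := PointPair.diff ξ
  have hx : Continuous x := PointPair.continuous_diff hpath
  have hv : Continuous v := PointPair.continuous_diff hξ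
  have hgThi (t : ℝ) : (L.vary ξ t).gThi = ⨅ k, ‖x k + t • v k‖ := gThi_vary_eq_iInf ξ t
  have hsqrt (t : ℝ) : ⨅ k, ‖x k + t • v k‖ = √(⨅ k, ‖x k + t • v k‖ ^ 2) := by
    rw [← iInf_sqrt (by fun_prop)]
    simp only [Real.sqrt_sq (norm_nonneg _)]
  have hsq : ⨅ k, ‖x k + (0 : ℝ) • v k‖ ^ 2 = L.gThi ^ 2 := by
    rw [← hvary0, hgThi, hsqrt, Real.sq_sqrt (Real.iInf_nonneg fun k => by positivity)]
  obtain ⟨p, hp, hstrut⟩ := exists_hasDerivWithinAt_iInf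
    (F := fun t k => ‖x k + t • v k‖ ^ 2) (F' := fun t k => 2 * ⟪x k + t • v k, v k⟫)
    (by unfold Function.uncurry; fun_prop) (by unfold Function.uncurry; fun_prop) fun t k => by
      simpa using (((hasDerivAt_id t).smul_const (v k)).const_add (x k)).norm_sq
  refine ⟨p / (2 * L.gThi), ?_, fun i j s t hij hs ht hst => ?_⟩
  · simp only [hgThi, hsqrt]
    simpa only [hsq, Real.sqrt_sq hpos.le] using hp.sqrt (by rw [hsq]; positivity)
  · set k : L.PointPair := ⟨⟨(i, j), hij⟩, ⟨s, hs⟩, ⟨t, ht⟩⟩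
    have hk : ‖x k + (0 : ℝ) • v k‖ ^ 2 = L.gThi ^ 2 := by
      rw [← hst, dist_eq_norm, zero_smul, add_zero]
      rfl
    have hle : p ≤ 2 * ⟪x k + (0 : ℝ) • v k, v k⟫ := hstrut k (hk.trans hsq.symm)
    rw [zero_smul, add_zero] at hle
    have hdiv : p / (2 * L.gThi) * L.gThi = p / 2 := by field_simp
    change p / (2 * L.gThi) * L.gThi ≤ ⟪x k, v k⟫
    linarith

theorem obstacleMin_vary_eq_iInf (ξ : ι → ℝ → E3) (t : ℝ) :
    (L.vary ξ t).obstacleMin = ⨅ k : L.ObstaclePoint,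
      L.obstacle k.1.1 ((L.strand k.1.2).path k.2 + t • ξ k.1.2 k.2) := by
  refine congrArg sInf (Set.ext fun r => ⟨?_, ?_⟩)
  · rintro ⟨j, i, s, hs, rfl⟩
    exact ⟨⟨(j, i), ⟨s, hs⟩⟩, rfl⟩
  · rintro ⟨⟨⟨j, i⟩, ⟨s, hs⟩⟩, rfl⟩
    exact ⟨j, i, s, hs, rfl⟩

theorem exists_hasDerivWithinAt_obstacleMin [Finite ι] [Finite κ]
    (hpath : ∀ i, ContinuousOn (L.strand i).path (L.strand i).dom)
    (hobstacle : ∀ j, ContDiff ℝ 1 (L.obstacle j)) {ξ : ι → ℝ → E3}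
    (hξ : ∀ i, ContinuousOn (ξ i) (L.strand i).dom) :
    ∃ q, HasDerivWithinAt (fun t => (L.vary ξ t).obstacleMin) q (Ici 0) 0 := by
  have hfield {η : ι → ℝ → E3} (hη : ∀ i, ContinuousOn (η i) (L.strand i).dom) (i : ι) :
      Continuous fun z : ℝ × (L.strand i).dom => η i z.2 :=
    (hη i).domRestrict.comp continuous_snd
  have hpoint (i : ι) : Continuous fun z : ℝ × (L.strand i).dom =>
      (L.strand i).path z.2 + z.1 • ξ i z.2 :=
    (hfield hpath i).add (continuous_fst.smul (hfield hξ i))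
  obtain ⟨q, hq, -⟩ := exists_hasDerivWithinAt_iInf (X := L.ObstaclePoint)
    (F := fun t k => L.obstacle k.1.1 ((L.strand k.1.2).path k.2 + t • ξ k.1.2 k.2))
    (F' := fun t k => fderiv ℝ (L.obstacle k.1.1)
      ((L.strand k.1.2).path k.2 + t • ξ k.1.2 k.2) (ξ k.1.2 k.2))
    (continuous_uncurry_sigma fun p => (hobstacle p.1).continuous.comp (hpoint p.2))
    (continuous_uncurry_sigma fun p =>
      (((hobstacle p.1).continuous_fderiv one_ne_zero).comp (hpoint p.2)).clm_apply
        (hfield hξ p.2))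
    fun t k => by
      have hmove : HasDerivAt (fun t : ℝ => (L.strand k.1.2).path k.2 + t • ξ k.1.2 k.2)
          (ξ k.1.2 k.2) t := by
        simpa using
          ((hasDerivAt_id t).smul_const (ξ k.1.2 k.2)).const_add ((L.strand k.1.2).path k.2)
      exact ((hobstacle k.1.1).differentiable one_ne_zero _).hasFDerivAt.comp_hasDerivAt t hmove
  exact ⟨q, by simpa only [obstacleMin_vary_eq_iInf] using hq⟩

end GeneralizedLink

/-! ### The first variation of length -/

section FirstVariation

variable {E : Type*} [NormedAddCommGroup E] [InnerProductSpace ℝ E]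

theorem hasDerivAt_norm_add_smul {x : E} (hx : x ≠ 0) (y : E) :
    HasDerivAt (fun t : ℝ => ‖x + t • y‖) (⟪x, y⟫ / ‖x‖) 0 := by
  have hline : HasDerivAt (fun t : ℝ => x + t • y) y 0 := by
    simpa using ((hasDerivAt_id (0 : ℝ)).smul_const y).const_add x
  have hsqrt := hline.norm_sq.sqrt (by simpa using hx)
  simp only [zero_smul, add_zero, Real.sqrt_sq (norm_nonneg _)] at hsqrt
  exact hsqrt.congr_deriv (mul_div_mul_left _ _ two_ne_zero)

theorem ae_Icc_mem_nhds (a b : ℝ) : ∀ᵐ s : ℝ, s ∈ Icc a b → Icc a b ∈ 𝓝 s := by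
  filter_upwards [Measure.ae_ne volume a, Measure.ae_ne volume b] with s ha hb hs
  exact Icc_mem_nhds (hs.1.lt_of_ne' ha) (hs.2.lt_of_ne hb)

variable {f g : ℝ → E} {a b : ℝ} {K K' : NNReal}

theorem ae_differentiableAt_of_lipschitzOnWith_Icc [FiniteDimensional ℝ E]
    (hf : LipschitzOnWith K f (Icc a b)) : ∀ᵐ s : ℝ, s ∈ Icc a b → DifferentiableAt ℝ f s := by
  filter_upwards [hf.ae_differentiableWithinAt_of_mem_real, ae_Icc_mem_nhds a b]
    with s hdiff hnhds hs
  exact (hdiff hs).differentiableAt (hnhds hs)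

theorem ae_norm_deriv_le_of_lipschitzOnWith_Icc (hf : LipschitzOnWith K f (Icc a b)) :
    ∀ᵐ s ∂volume.restrict (Icc a b), ‖deriv f s‖ ≤ K := by
  rw [ae_restrict_iff' measurableSet_Icc]
  filter_upwards [ae_Icc_mem_nhds a b] with s hnhds hs
  exact norm_deriv_le_of_lipschitzOn (hnhds hs) hf

theorem integrableOn_deriv_of_lipschitzOnWith_Icc [CompleteSpace E]
    (hf : LipschitzOnWith K f (Icc a b)) : IntegrableOn (deriv f) (Icc a b) :=
  Integrable.mono' (g := fun _ => (K : ℝ)) (integrableOn_const (by simp))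
    (aestronglyMeasurable_deriv f _) (ae_norm_deriv_le_of_lipschitzOnWith_Icc hf)

theorem integrableOn_inner_deriv [CompleteSpace E] (hf : ContinuousOn f (Icc a b))
    (hg : LipschitzOnWith K g (Icc a b)) :
    IntegrableOn (fun s => ⟪f s, deriv g s⟫) (Icc a b) := by
  obtain ⟨M, hM⟩ := isCompact_Icc.exists_bound_of_continuousOn hf
  refine Integrable.mono' ((integrableOn_deriv_of_lipschitzOnWith_Icc hg).norm.const_mul M)
    ((hf.aestronglyMeasurable measurableSet_Icc).inner (aestronglyMeasurable_deriv g _)) ?_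
  filter_upwards [ae_restrict_mem measurableSet_Icc] with s hs
  exact (norm_inner_le_norm _ _).trans (mul_le_mul_of_nonneg_right (hM s hs) (norm_nonneg _))

theorem absolutelyContinuousOnInterval_inner (hf : LipschitzOnWith K f (uIcc a b))
    (hg : LipschitzOnWith K' g (uIcc a b)) :
    AbsolutelyContinuousOnInterval (fun s => ⟪f s, g s⟫) a b := by
  have hadd := (lipschitzWith_one_norm.comp_lipschitzOnWith
    (hf.add hg)).absolutelyContinuousOnInterval
  have hsub := (lipschitzWith_one_norm.comp_lipschitzOnWith
    (hf.sub hg)).absolutelyContinuousOnInterval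
  have hpolar := ((hadd.mul hadd).sub (hsub.mul hsub)).const_mul (4⁻¹ : ℝ)
  convert hpolar using 2 with s
  exact (re_inner_eq_norm_add_mul_self_sub_norm_sub_mul_self_div_four (𝕜 := ℝ) (f s) (g s)).trans
    (div_eq_inv_mul _ _)

theorem integral_inner_deriv_eq_sub [FiniteDimensional ℝ E] (hab : a ≤ b)
    (hf : LipschitzOnWith K f (Icc a b)) (hg : LipschitzOnWith K' g (Icc a b)) :
    ∫ s in Icc a b, ⟪f s, deriv g s⟫ =
      ⟪g b, f b⟫ - ⟪g a, f a⟫ - ∫ s in Icc a b, ⟪g s, deriv f s⟫ := by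
  have hFTC : ∫ s in Icc a b, deriv (fun s => ⟪f s, g s⟫) s = ⟪f b, g b⟫ - ⟪f a, g a⟫ := by
    rw [integral_Icc_eq_integral_Ioc, ← intervalIntegral.integral_of_le hab]
    rw [← uIcc_of_le hab] at hf hg
    exact (absolutelyContinuousOnInterval_inner hf hg).integral_deriv_eq_sub
  have hLeibniz : ∫ s in Icc a b, deriv (fun s => ⟪f s, g s⟫) s =
      ∫ s in Icc a b, (⟪f s, deriv g s⟫ + ⟪g s, deriv f s⟫) := by
    refine setIntegral_congr_ae measurableSet_Icc ?_
    filter_upwards [ae_differentiableAt_of_lipschitzOnWith_Icc hf,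
      ae_differentiableAt_of_lipschitzOnWith_Icc hg] with s hfs hgs hs
    rw [((hfs hs).hasDerivAt.inner ℝ (hgs hs).hasDerivAt).deriv, real_inner_comm (deriv f s)]
  rw [hLeibniz, integral_add (integrableOn_inner_deriv hf.continuousOn hg)
    (integrableOn_inner_deriv hg.continuousOn hf)] at hFTC
  rw [real_inner_comm, real_inner_comm (f a)]
  linarith

variable {c T ξ : ℝ → E}

theorem hasDerivAt_integral_norm_deriv_add_smul [FiniteDimensional ℝ E]
    (hc : LipschitzOnWith K c (Icc a b)) (hT : Continuous T) (hT1 : ∀ s, ‖T s‖ = 1)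
    (hcT : ∀ᵐ s : ℝ, s ∈ Icc a b → ∃ v : ℝ, 0 < v ∧ HasDerivAt c (v • T s) s)
    (hξ : LipschitzOnWith K' ξ (Icc a b)) :
    HasDerivAt (fun t : ℝ => ∫ s in Icc a b, ‖deriv (fun s => c s + t • ξ s) s‖)
      (∫ s in Icc a b, ⟪T s, deriv ξ s⟫) 0 := by
  have hderiv : ∀ᵐ s ∂volume.restrict (Icc a b), ∃ v : ℝ, 0 < v ∧
      ∀ t : ℝ, deriv (fun s => c s + t • ξ s) s = v • T s + t • deriv ξ s := by
    rw [ae_restrict_iff' measurableSet_Icc]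
    filter_upwards [hcT, ae_differentiableAt_of_lipschitzOnWith_Icc hξ] with s hcs hξs hs
    obtain ⟨v, hv, hd⟩ := hcs hs
    exact ⟨v, hv, fun t => (hd.add ((hξs hs).hasDerivAt.const_smul t)).deriv⟩
  refine (hasDerivAt_integral_of_dominated_loc_of_lip (bound := fun _ => (K' : ℝ))
    (F := fun t s => ‖deriv (fun s => c s + t • ξ s) s‖) univ_mem
    (.of_forall fun t => (aestronglyMeasurable_deriv _ _).norm)
    (by simpa using (integrableOn_deriv_of_lipschitzOnWith_Icc hc).norm)
    (hT.aestronglyMeasurable.inner (aestronglyMeasurable_deriv ξ _)) ?_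
    (integrableOn_const (by simp)) ?_).2
  · filter_upwards [hderiv, ae_norm_deriv_le_of_lipschitzOnWith_Icc hξ]
      with s hs hbound
    obtain ⟨v, -, hd⟩ := hs
    refine LipschitzOnWith.of_dist_le_mul fun t _ t' _ => ?_
    rw [hd, hd]
    calc dist ‖v • T s + t • deriv ξ s‖ ‖v • T s + t' • deriv ξ s‖
        ≤ ‖(v • T s + t • deriv ξ s) - (v • T s + t' • deriv ξ s)‖ := dist_norm_norm_le _ _
      _ = ‖(t - t') • deriv ξ s‖ := by congr 1; module
      _ = ‖deriv ξ s‖ * dist t t' := by rw [norm_smul, Real.dist_eq, Real.norm_eq_abs, mul_comm]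
      _ ≤ K' * dist t t' := by gcongr
      _ = _ := by simp
  · filter_upwards [hderiv] with s hs
    obtain ⟨v, hv, hd⟩ := hs
    have hne : v • T s ≠ 0 := smul_ne_zero hv.ne' (norm_ne_zero_iff.1 (by simp [hT1]))
    simp only [hd]
    refine (hasDerivAt_norm_add_smul hne (deriv ξ s)).congr_deriv ?_
    rw [real_inner_smul_left, norm_smul, hT1, Real.norm_eq_abs, abs_of_pos hv, mul_one,
      mul_div_cancel_left₀ _ hv.ne']

/-- The **first variation of length** of a curve with Lipschitz unit tangent `T`. -/
theorem hasDerivAt_integral_norm_deriv_vary [FiniteDimensional ℝ E] {K'' : NNReal} (hab : a ≤ b)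
    (hc : LipschitzOnWith K c (Icc a b)) (hT : LipschitzWith K'' T) (hT1 : ∀ s, ‖T s‖ = 1)
    (hcT : ∀ᵐ s : ℝ, s ∈ Icc a b → ∃ v : ℝ, 0 < v ∧ HasDerivAt c (v • T s) s)
    (hξ : LipschitzOnWith K' ξ (Icc a b)) :
    HasDerivAt (fun t : ℝ => ∫ s in Icc a b, ‖deriv (fun s => c s + t • ξ s) s‖)
      (⟪ξ b, T b⟫ - ⟪ξ a, T a⟫ - ∫ s in Icc a b, ⟪ξ s, deriv T s⟫) 0 :=
  integral_inner_deriv_eq_sub hab hT.lipschitzOnWith hξ ▸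
    hasDerivAt_integral_norm_deriv_add_smul hc hT.continuous hT1 hcT hξ

end FirstVariation

/-! ### The clasp arcs -/

/-- The square of `claspX τ w / w`, for `0 < w`. -/
def claspRatio (τ w : ℝ) : ℝ := (1 - (τ - w) ^ 2) / (1 - w ^ 2 * (τ - w) ^ 2)

/-- The derivative of `claspRatio τ`. -/
def claspRatioDeriv (τ w : ℝ) : ℝ :=
  2 * (τ - w) * (1 - w ^ 2 + w * (τ - w) * (1 - (τ - w) ^ 2)) / (1 - w ^ 2 * (τ - w) ^ 2) ^ 2

/-- The derivative of `claspX τ` at `w ≥ 0`; the division by zero that occurs for `τ = 1`, `w = 0`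
is harmless, as it is multiplied by `w`. -/
def claspXDeriv (τ w : ℝ) : ℝ :=
  √(claspRatio τ w) + w / √(claspRatio τ w) * (claspRatioDeriv τ w / 2)

/-- The speed of a `τ`-clasp arc parametrized by the angle of its tangent. -/
def claspSpeed (τ s : ℝ) : ℝ := claspXDeriv τ |Real.sin s|

section ClaspArc

variable {τ s u v w : ℝ}

theorem claspX_eq_mul_sqrt_claspRatio (τ u : ℝ) : claspX τ u = u * √(claspRatio τ |u|) := by
  rw [claspX, claspRatio, sq_abs]

theorem claspX_neg (τ u : ℝ) : claspX τ (-u) = -claspX τ u := by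
  rw [claspX_eq_mul_sqrt_claspRatio, claspX_eq_mul_sqrt_claspRatio, abs_neg, neg_mul]

theorem claspX_zero (τ : ℝ) : claspX τ 0 = 0 := by simp [claspX]

theorem claspX_self (hτ : 0 ≤ τ) : claspX τ τ = τ := by simp [claspX, abs_of_nonneg hτ]

theorem one_sub_sq_sub_pos (hτ : τ ∈ Ioc 0 1) (hw : w ∈ Ioc 0 1) : 0 < 1 - (τ - w) ^ 2 := by
  nlinarith [hτ.1, hτ.2, hw.1, hw.2]

theorem claspRatio_denom_pos (hτ : τ ∈ Ioc 0 1) (hw : w ∈ Icc 0 1) :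
    0 < 1 - w ^ 2 * (τ - w) ^ 2 := by
  rcases hw.1.eq_or_lt with rfl | hw0
  · norm_num
  · have hsub := one_sub_sq_sub_pos hτ ⟨hw0, hw.2⟩
    have hsq : w ^ 2 ≤ 1 := pow_le_one₀ hw.1 hw.2
    nlinarith [sq_nonneg (τ - w)]

theorem claspRatio_pos (hτ : τ ∈ Ioc 0 1) (hw : w ∈ Ioc 0 1) : 0 < claspRatio τ w :=
  div_pos (one_sub_sq_sub_pos hτ hw) (claspRatio_denom_pos hτ (Ioc_subset_Icc_self hw))

theorem hasDerivAt_claspRatio (hτ : τ ∈ Ioc 0 1) (hw : w ∈ Icc 0 1) :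
    HasDerivAt (claspRatio τ) (claspRatioDeriv τ w) w := by
  have hsub : HasDerivAt (fun w => τ - w) (-1) w := by simpa using (hasDerivAt_id w).const_sub τ
  have hnum := (hsub.pow 2).const_sub 1
  have hdenom := (((hasDerivAt_id w).pow 2).mul (hsub.pow 2)).const_sub 1
  refine (hnum.div hdenom (claspRatio_denom_pos hτ hw).ne').congr_deriv ?_
  simp only [claspRatioDeriv, id, Pi.mul_apply, Pi.pow_apply]
  congr 1
  ring

theorem hasDerivAt_claspX_of_pos (hτ : τ ∈ Ioc 0 1) (hu : u ∈ Ioc 0 1) :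
    HasDerivAt (claspX τ) (claspXDeriv τ u) u := by
  have hpos := claspRatio_pos hτ hu
  have hprod := (hasDerivAt_id u).mul
    ((hasDerivAt_claspRatio hτ (Ioc_subset_Icc_self hu)).sqrt hpos.ne')
  have heq : claspX τ =ᶠ[𝓝 u] fun w => id w * √(claspRatio τ w) := by
    filter_upwards [eventually_gt_nhds hu.1] with w hw
    rw [claspX_eq_mul_sqrt_claspRatio, abs_of_pos hw, id]
  refine (hprod.congr_of_eventuallyEq heq).congr_deriv ?_
  have hne : √(claspRatio τ u) ≠ 0 := (Real.sqrt_pos.2 hpos).ne'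
  simp only [claspXDeriv, id]
  field_simp

theorem hasDerivAt_claspX_zero (hτ : τ ∈ Ioc 0 1) :
    HasDerivAt (claspX τ) (claspXDeriv τ 0) 0 := by
  have hratio : ContinuousAt (claspRatio τ) |0| := by
    rw [abs_zero]
    exact (hasDerivAt_claspRatio hτ ⟨le_rfl, zero_le_one⟩).continuousAt
  have hsqrt : ContinuousAt (fun u : ℝ => √(claspRatio τ |u|)) 0 :=
    (ContinuousAt.comp hratio continuous_abs.continuousAt).sqrt
  rw [show claspXDeriv τ 0 = √(claspRatio τ |0|) by simp [claspXDeriv],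
    hasDerivAt_iff_tendsto_slope]
  refine (hsqrt.tendsto.mono_left nhdsWithin_le_nhds).congr' ?_
  filter_upwards [self_mem_nhdsWithin] with u (hu : u ≠ 0)
  rw [slope_def_field, claspX_zero, sub_zero, sub_zero, claspX_eq_mul_sqrt_claspRatio,
    mul_div_cancel_left₀ _ hu]

theorem hasDerivAt_claspX (hτ : τ ∈ Ioc 0 1) (hu : |u| ≤ 1) :
    HasDerivAt (claspX τ) (claspXDeriv τ |u|) u := by
  rcases lt_trichotomy u 0 with hneg | rfl | hpos
  · rw [abs_of_neg hneg] at hu ⊢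
    have hodd : (fun w => -claspX τ (-w)) = claspX τ := by
      ext w
      rw [claspX_neg, neg_neg]
    rw [← hodd]
    exact ((hasDerivAt_claspX_of_pos hτ ⟨neg_pos.2 hneg, hu⟩).scomp u
      (hasDerivAt_neg u)).neg.congr_deriv (by simp)
  · simpa using hasDerivAt_claspX_zero hτ
  · rw [abs_of_pos hpos] at hu ⊢
    exact hasDerivAt_claspX_of_pos hτ ⟨hpos, hu⟩

theorem le_claspRatio (hτ : τ ∈ Ioc 0 1) (hw : w ∈ Icc 0 τ) : w ≤ claspRatio τ w := by
  obtain ⟨hw0, hwτ⟩ := hw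
  rw [claspRatio, le_div_iff₀ (claspRatio_denom_pos hτ ⟨hw0, hwτ.trans hτ.2⟩)]
  have hprod : 0 ≤ w * (w ^ 2 * (τ - w) ^ 2) := by positivity
  nlinarith [hτ.2]

theorem tendsto_div_sqrt_claspRatio_zero (hτ : τ ∈ Ioc 0 1) :
    Tendsto (fun w => w / √(claspRatio τ w)) (𝓝[Icc 0 τ] 0) (𝓝 0) := by
  have hsqrt : Tendsto (fun w : ℝ => √w) (𝓝[Icc 0 τ] 0) (𝓝 0) :=
    (Real.continuous_sqrt.tendsto' 0 0 Real.sqrt_zero).mono_left nhdsWithin_le_nhds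
  refine squeeze_zero' ?_ ?_ hsqrt <;> filter_upwards [self_mem_nhdsWithin] with w hw
  · exact div_nonneg hw.1 (Real.sqrt_nonneg _)
  · calc w / √(claspRatio τ w) ≤ w / √w := by
          rcases hw.1.eq_or_lt with rfl | hpos
          · simp
          · exact div_le_div_of_nonneg_left hw.1 (Real.sqrt_pos.2 hpos)
              (Real.sqrt_le_sqrt (le_claspRatio hτ hw))
      _ = √w := Real.div_sqrt

theorem continuousOn_claspXDeriv (hτ : τ ∈ Ioc 0 1) : ContinuousOn (claspXDeriv τ) (Icc 0 1) := by
  have hratio : ContinuousOn (claspRatio τ) (Icc 0 1) := fun w hw =>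
    (hasDerivAt_claspRatio hτ hw).continuousAt.continuousWithinAt
  have hratio' : ContinuousOn (claspRatioDeriv τ) (Icc 0 1) :=
    ContinuousOn.div (by fun_prop) (by fun_prop) fun w hw =>
      pow_ne_zero _ (claspRatio_denom_pos hτ hw).ne'
  refine hratio.sqrt.add (ContinuousOn.mul (fun w hw => ?_) (hratio'.div_const 2))
  rcases hw.1.eq_or_lt with rfl | hpos
  · refine ContinuousWithinAt.mono_of_mem_nhdsWithin (t := Icc 0 τ) ?_ ?_
    · simpa only [ContinuousWithinAt, zero_div] using tendsto_div_sqrt_claspRatio_zero hτ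
    · filter_upwards [self_mem_nhdsWithin, mem_nhdsWithin_of_mem_nhds (Iic_mem_nhds hτ.1)]
        with x hx hxτ using ⟨hx.1, hxτ⟩
  · exact continuousWithinAt_id.div (hratio w hw).sqrt
      (Real.sqrt_pos.2 (claspRatio_pos hτ ⟨hpos, hw.2⟩)).ne'

theorem claspXDeriv_pos (hτ : τ ∈ Ioc 0 1) (hw : w ∈ Ioc 0 τ) : 0 < claspXDeriv τ w := by
  have hw1 : w ∈ Ioc 0 1 := ⟨hw.1, hw.2.trans hτ.2⟩
  have hsqrt := Real.sqrt_pos.2 (claspRatio_pos hτ hw1)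
  have hderiv : 0 ≤ claspRatioDeriv τ w := by
    have hsub : 0 ≤ τ - w := sub_nonneg.2 hw.2
    have hsq : 0 ≤ 1 - w ^ 2 := sub_nonneg.2 (pow_le_one₀ hw.1.le hw1.2)
    have hsubsq := (one_sub_sq_sub_pos hτ hw1).le
    have hw0 := hw.1.le
    unfold claspRatioDeriv
    positivity
  have hw0 := hw.1.le
  unfold claspXDeriv
  positivity

theorem deriv_claspX_sin (hτ : τ ∈ Ioc 0 1) (s : ℝ) :
    deriv (claspX τ) (Real.sin s) = claspSpeed τ s :=
  (hasDerivAt_claspX hτ (Real.abs_sin_le_one s)).deriv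

theorem continuous_claspSpeed (hτ : τ ∈ Ioc 0 1) : Continuous (claspSpeed τ) :=
  (continuousOn_claspXDeriv hτ).comp_continuous (by fun_prop)
    fun s => ⟨abs_nonneg _, Real.abs_sin_le_one s⟩

theorem claspXDeriv_self (τ : ℝ) : claspXDeriv τ τ = 1 := by
  simp [claspXDeriv, claspRatio, claspRatioDeriv]

theorem claspSpeed_neg (τ s : ℝ) : claspSpeed τ (-s) = claspSpeed τ s := by simp [claspSpeed]

theorem hasDerivAt_claspX_sin (hτ : τ ∈ Ioc 0 1) (s : ℝ) :
    HasDerivAt (fun s => claspX τ (Real.sin s)) (claspSpeed τ s * Real.cos s) s :=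
  (hasDerivAt_claspX hτ (Real.abs_sin_le_one s)).comp s (Real.hasDerivAt_sin s)

theorem hasDerivAt_claspZ (hτ : τ ∈ Ioc 0 1) (s : ℝ) :
    HasDerivAt (claspZ τ) (Real.sin s * claspSpeed τ s) s := by
  have hcont : Continuous fun s => Real.sin s * claspSpeed τ s :=
    Real.continuous_sin.mul (continuous_claspSpeed hτ)
  have heq : claspZ τ = fun φ => ∫ s in (0 : ℝ)..φ, Real.sin s * claspSpeed τ s := by
    funext φ
    simp only [claspZ, deriv_claspX_sin hτ]
  rw [heq]
  exact intervalIntegral.integral_hasDerivAt_right (hcont.intervalIntegrable _ _)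
    (hcont.stronglyMeasurableAtFilter _ _) hcont.continuousAt

theorem continuous_claspZ (hτ : τ ∈ Ioc 0 1) : Continuous (claspZ τ) :=
  continuous_iff_continuousAt.2 fun s => (hasDerivAt_claspZ hτ s).continuousAt

theorem claspZ_zero (τ : ℝ) : claspZ τ 0 = 0 := by simp [claspZ]

theorem claspZ_neg (hτ : τ ∈ Ioc 0 1) (s : ℝ) : claspZ τ (-s) = claspZ τ s := by
  have hodd := intervalIntegral.integral_comp_neg (fun s => Real.sin s * claspSpeed τ s)
    (a := 0) (b := s)
  simp only [Real.sin_neg, claspSpeed_neg, neg_mul, neg_zero] at hodd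
  simp only [claspZ, deriv_claspX_sin hτ]
  rw [intervalIntegral.integral_symm, ← hodd, intervalIntegral.integral_neg, neg_neg]

theorem claspZ_abs (hτ : τ ∈ Ioc 0 1) (s : ℝ) : claspZ τ |s| = claspZ τ s := by
  rcases abs_choice s with h | h <;> rw [h]
  exact claspZ_neg hτ s

theorem sin_mem_Icc_of_mem_Icc_arcsin (hs : s ∈ Icc 0 (Real.arcsin τ)) : Real.sin s ∈ Icc 0 τ := by
  have hpi := Real.pi_pos
  have hs' := hs.2.trans (Real.arcsin_le_pi_div_two τ)
  exact ⟨Real.sin_nonneg_of_nonneg_of_le_pi hs.1 (by linarith),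
    (Real.le_arcsin_iff_sin_le' ⟨by linarith [hs.1], hs'⟩).1 hs.2⟩

theorem sin_mem_Ioc_of_mem_Ioc_arcsin (hs : s ∈ Ioc 0 (Real.arcsin τ)) : Real.sin s ∈ Ioc 0 τ := by
  have hpi := Real.arcsin_le_pi_div_two τ
  exact ⟨Real.sin_pos_of_pos_of_lt_pi hs.1 (by linarith [hs.2, Real.pi_pos]),
    (sin_mem_Icc_of_mem_Icc_arcsin (Ioc_subset_Icc_self hs)).2⟩

theorem claspSpeed_pos (hτ : τ ∈ Ioc 0 1) (hs0 : s ≠ 0) (hs : |s| ≤ Real.arcsin τ) :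
    0 < claspSpeed τ s := by
  have habs : claspSpeed τ s = claspSpeed τ |s| := by
    rcases abs_choice s with h | h <;> rw [h]
    exact (claspSpeed_neg τ s).symm
  have hsin := sin_mem_Ioc_of_mem_Ioc_arcsin ⟨abs_pos.2 hs0, hs⟩
  rw [habs, claspSpeed, abs_of_pos hsin.1]
  exact claspXDeriv_pos hτ hsin

theorem strictMonoOn_claspZ (hτ : τ ∈ Ioc 0 1) :
    StrictMonoOn (claspZ τ) (Icc 0 (Real.arcsin τ)) := by
  refine strictMonoOn_of_deriv_pos (convex_Icc _ _) (continuous_claspZ hτ).continuousOn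
    fun s hs => ?_
  rw [interior_Icc] at hs
  rw [(hasDerivAt_claspZ hτ s).deriv]
  exact mul_pos (sin_mem_Ioc_of_mem_Ioc_arcsin ⟨hs.1, hs.2.le⟩).1
    (claspSpeed_pos hτ hs.1.ne' ((abs_of_pos hs.1).trans_le hs.2.le))

theorem claspZ_nonneg (hτ : τ ∈ Ioc 0 1) (hs : |s| ≤ Real.arcsin τ) : 0 ≤ claspZ τ s := by
  rw [← claspZ_abs hτ, ← claspZ_zero τ]
  exact (strictMonoOn_claspZ hτ).monotoneOn ⟨le_rfl, Real.arcsin_nonneg.2 hτ.1.le⟩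
    ⟨abs_nonneg s, hs⟩ (abs_nonneg s)

theorem claspZ_le (hτ : τ ∈ Ioc 0 1) (hs : |s| ≤ Real.arcsin τ) :
    claspZ τ s ≤ claspZ τ (Real.arcsin τ) := by
  rw [← claspZ_abs hτ]
  exact (strictMonoOn_claspZ hτ).monotoneOn ⟨abs_nonneg s, hs⟩
    ⟨Real.arcsin_nonneg.2 hτ.1.le, le_rfl⟩ hs

end ClaspArc

/-! ### Contact between the two arcs of a clasp -/

/-- The difference in height between points at distance one, one on each arc of a clasp, whose
tangents have vertical components `u` and `v`. Points are in contact if `|u| + |v| = τ`. -/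
def contactHeight (τ u v : ℝ) : ℝ := √(1 - claspX τ u ^ 2 - claspX τ v ^ 2)

theorem contactHeight_comm (τ u v : ℝ) : contactHeight τ u v = contactHeight τ v u := by
  rw [contactHeight, contactHeight, sub_right_comm]

section Contact

variable {τ u v : ℝ}

theorem claspX_of_add_eq (hu : 0 ≤ u) (huv : u + v = τ) :
    claspX τ u = u * √((1 - v ^ 2) / (1 - u ^ 2 * v ^ 2)) := by
  rw [claspX, abs_of_nonneg hu, ← huv, add_sub_cancel_left]

theorem one_sub_sq_mul_sq_pos (hτ : τ ∈ Ioc 0 1) (hu : 0 ≤ u) (hv : 0 ≤ v) (huv : u + v = τ) :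
    0 < 1 - u ^ 2 * v ^ 2 := by
  simpa [← huv] using claspRatio_denom_pos hτ (w := u) ⟨hu, by linarith [hτ.2]⟩

theorem one_sub_claspX_sq_sub_claspX_sq (hτ : τ ∈ Ioc 0 1) (hu : 0 ≤ u) (hv : 0 ≤ v)
    (huv : u + v = τ) : 1 - claspX τ u ^ 2 - claspX τ v ^ 2 =
      (1 - u ^ 2) * ((1 - v ^ 2) / (1 - u ^ 2 * v ^ 2)) := by
  have hdenom := one_sub_sq_mul_sq_pos hτ hu hv huv
  have hu1 : 0 ≤ 1 - u ^ 2 := sub_nonneg.2 (pow_le_one₀ hu (by linarith [hτ.2]))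
  have hv1 : 0 ≤ 1 - v ^ 2 := sub_nonneg.2 (pow_le_one₀ hv (by linarith [hτ.2]))
  rw [claspX_of_add_eq hu huv, claspX_of_add_eq hv (add_comm u v ▸ huv), mul_comm (v ^ 2), mul_pow,
    mul_pow, Real.sq_sqrt (div_nonneg hv1 hdenom.le), Real.sq_sqrt (div_nonneg hu1 hdenom.le)]
  field_simp
  ring

theorem contactHeight_eq_mul (hτ : τ ∈ Ioc 0 1) (hu : 0 ≤ u) (hv : 0 ≤ v) (huv : u + v = τ) :
    contactHeight τ u v = √(1 - u ^ 2) * √((1 - v ^ 2) / (1 - u ^ 2 * v ^ 2)) := by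
  rw [contactHeight, one_sub_claspX_sq_sub_claspX_sq hτ hu hv huv,
    Real.sqrt_mul (sub_nonneg.2 (pow_le_one₀ hu (by linarith [hτ.2])))]

/-- Points in contact are joined by a vector in the normal plane of the arc. -/
theorem claspX_mul_sqrt (hτ : τ ∈ Ioc 0 1) (hu : 0 ≤ u) (hv : 0 ≤ v) (huv : u + v = τ) :
    claspX τ u * √(1 - u ^ 2) = u * contactHeight τ u v := by
  rw [contactHeight_eq_mul hτ hu hv huv, claspX_of_add_eq hu huv]
  ring

theorem sqrt_mul_sqrt_le_contactHeight (hτ : τ ∈ Ioc 0 1) (hu : 0 ≤ u) (hv : 0 ≤ v)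
    (huv : u + v = τ) : √(1 - u ^ 2) * √(1 - v ^ 2) ≤ contactHeight τ u v := by
  rw [contactHeight_eq_mul hτ hu hv huv]
  gcongr
  refine le_div_self (sub_nonneg.2 (pow_le_one₀ hv (by linarith [hτ.2])))
    (one_sub_sq_mul_sq_pos hτ hu hv huv) (sub_le_self _ (by positivity))

theorem contactHeight_pos (hτ : τ ∈ Ioc 0 1) (hu : 0 < u) (hv : 0 < v) (huv : u + v = τ) :
    0 < contactHeight τ u v := by
  have hu1 : 0 < 1 - u ^ 2 := sub_pos.2 (pow_lt_one₀ hu.le (by linarith [hτ.2]) two_ne_zero)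
  have hv1 : 0 < 1 - v ^ 2 := sub_pos.2 (pow_lt_one₀ hv.le (by linarith [hτ.2]) two_ne_zero)
  exact (mul_pos (Real.sqrt_pos.2 hu1) (Real.sqrt_pos.2 hv1)).trans_le
    (sqrt_mul_sqrt_le_contactHeight hτ hu.le hv.le huv)

theorem claspX_sq_add_claspX_sq_add_contactHeight_sq (hτ : τ ∈ Ioc 0 1) (hu : 0 ≤ u) (hv : 0 ≤ v)
    (huv : u + v = τ) : claspX τ u ^ 2 + claspX τ v ^ 2 + contactHeight τ u v ^ 2 = 1 := by
  have hnonneg : 0 ≤ 1 - claspX τ u ^ 2 - claspX τ v ^ 2 := by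
    rw [one_sub_claspX_sq_sub_claspX_sq hτ hu hv huv]
    exact mul_nonneg (sub_nonneg.2 (pow_le_one₀ hu (by linarith [hτ.2])))
      (div_nonneg (sub_nonneg.2 (pow_le_one₀ hv (by linarith [hτ.2])))
        (one_sub_sq_mul_sq_pos hτ hu hv huv).le)
  rw [contactHeight, Real.sq_sqrt hnonneg]
  ring

theorem contactHeight_self_zero (hτ : 0 ≤ τ) : contactHeight τ τ 0 = √(1 - τ ^ 2) := by
  simp [contactHeight, claspX_zero, claspX_self hτ]

theorem hasDerivAt_claspZ_arcsin (hτ : τ ∈ Ioc 0 1) (hu : u ∈ Ioo 0 1) :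
    HasDerivAt (fun u => claspZ τ (Real.arcsin u)) (u / √(1 - u ^ 2) * claspXDeriv τ u) u := by
  have hcomp := (hasDerivAt_claspZ hτ (Real.arcsin u)).comp u
    (Real.hasDerivAt_arcsin (by linarith [hu.1]) hu.2.ne)
  refine hcomp.congr_deriv ?_
  rw [claspSpeed, Real.sin_arcsin (by linarith [hu.1]) hu.2.le, abs_of_pos hu.1]
  ring

theorem div_sqrt_eq_claspX_div_contactHeight (hτ : τ ∈ Ioc 0 1) (hu : 0 < u) (hv : 0 < v)
    (huv : u + v = τ) : u / √(1 - u ^ 2) = claspX τ u / contactHeight τ u v := by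
  have hsqrt : 0 < √(1 - u ^ 2) :=
    Real.sqrt_pos.2 (sub_pos.2 (pow_lt_one₀ hu.le (by linarith [hτ.2]) two_ne_zero))
  rw [div_eq_div_iff hsqrt.ne' (contactHeight_pos hτ hu hv huv).ne',
    claspX_mul_sqrt hτ hu.le hv.le huv]

theorem continuousOn_contactHeight_sub (hτ : τ ∈ Ioc 0 1) :
    ContinuousOn (fun u => contactHeight τ u (τ - u)) (Icc 0 τ) := by
  have hX : ContinuousOn (claspX τ) (Icc 0 τ) := fun u hu =>
    (hasDerivAt_claspX hτ (by rw [abs_of_nonneg hu.1]; exact hu.2.trans hτ.2)).continuousAt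
      |>.continuousWithinAt
  have hX' : ContinuousOn (fun u => claspX τ (τ - u)) (Icc 0 τ) :=
    hX.comp (by fun_prop) fun u hu => ⟨by linarith [hu.2], by linarith [hu.1]⟩
  exact ((continuousOn_const.sub (hX.pow 2)).sub (hX'.pow 2)).sqrt

theorem hasDerivAt_contact_heights (hτ : τ ∈ Ioc 0 1) (hu : u ∈ Ioo 0 τ) :
    HasDerivAt (fun u => claspZ τ (Real.arcsin u) + claspZ τ (Real.arcsin (τ - u)) +
      contactHeight τ u (τ - u)) 0 u := by
  have hu' : τ - u ∈ Ioo 0 τ := ⟨by linarith [hu.2], by linarith [hu.1]⟩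
  have hsum : u + (τ - u) = τ := add_sub_cancel u τ
  have hH := contactHeight_pos hτ hu.1 hu'.1 hsum
  have hrad : 0 < 1 - claspX τ u ^ 2 - claspX τ (τ - u) ^ 2 := Real.sqrt_pos.1 hH
  have hsub : HasDerivAt (fun u => τ - u) (-1) u := by simpa using (hasDerivAt_id u).const_sub τ
  have hX := hasDerivAt_claspX_of_pos hτ ⟨hu.1, hu.2.le.trans hτ.2⟩
  have hX' := (hasDerivAt_claspX_of_pos hτ ⟨hu'.1, hu'.2.le.trans hτ.2⟩).comp u hsub
  have hZ := hasDerivAt_claspZ_arcsin hτ ⟨hu.1, hu.2.trans_le hτ.2⟩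
  have hZ' := (hasDerivAt_claspZ_arcsin hτ ⟨hu'.1, hu'.2.trans_le hτ.2⟩).comp u hsub
  have hheight := (((hX.pow 2).const_sub 1).sub (hX'.pow 2)).sqrt hrad.ne'
  refine ((hZ.add hZ').add hheight).congr_deriv ?_
  rw [div_sqrt_eq_claspX_div_contactHeight hτ hu.1 hu'.1 hsum,
    div_sqrt_eq_claspX_div_contactHeight hτ hu'.1 hu.1 (sub_add_cancel τ u), contactHeight_comm τ
      (τ - u)]
  change _ + (_ : ℝ) / (2 * contactHeight τ u (τ - u)) = 0
  simp only [Function.comp]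
  field_simp
  ring

theorem claspGap_eq (hτ : τ ∈ Ioc 0 1) (hu : 0 ≤ u) (hv : 0 ≤ v) (huv : u + v = τ) :
    claspGap τ = claspZ τ (Real.arcsin u) + claspZ τ (Real.arcsin v) + contactHeight τ u v := by
  obtain rfl : v = τ - u := eq_sub_of_add_eq' huv
  set W : ℝ → ℝ := fun u =>
    claspZ τ (Real.arcsin u) + claspZ τ (Real.arcsin (τ - u)) + contactHeight τ u (τ - u) with hW
  have hZ : Continuous fun u => claspZ τ (Real.arcsin u) :=
    (continuous_claspZ hτ).comp Real.continuous_arcsin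
  have hcont : ContinuousOn W (Icc 0 τ) :=
    (hZ.add (hZ.comp (by fun_prop : Continuous fun u => τ - u))).continuousOn.add
      (continuousOn_contactHeight_sub hτ)
  have hconst : ∫ _ in u..τ, (0 : ℝ) = W τ - W u :=
    intervalIntegral.integral_eq_sub_of_hasDerivAt_of_le (by linarith)
      (hcont.mono (Icc_subset_Icc_left hu))
      (fun x hx => hasDerivAt_contact_heights hτ ⟨hu.trans_lt hx.1, hx.2⟩) (by simp)
  rw [intervalIntegral.integral_zero] at hconst
  change _ = W u
  rw [← sub_eq_zero.1 hconst.symm]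
  simp [hW, contactHeight_self_zero hτ.1.le, claspGap, claspZ_zero]

theorem arcsin_mem_Icc_arcsin (hu : u ∈ Icc 0 τ) : Real.arcsin u ∈ Icc 0 (Real.arcsin τ) :=
  ⟨Real.arcsin_nonneg.2 hu.1, Real.monotone_arcsin hu.2⟩

end Contact

/-- The angle of the tangent at the point of one arc of a `τ`-clasp that is in contact with the
point of the other arc whose tangent has angle `s ≥ 0`. -/
def contactAngle (τ s : ℝ) : ℝ := Real.arcsin (τ - Real.sin s)

/-- The squared distance between points of the two arcs of a `τ`-clasp, with tangents of angles `s`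
and `t`. -/
def claspDistSq (τ s t : ℝ) : ℝ :=
  claspX τ (Real.sin s) ^ 2 + claspX τ (Real.sin t) ^ 2 +
    (claspGap τ - claspZ τ s - claspZ τ t) ^ 2

section ClaspDist

variable {τ s t : ℝ}

theorem arcsin_sin_of_mem_Icc_arcsin (hs : s ∈ Icc 0 (Real.arcsin τ)) :
    Real.arcsin (Real.sin s) = s :=
  Real.arcsin_sin (by linarith [hs.1, Real.pi_pos])
    (hs.2.trans (Real.arcsin_le_pi_div_two τ))

theorem sub_sin_mem_Icc (hs : s ∈ Icc 0 (Real.arcsin τ)) : τ - Real.sin s ∈ Icc 0 τ := by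
  have hsin := sin_mem_Icc_of_mem_Icc_arcsin hs
  exact ⟨sub_nonneg.2 hsin.2, sub_le_self _ hsin.1⟩

theorem contactAngle_mem_Icc (hs : s ∈ Icc 0 (Real.arcsin τ)) :
    contactAngle τ s ∈ Icc 0 (Real.arcsin τ) :=
  arcsin_mem_Icc_arcsin (sub_sin_mem_Icc hs)

theorem sin_contactAngle (hτ : τ ∈ Ioc 0 1) (hs : s ∈ Icc 0 (Real.arcsin τ)) :
    Real.sin (contactAngle τ s) = τ - Real.sin s := by
  have hmem := sub_sin_mem_Icc hs
  exact Real.sin_arcsin (by linarith [hmem.1]) (hmem.2.trans hτ.2)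

theorem contactAngle_contactAngle (hτ : τ ∈ Ioc 0 1) (hs : s ∈ Icc 0 (Real.arcsin τ)) :
    contactAngle τ (contactAngle τ s) = s := by
  rw [contactAngle, sin_contactAngle hτ hs, sub_sub_cancel, arcsin_sin_of_mem_Icc_arcsin hs]

theorem antitoneOn_contactAngle (τ : ℝ) :
    AntitoneOn (contactAngle τ) (Icc 0 (Real.arcsin τ)) := fun s hs t ht hst =>
  Real.monotone_arcsin <| sub_le_sub_left (Real.sin_le_sin_of_le_of_le_pi_div_two
    (by linarith [hs.1, Real.pi_pos]) (ht.2.trans (Real.arcsin_le_pi_div_two τ)) hst) τ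

theorem claspGap_eq_contactAngle (hτ : τ ∈ Ioc 0 1) (hs : s ∈ Icc 0 (Real.arcsin τ)) :
    claspGap τ = claspZ τ s + claspZ τ (contactAngle τ s) +
      contactHeight τ (Real.sin s) (τ - Real.sin s) := by
  rw [claspGap_eq hτ (sin_mem_Icc_of_mem_Icc_arcsin hs).1 (sub_sin_mem_Icc hs).1
    (add_sub_cancel _ _), arcsin_sin_of_mem_Icc_arcsin hs, contactAngle]

theorem claspDistSq_contactAngle (hτ : τ ∈ Ioc 0 1) (ht : t ∈ Icc 0 (Real.arcsin τ)) :
    claspDistSq τ (contactAngle τ t) t = 1 := by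
  rw [claspDistSq, sin_contactAngle hτ ht, claspGap_eq_contactAngle hτ ht,
    ← claspX_sq_add_claspX_sq_add_contactHeight_sq hτ (sin_mem_Icc_of_mem_Icc_arcsin ht).1
      (sub_sin_mem_Icc ht).1 (add_sub_cancel _ _)]
  ring

theorem hasDerivAt_claspDistSq (hτ : τ ∈ Ioc 0 1) (hs : s ∈ Icc 0 (Real.arcsin τ)) (t : ℝ) :
    HasDerivAt (claspDistSq τ · t) (2 * claspSpeed τ s * Real.sin s *
      (claspZ τ t - claspZ τ (contactAngle τ s))) s := by
  have hderiv := (((hasDerivAt_claspX_sin hτ s).pow 2).add_const (claspX τ (Real.sin t) ^ 2)).add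
    ((((hasDerivAt_claspZ hτ s).const_sub (claspGap τ)).sub_const (claspZ τ t)).pow 2)
  refine hderiv.congr_deriv ?_
  have hnormal := claspX_mul_sqrt hτ (sin_mem_Icc_of_mem_Icc_arcsin hs).1 (sub_sin_mem_Icc hs).1
    (add_sub_cancel _ _)
  rw [← Real.cos_eq_sqrt_one_sub_sin_sq (by linarith [hs.1, Real.pi_pos])
    (hs.2.trans (Real.arcsin_le_pi_div_two τ))] at hnormal
  push_cast
  linear_combination 2 * claspSpeed τ s * hnormal -
    2 * claspSpeed τ s * Real.sin s * claspGap_eq_contactAngle hτ hs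

theorem claspSpeed_mul_sin_pos (hτ : τ ∈ Ioc 0 1) (hs : s ∈ Ioc 0 (Real.arcsin τ)) :
    0 < 2 * claspSpeed τ s * Real.sin s := by
  have hspeed := claspSpeed_pos hτ hs.1.ne' (by rw [abs_of_pos hs.1]; exact hs.2)
  have hsin := (sin_mem_Ioc_of_mem_Ioc_arcsin hs).1
  positivity

/-- For a fixed point of one arc, the distance decreases up to the point in contact with it, and
increases from there on. -/
theorem one_le_claspDistSq_of_mem_Icc (hτ : τ ∈ Ioc 0 1) (hs : s ∈ Icc 0 (Real.arcsin τ))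
    (ht : t ∈ Icc 0 (Real.arcsin τ)) : 1 ≤ claspDistSq τ s t := by
  set m := contactAngle τ t
  have hm : m ∈ Icc 0 (Real.arcsin τ) := contactAngle_mem_Icc ht
  have hmt : contactAngle τ m = t := contactAngle_contactAngle hτ ht
  have hmono := (strictMonoOn_claspZ hτ).monotoneOn
  have hcont : ContinuousOn (claspDistSq τ · t) (Icc 0 (Real.arcsin τ)) := fun x hx =>
    (hasDerivAt_claspDistSq hτ hx t).continuousAt.continuousWithinAt
  let D x := 2 * claspSpeed τ x * Real.sin x * (claspZ τ t - claspZ τ (contactAngle τ x))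
  rw [← claspDistSq_contactAngle hτ ht]
  rcases le_total s m with hsm | hms
  · refine antitoneOn_of_hasDerivWithinAt_nonpos (f' := D) (convex_Icc 0 m)
      (hcont.mono (Icc_subset_Icc_right hm.2)) (fun x hx => ?_) (fun x hx => ?_)
      ⟨hs.1, hsm⟩ ⟨hm.1, le_rfl⟩ hsm <;> rw [interior_Icc] at hx
    · exact (hasDerivAt_claspDistSq hτ ⟨hx.1.le, hx.2.le.trans hm.2⟩ t).hasDerivWithinAt
    · have hxI : x ∈ Icc 0 (Real.arcsin τ) := ⟨hx.1.le, hx.2.le.trans hm.2⟩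
      have hle : t ≤ contactAngle τ x := hmt ▸ antitoneOn_contactAngle τ hxI hm hx.2.le
      exact mul_nonpos_of_nonneg_of_nonpos (claspSpeed_mul_sin_pos hτ ⟨hx.1, hxI.2⟩).le
        (sub_nonpos.2 (hmono ht (contactAngle_mem_Icc hxI) hle))
  · refine monotoneOn_of_hasDerivWithinAt_nonneg (f' := D) (convex_Icc m (Real.arcsin τ))
      (hcont.mono (Icc_subset_Icc_left hm.1)) (fun x hx => ?_) (fun x hx => ?_)
      ⟨le_rfl, hm.2⟩ ⟨hms, hs.2⟩ hms <;> rw [interior_Icc] at hx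
    · exact (hasDerivAt_claspDistSq hτ ⟨hm.1.trans hx.1.le, hx.2.le⟩ t).hasDerivWithinAt
    · have hxI : x ∈ Icc 0 (Real.arcsin τ) := ⟨hm.1.trans hx.1.le, hx.2.le⟩
      have hle : contactAngle τ x ≤ t := hmt ▸ antitoneOn_contactAngle τ hm hxI hx.1.le
      exact mul_nonneg (claspSpeed_mul_sin_pos hτ ⟨hm.1.trans_lt hx.1, hxI.2⟩).le
        (sub_nonneg.2 (hmono (contactAngle_mem_Icc hxI) ht hle))

theorem claspX_sin_abs_sq (τ s : ℝ) :
    claspX τ (Real.sin |s|) ^ 2 = claspX τ (Real.sin s) ^ 2 := by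
  rcases abs_choice s with h | h <;> rw [h]
  rw [Real.sin_neg, claspX_neg, neg_sq]

theorem one_le_claspDistSq (hτ : τ ∈ Ioc 0 1) (hs : |s| ≤ Real.arcsin τ)
    (ht : |t| ≤ Real.arcsin τ) : 1 ≤ claspDistSq τ s t := by
  simpa only [claspDistSq, claspX_sin_abs_sq, claspZ_abs hτ] using
    one_le_claspDistSq_of_mem_Icc hτ ⟨abs_nonneg s, hs⟩ ⟨abs_nonneg t, ht⟩

end ClaspDist

/-! ### Coordinates -/

theorem vec3_eq (a b c : ℝ) : (!₂[a, b, c] : E3) = a • EuclideanSpace.single 0 1 +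
    b • EuclideanSpace.single 1 1 + c • EuclideanSpace.single 2 1 := by
  ext i
  fin_cases i <;> simp

theorem smul_vec3 (r a b c : ℝ) : r • (!₂[a, b, c] : E3) = !₂[r * a, r * b, r * c] := by
  ext i
  fin_cases i <;> simp

theorem neg_vec3 (a b c : ℝ) : -(!₂[a, b, c] : E3) = !₂[-a, -b, -c] := by
  rw [← neg_one_smul ℝ, smul_vec3, neg_one_mul, neg_one_mul, neg_one_mul]

theorem hasDerivAt_vec3 {f g h : ℝ → ℝ} {f' g' h' s : ℝ} (hf : HasDerivAt f f' s)
    (hg : HasDerivAt g g' s) (hh : HasDerivAt h h' s) :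
    HasDerivAt (fun s => (!₂[f s, g s, h s] : E3)) !₂[f', g', h'] s := by
  simp only [vec3_eq]
  exact ((hf.smul_const _).add (hg.smul_const _)).add (hh.smul_const _)

theorem inner_vec3 (x y : E3) : ⟪x, y⟫ = x 0 * y 0 + x 1 * y 1 + x 2 * y 2 := by
  simp [PiLp.inner_apply, Fin.sum_univ_three, mul_comm]

theorem norm_sq_vec3 (x : E3) : ‖x‖ ^ 2 = x 0 ^ 2 + x 1 ^ 2 + x 2 ^ 2 := by
  rw [← real_inner_self_eq_norm_sq, inner_vec3]
  ring

theorem dist_sq_vec3 (x y : E3) :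
    dist x y ^ 2 = (x 0 - y 0) ^ 2 + (x 1 - y 1) ^ 2 + (x 2 - y 2) ^ 2 := by
  rw [dist_eq_norm, norm_sq_vec3]
  rfl

/-- The reflection in the plane `z = 0` as a linear isometry. -/
def reflZEquiv : E3 ≃ₗᵢ[ℝ] E3 where
  toFun := reflZ
  invFun := reflZ
  map_add' x y := by ext i; fin_cases i <;> simp [reflZ, add_comm]
  map_smul' r x := by ext i; fin_cases i <;> simp [reflZ]
  left_inv x := by ext i; fin_cases i <;> simp [reflZ]
  right_inv x := by ext i; fin_cases i <;> simp [reflZ]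
  norm_map' x := by
    refine (sq_eq_sq₀ (norm_nonneg _) (norm_nonneg _)).1 ?_
    change ‖reflZ x‖ ^ 2 = _
    rw [norm_sq_vec3, norm_sq_vec3]
    simp [reflZ]

theorem reflZ_vec3 (a b c : ℝ) : reflZ !₂[a, b, c] = !₂[a, b, -c] := by simp [reflZ]

theorem reflZ_reflZ (x : E3) : reflZ (reflZ x) = x := reflZEquiv.symm_apply_apply x

theorem dist_reflZ (x y : E3) : dist (reflZ x) (reflZ y) = dist x y := reflZEquiv.dist_map x y

theorem dist_reflZ_right (x y : E3) : dist x (reflZ y) = dist (reflZ x) y := by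
  rw [← dist_reflZ, reflZ_reflZ]

theorem inner_reflZ (x y : E3) : ⟪reflZ x, reflZ y⟫ = ⟪x, y⟫ := reflZEquiv.inner_map_map x y

theorem inner_reflZ_right (x y : E3) : ⟪x, reflZ y⟫ = ⟪reflZ x, y⟫ := by
  rw [← inner_reflZ, reflZ_reflZ]

theorem norm_reflZ (x : E3) : ‖reflZ x‖ = ‖x‖ := reflZEquiv.norm_map x

theorem reflZ_smul (r : ℝ) (x : E3) : reflZ (r • x) = r • reflZ x := reflZEquiv.map_smul r x

theorem reflZ_neg (x : E3) : reflZ (-x) = -reflZ x := map_neg reflZEquiv x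

theorem reflZ_sub (x y : E3) : reflZ (x - y) = reflZ x - reflZ y := map_sub reflZEquiv x y

theorem hasDerivAt_reflZ {f : ℝ → E3} {f' : E3} {s : ℝ} (hf : HasDerivAt f f' s) :
    HasDerivAt (fun s => reflZ (f s)) (reflZ f') s :=
  (reflZEquiv : E3 →L[ℝ] E3).hasFDerivAt.comp_hasDerivAt s hf

/-! ### Lipschitz functions -/

/-- Functions on the line that are Lipschitz with some constant. None of the constants matters, and
leaving them implicit makes the class closed under the operations used to build the curves. -/
def IsLip {V : Type*} [PseudoEMetricSpace V] (f : ℝ → V) : Prop := ∃ K, LipschitzWith K f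

namespace IsLip

variable {V : Type*} [SeminormedAddCommGroup V]

theorem id : IsLip fun s : ℝ => s := ⟨1, LipschitzWith.id⟩

theorem const {V : Type*} [PseudoEMetricSpace V] (v : V) : IsLip fun _ : ℝ => v :=
  ⟨0, LipschitzWith.const v⟩

theorem add {f g : ℝ → V} (hf : IsLip f) (hg : IsLip g) : IsLip fun s => f s + g s :=
  ⟨_, hf.choose_spec.add hg.choose_spec⟩

theorem sub {f g : ℝ → V} (hf : IsLip f) (hg : IsLip g) : IsLip fun s => f s - g s :=
  ⟨_, hf.choose_spec.sub hg.choose_spec⟩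

theorem neg {f : ℝ → V} (hf : IsLip f) : IsLip fun s => -f s := ⟨_, hf.choose_spec.neg⟩

theorem comp {V : Type*} [PseudoEMetricSpace V] {f : ℝ → V} {g : ℝ → ℝ} (hf : IsLip f)
    (hg : IsLip g) : IsLip fun s => f (g s) :=
  ⟨_, hf.choose_spec.comp hg.choose_spec⟩

theorem mul_const {f : ℝ → ℝ} (hf : IsLip f) (c : ℝ) : IsLip fun s => f s * c :=
  ⟨_, ((ContinuousLinearMap.mul ℝ ℝ).flip c).lipschitz.comp hf.choose_spec⟩

theorem smul_const [NormedSpace ℝ V] {f : ℝ → ℝ} (hf : IsLip f) (v : V) : IsLip fun s => f s • v :=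
  ⟨_, (ContinuousLinearMap.toSpanSingleton ℝ v).lipschitz.comp hf.choose_spec⟩

theorem vec3 {f g h : ℝ → ℝ} (hf : IsLip f) (hg : IsLip g) (hh : IsLip h) :
    IsLip fun s => (!₂[f s, g s, h s] : E3) := by
  simp only [vec3_eq]
  exact ((hf.smul_const _).add (hg.smul_const _)).add (hh.smul_const _)

theorem reflZ {f : ℝ → E3} (hf : IsLip f) : IsLip fun s => reflZ (f s) :=
  ⟨_, reflZEquiv.lipschitz.comp hf.choose_spec⟩

theorem abs : IsLip fun s : ℝ => |s| := ⟨1, lipschitzWith_one_norm⟩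

theorem min {f : ℝ → ℝ} (hf : IsLip f) (c : ℝ) : IsLip fun s => min (f s) c :=
  ⟨_, hf.choose_spec.min_const c⟩

theorem max {f : ℝ → ℝ} (hf : IsLip f) (c : ℝ) : IsLip fun s => max c (f s) :=
  ⟨_, hf.choose_spec.const_max c⟩

theorem of_deriv {f f' : ℝ → ℝ} (hf : ∀ s, HasDerivAt f (f' s) s) {M : ℝ}
    (hM : ∀ s, |f' s| ≤ M) : IsLip f := by
  refine ⟨M.toNNReal, lipschitzWith_of_nnnorm_deriv_le (fun s => (hf s).differentiableAt)
    fun s => ?_⟩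
  rw [(hf s).deriv, ← NNReal.coe_le_coe, coe_nnnorm]
  exact (hM s).trans (Real.le_coe_toNNReal M)

end IsLip

theorem isLip_sin : IsLip Real.sin :=
  IsLip.of_deriv Real.hasDerivAt_sin Real.abs_cos_le_one

theorem isLip_cos : IsLip Real.cos :=
  IsLip.of_deriv Real.hasDerivAt_cos fun s => by rw [abs_neg]; exact Real.abs_sin_le_one s

theorem exists_claspSpeed_le {τ : ℝ} (hτ : τ ∈ Ioc 0 1) : ∃ M, ∀ s, |claspSpeed τ s| ≤ M := by
  obtain ⟨M, hM⟩ := isCompact_Icc.exists_bound_of_continuousOn (continuousOn_claspXDeriv hτ)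
  exact ⟨M, fun s => hM _ ⟨abs_nonneg _, Real.abs_sin_le_one s⟩⟩

theorem isLip_claspX_sin {τ : ℝ} (hτ : τ ∈ Ioc 0 1) : IsLip fun s => claspX τ (Real.sin s) := by
  obtain ⟨M, hM⟩ := exists_claspSpeed_le hτ
  refine IsLip.of_deriv (hasDerivAt_claspX_sin hτ) (M := M) fun s => ?_
  rw [abs_mul]
  exact (mul_le_of_le_one_right (abs_nonneg _) (Real.abs_cos_le_one s)).trans (hM s)

theorem isLip_claspZ {τ : ℝ} (hτ : τ ∈ Ioc 0 1) : IsLip (claspZ τ) := by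
  obtain ⟨M, hM⟩ := exists_claspSpeed_le hτ
  refine IsLip.of_deriv (hasDerivAt_claspZ hτ) (M := M) fun s => ?_
  rw [abs_mul]
  exact (mul_le_of_le_one_left (abs_nonneg _) (Real.abs_sin_le_one s)).trans (hM s)

/-! ### Truncation to a symmetric interval -/

section Clamp

variable {r s : ℝ}

/-- The nearest point of `[-r, r]`. Composing with it extends a curve by its values at the end
points of the interval. -/
def clamp (r s : ℝ) : ℝ := max (-r) (min s r)

theorem isLip_clamp (r : ℝ) : IsLip (clamp r) := (IsLip.id.min r).max (-r)

theorem clamp_of_abs_le (h : |s| ≤ r) : clamp r s = s := by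
  rw [clamp, min_eq_left (abs_le.1 h).2, max_eq_right (abs_le.1 h).1]

theorem clamp_of_le (hr : 0 ≤ r) (h : r ≤ s) : clamp r s = r := by
  rw [clamp, min_eq_right h, max_eq_right (by linarith)]

theorem clamp_of_le_neg (hr : 0 ≤ r) (h : s ≤ -r) : clamp r s = -r := by
  rw [clamp, min_eq_left (by linarith), max_eq_left h]

theorem clamp_of_le_abs (hr : 0 < r) (h : r ≤ |s|) : clamp r s = SignType.sign s * r := by
  rcases le_abs'.1 h with h | h
  · rw [clamp_of_le_neg hr.le h, sign_neg (by linarith)]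
    simp
  · rw [clamp_of_le hr.le h, sign_pos (by linarith)]
    simp

theorem clamp_neg (hr : 0 < r) (s : ℝ) : clamp r (-s) = -clamp r s := by
  rcases le_total |s| r with h | h
  · rw [clamp_of_abs_le h, clamp_of_abs_le (by rwa [abs_neg])]
  · rw [clamp_of_le_abs hr h, clamp_of_le_abs hr (by rwa [abs_neg]), Left.sign_neg]
    simp

theorem sub_clamp_of_le_abs (hr : 0 < r) (h : r ≤ |s|) :
    s - clamp r s = SignType.sign s * (|s| - r) := by
  rw [clamp_of_le_abs hr h, mul_sub, sign_mul_abs]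

theorem abs_sub_clamp_of_le_abs (hr : 0 < r) (h : r ≤ |s|) : |s - clamp r s| = |s| - r := by
  rcases le_abs'.1 h with h' | h'
  · rw [clamp_of_le_neg hr.le h', abs_of_nonpos (a := s) (by linarith), abs_of_nonpos (by linarith)]
    ring
  · rw [clamp_of_le hr.le h', abs_of_nonneg (a := s) (by linarith), abs_of_nonneg (by linarith)]

theorem sin_clamp_of_le_abs (hr : 0 < r) (h : r ≤ |s|) :
    Real.sin (clamp r s) = SignType.sign s * Real.sin r := by
  rw [clamp_of_le_abs hr h]
  rcases SignType.sign s <;> simp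

theorem cos_clamp_of_le_abs (hr : 0 < r) (h : r ≤ |s|) : Real.cos (clamp r s) = Real.cos r := by
  rcases le_abs'.1 h with h | h
  · rw [clamp_of_le_neg hr.le h, Real.cos_neg]
  · rw [clamp_of_le hr.le h]

theorem hasDerivAt_clamp_of_abs_lt (h : |s| < r) : HasDerivAt (clamp r) 1 s := by
  refine (hasDerivAt_id s).congr_of_eventuallyEq ?_
  filter_upwards [continuous_abs.continuousAt.eventually_lt_const h] with x hx
  exact clamp_of_abs_le hx.le

theorem hasDerivAt_clamp_of_lt_abs (hr : 0 ≤ r) (h : r < |s|) : HasDerivAt (clamp r) 0 s := by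
  rcases lt_abs.1 h with h | h
  · refine (hasDerivAt_const s r).congr_of_eventuallyEq ?_
    filter_upwards [eventually_gt_nhds h] with x hx
    exact clamp_of_le hr hx.le
  · refine (hasDerivAt_const s (-r)).congr_of_eventuallyEq ?_
    filter_upwards [eventually_lt_nhds (lt_neg.1 h)] with x hx
    exact clamp_of_le_neg hr hx.le

theorem hasDerivAt_abs_sub_clamp_of_abs_lt (h : |s| < r) :
    HasDerivAt (fun s => |s - clamp r s|) 0 s := by
  refine (hasDerivAt_const s (0 : ℝ)).congr_of_eventuallyEq ?_
  filter_upwards [continuous_abs.continuousAt.eventually_lt_const h] with x hx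
  rw [clamp_of_abs_le hx.le, sub_self, abs_zero]

theorem hasDerivAt_abs_sub_clamp_of_lt_abs (hr : 0 < r) (h : r < |s|) :
    HasDerivAt (fun s => |s - clamp r s|) (SignType.sign s : ℝ) s := by
  refine ((hasDerivAt_abs (abs_pos.1 (hr.trans h))).sub_const r).congr_of_eventuallyEq ?_
  filter_upwards [continuous_abs.continuousAt.eventually_const_lt h] with x hx
  exact abs_sub_clamp_of_le_abs hr hx.le

end Clamp

/-! ### The curves of the chained clasp -/

/-- The coordinate `x₂` of `γ`. -/
def gammaX (τ s : ℝ) : ℝ :=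
  claspX τ (Real.sin (clamp (Real.arcsin τ) s)) + (s - clamp (Real.arcsin τ) s) * √(1 - τ ^ 2)

/-- The height of `γ` above its tip. -/
def gammaHeight (τ s : ℝ) : ℝ :=
  claspZ τ (clamp (Real.arcsin τ) s) + |s - clamp (Real.arcsin τ) s| * τ

/-- The coordinate `x₁` of the upper half of `α`. -/
def alphaX (τ s : ℝ) : ℝ :=
  claspX τ (Real.sin (clamp (Real.arcsin τ) s)) + Real.sin (clamp (Real.pi / 2) s) -
    Real.sin (clamp (Real.arcsin τ) s)

/-- The height of the upper half of `α` above the tip of `γ`. -/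
def alphaHeight (τ s : ℝ) : ℝ :=
  claspGap τ - claspZ τ (clamp (Real.arcsin τ) s) + Real.cos (clamp (Real.pi / 2) s) -
    Real.cos (clamp (Real.arcsin τ) s) - |s - clamp (Real.pi / 2) s|

/-- The unit tangent vector of `γ`. -/
def gammaTangent (τ s : ℝ) : E3 :=
  !₂[0, Real.cos (clamp (Real.arcsin τ) s), Real.sin (clamp (Real.arcsin τ) s)]

/-- Half the length of the parameter interval of the upper half of `α`. -/
def alphaHalf (d : ℝ) : ℝ := Real.pi / 2 + d / 2

/-- The angle from the horizontal down to the tangent of `α`. It grows from `-π/2` to `π/2` on the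
upper half and on to `3π/2` on the lower half, and is constant on the vertical segments. -/
def alphaAngle (d s : ℝ) : ℝ :=
  clamp (Real.pi / 2) s + clamp (Real.pi / 2) (s - 2 * alphaHalf d) + Real.pi / 2

/-- The unit tangent vector of `α`. -/
def alphaTangent (d s : ℝ) : E3 := !₂[Real.cos (alphaAngle d s), 0, -Real.sin (alphaAngle d s)]

/-- The speed of `γ` and of the upper half of `α`. -/
def upperSpeed (τ s : ℝ) : ℝ := if |s| ≤ Real.arcsin τ then claspSpeed τ s else 1

/-- The speed of `α`. -/
def alphaSpeed (τ d s : ℝ) : ℝ :=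
  if s < alphaHalf d then upperSpeed τ s else upperSpeed τ (2 * alphaHalf d - s)

section Curves

variable {τ d s : ℝ}

theorem arcsin_pos (hτ : τ ∈ Ioc 0 1) : 0 < Real.arcsin τ := Real.arcsin_pos.2 hτ.1

theorem sin_arcsin_self (hτ : τ ∈ Ioc 0 1) : Real.sin (Real.arcsin τ) = τ :=
  Real.sin_arcsin (by linarith [hτ.1]) hτ.2

theorem claspX_sin_arcsin (hτ : τ ∈ Ioc 0 1) : claspX τ (Real.sin (Real.arcsin τ)) = τ := by
  rw [sin_arcsin_self hτ, claspX_self hτ.1.le]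

theorem claspZ_arcsin_eq (τ : ℝ) : claspZ τ (Real.arcsin τ) = claspGap τ - √(1 - τ ^ 2) := by
  rw [claspGap, add_sub_cancel_right]

theorem claspX_sin_clamp_of_le_abs (hτ : τ ∈ Ioc 0 1) (h : Real.arcsin τ ≤ |s|) :
    claspX τ (Real.sin (clamp (Real.arcsin τ) s)) = SignType.sign s * τ := by
  rcases le_abs'.1 h with h | h
  · rw [clamp_of_le_neg (arcsin_pos hτ).le h, Real.sin_neg, claspX_neg, claspX_sin_arcsin hτ,
      sign_neg (by linarith [arcsin_pos hτ])]
    simp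
  · rw [clamp_of_le (arcsin_pos hτ).le h, claspX_sin_arcsin hτ,
      sign_pos (by linarith [arcsin_pos hτ])]
    simp

theorem claspZ_clamp_of_le_abs (hτ : τ ∈ Ioc 0 1) (h : Real.arcsin τ ≤ |s|) :
    claspZ τ (clamp (Real.arcsin τ) s) = claspZ τ (Real.arcsin τ) := by
  rcases le_abs'.1 h with h | h
  · rw [clamp_of_le_neg (arcsin_pos hτ).le h, claspZ_neg hτ]
  · rw [clamp_of_le (arcsin_pos hτ).le h]

theorem gammaX_of_abs_le (h : |s| ≤ Real.arcsin τ) : gammaX τ s = claspX τ (Real.sin s) := by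
  rw [gammaX, clamp_of_abs_le h, sub_self, zero_mul, add_zero]

theorem gammaX_of_le_abs (hτ : τ ∈ Ioc 0 1) (h : Real.arcsin τ ≤ |s|) :
    gammaX τ s = SignType.sign s * (τ + (|s| - Real.arcsin τ) * √(1 - τ ^ 2)) := by
  rw [gammaX, claspX_sin_clamp_of_le_abs hτ h, sub_clamp_of_le_abs (arcsin_pos hτ) h, mul_assoc,
    ← mul_add]

theorem gammaHeight_of_abs_le (h : |s| ≤ Real.arcsin τ) : gammaHeight τ s = claspZ τ s := by
  rw [gammaHeight, clamp_of_abs_le h, sub_self, abs_zero, zero_mul, add_zero]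

theorem gammaHeight_of_le_abs (hτ : τ ∈ Ioc 0 1) (h : Real.arcsin τ ≤ |s|) :
    gammaHeight τ s = claspZ τ (Real.arcsin τ) + (|s| - Real.arcsin τ) * τ := by
  rw [gammaHeight, claspZ_clamp_of_le_abs hτ h, abs_sub_clamp_of_le_abs (arcsin_pos hτ) h]

theorem alphaX_of_abs_le (h : |s| ≤ Real.arcsin τ) : alphaX τ s = claspX τ (Real.sin s) := by
  rw [alphaX, clamp_of_abs_le h, clamp_of_abs_le (h.trans (Real.arcsin_le_pi_div_two τ)),
    add_sub_cancel_right]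

theorem alphaX_of_abs_mem_Icc (hτ : τ ∈ Ioc 0 1) (h : |s| ∈ Icc (Real.arcsin τ) (Real.pi / 2)) :
    alphaX τ s = Real.sin s := by
  rw [alphaX, claspX_sin_clamp_of_le_abs hτ h.1, sin_clamp_of_le_abs (arcsin_pos hτ) h.1,
    sin_arcsin_self hτ, clamp_of_abs_le h.2, add_sub_cancel_left]

theorem alphaX_of_le_abs (hτ : τ ∈ Ioc 0 1) (h : Real.pi / 2 ≤ |s|) :
    alphaX τ s = SignType.sign s := by
  have hθ := (Real.arcsin_le_pi_div_two τ).trans h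
  rw [alphaX, claspX_sin_clamp_of_le_abs hτ hθ, sin_clamp_of_le_abs (arcsin_pos hτ) hθ,
    sin_arcsin_self hτ, sin_clamp_of_le_abs Real.pi_div_two_pos h, Real.sin_pi_div_two,
    add_sub_cancel_left, mul_one]

theorem alphaHeight_of_abs_le (h : |s| ≤ Real.arcsin τ) :
    alphaHeight τ s = claspGap τ - claspZ τ s := by
  rw [alphaHeight, clamp_of_abs_le h, clamp_of_abs_le (h.trans (Real.arcsin_le_pi_div_two τ)),
    sub_self, abs_zero, sub_zero, add_sub_cancel_right]

theorem alphaHeight_of_abs_mem_Icc (hτ : τ ∈ Ioc 0 1)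
    (h : |s| ∈ Icc (Real.arcsin τ) (Real.pi / 2)) : alphaHeight τ s = Real.cos s := by
  rw [alphaHeight, claspZ_clamp_of_le_abs hτ h.1, cos_clamp_of_le_abs (arcsin_pos hτ) h.1,
    clamp_of_abs_le h.2, claspZ_arcsin_eq, Real.cos_arcsin, sub_self, abs_zero]
  ring

theorem alphaHeight_of_le_abs (hτ : τ ∈ Ioc 0 1) (h : Real.pi / 2 ≤ |s|) :
    alphaHeight τ s = -(|s| - Real.pi / 2) := by
  have hθ := (Real.arcsin_le_pi_div_two τ).trans h
  rw [alphaHeight, claspZ_clamp_of_le_abs hτ hθ, cos_clamp_of_le_abs (arcsin_pos hτ) hθ,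
    cos_clamp_of_le_abs Real.pi_div_two_pos h, abs_sub_clamp_of_le_abs Real.pi_div_two_pos h,
    claspZ_arcsin_eq, Real.cos_arcsin, Real.cos_pi_div_two]
  ring

theorem gammaPath_eq (hτ : τ ∈ Ioc 0 1) (d s : ℝ) :
    gammaPath τ d s = !₂[0, gammaX τ s, d / 2 + gammaHeight τ s] := by
  unfold gammaPath
  split_ifs with h
  · rw [gammaX_of_abs_le h, gammaHeight_of_abs_le h]
  · have h := (not_le.1 h).le
    rw [gammaX_of_le_abs hτ h, gammaHeight_of_le_abs hτ h, add_assoc]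

theorem alphaUpper_eq (hτ : τ ∈ Ioc 0 1) (d s : ℝ) :
    alphaUpper τ d s = !₂[alphaX τ s, 0, d / 2 + alphaHeight τ s] := by
  unfold alphaUpper
  split_ifs with h h'
  · rw [alphaX_of_abs_le h, alphaHeight_of_abs_le h, add_sub_assoc]
  · have h := (not_le.1 h).le
    rw [alphaX_of_abs_mem_Icc hτ ⟨h, h'⟩, alphaHeight_of_abs_mem_Icc hτ ⟨h, h'⟩]
  · have h' := (not_le.1 h').le
    rw [alphaX_of_le_abs hτ h', alphaHeight_of_le_abs hτ h', sub_eq_add_neg]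

theorem alphaPath_of_le (h : s ≤ alphaHalf d) : alphaPath τ d s = alphaUpper τ d s := if_pos h

theorem pi_div_two_le_alphaHalf (hd : 0 ≤ d) : Real.pi / 2 ≤ alphaHalf d := by
  rw [alphaHalf]
  linarith

theorem alphaHalf_pos (hd : 0 ≤ d) : 0 < alphaHalf d :=
  Real.pi_div_two_pos.trans_le (pi_div_two_le_alphaHalf hd)

theorem alphaUpper_alphaHalf (hτ : τ ∈ Ioc 0 1) (hd : 0 ≤ d) :
    alphaUpper τ d (alphaHalf d) = !₂[1, 0, 0] := by
  have habs : |alphaHalf d| = alphaHalf d := abs_of_pos (alphaHalf_pos hd)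
  have hle : Real.pi / 2 ≤ |alphaHalf d| := (pi_div_two_le_alphaHalf hd).trans_eq habs.symm
  rw [alphaUpper_eq hτ, alphaX_of_le_abs hτ hle, alphaHeight_of_le_abs hτ hle,
    sign_pos (alphaHalf_pos hd), habs, alphaHalf]
  simp

theorem alphaPath_of_ge (hτ : τ ∈ Ioc 0 1) (hd : 0 ≤ d) (h : alphaHalf d ≤ s) :
    alphaPath τ d s = reflZ (alphaUpper τ d (2 * alphaHalf d - s)) := by
  rcases h.eq_or_lt with rfl | h
  · rw [alphaPath_of_le le_rfl, two_mul, add_sub_cancel_right, alphaUpper_alphaHalf hτ hd,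
      reflZ_vec3, neg_zero]
  · exact if_neg (not_le.2 h)

theorem alphaPath_reflect (hτ : τ ∈ Ioc 0 1) (hd : 0 ≤ d) (s : ℝ) :
    alphaPath τ d (2 * alphaHalf d - s) = reflZ (alphaPath τ d s) := by
  rcases le_total s (alphaHalf d) with h | h
  · rw [alphaPath_of_ge hτ hd (by linarith), alphaPath_of_le h, sub_sub_cancel]
  · rw [alphaPath_of_ge hτ hd h, alphaPath_of_le (by linarith), reflZ_reflZ]

theorem alphaPath_eq (hτ : τ ∈ Ioc 0 1) (hd : 0 ≤ d) (s : ℝ) :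
    alphaPath τ d s = alphaUpper τ d (min s (alphaHalf d)) +
      reflZ (alphaUpper τ d (min (2 * alphaHalf d - s) (alphaHalf d))) - !₂[1, 0, 0] := by
  have hhalf := alphaUpper_alphaHalf hτ hd
  rcases le_total s (alphaHalf d) with h | h
  · rw [alphaPath_of_le h, min_eq_left h, min_eq_right (by linarith), hhalf,
      reflZ_vec3, neg_zero, add_sub_cancel_right]
  · rw [alphaPath_of_ge hτ hd h, min_eq_right h, min_eq_left (by linarith), hhalf,
      add_sub_cancel_left]

theorem isLip_gammaPath (hτ : τ ∈ Ioc 0 1) (d : ℝ) : IsLip (gammaPath τ d) := by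
  have hp := isLip_clamp (Real.arcsin τ)
  have hq := IsLip.id.sub hp
  rw [funext (gammaPath_eq hτ d)]
  unfold gammaX gammaHeight
  exact IsLip.vec3 (IsLip.const 0) (((isLip_claspX_sin hτ).comp hp).add (hq.mul_const _))
    ((IsLip.const _).add (((isLip_claspZ hτ).comp hp).add ((IsLip.abs.comp hq).mul_const _)))

theorem isLip_alphaUpper (hτ : τ ∈ Ioc 0 1) (d : ℝ) : IsLip (alphaUpper τ d) := by
  have hp := isLip_clamp (Real.arcsin τ)
  have hp' := isLip_clamp (Real.pi / 2)
  rw [funext (alphaUpper_eq hτ d)]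
  unfold alphaX alphaHeight
  exact IsLip.vec3
    ((((isLip_claspX_sin hτ).comp hp).add (isLip_sin.comp hp')).sub (isLip_sin.comp hp))
    (IsLip.const 0)
    ((IsLip.const _).add (((((IsLip.const _).sub ((isLip_claspZ hτ).comp hp)).add
      (isLip_cos.comp hp')).sub (isLip_cos.comp hp)).sub (IsLip.abs.comp (IsLip.id.sub hp'))))

theorem isLip_alphaPath (hτ : τ ∈ Ioc 0 1) (hd : 0 ≤ d) : IsLip (alphaPath τ d) := by
  have h := isLip_alphaUpper hτ d
  rw [funext (alphaPath_eq hτ hd)]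
  exact ((h.comp (IsLip.id.min _)).add
    (h.comp (((IsLip.const _).sub IsLip.id).min _)).reflZ).sub (IsLip.const _)

theorem isLip_gammaTangent (τ : ℝ) : IsLip (gammaTangent τ) :=
  IsLip.vec3 (IsLip.const 0) (isLip_cos.comp (isLip_clamp _)) (isLip_sin.comp (isLip_clamp _))

theorem isLip_alphaTangent (d : ℝ) : IsLip (alphaTangent d) := by
  have h : IsLip (alphaAngle d) := ((isLip_clamp _).add
    ((isLip_clamp _).comp (IsLip.id.sub (IsLip.const _)))).add (IsLip.const _)
  exact IsLip.vec3 (isLip_cos.comp h) (IsLip.const 0) (isLip_sin.comp h).neg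

theorem norm_gammaTangent (τ s : ℝ) : ‖gammaTangent τ s‖ = 1 := by
  rw [← sq_eq_sq₀ (norm_nonneg _) zero_le_one, norm_sq_vec3]
  simp [gammaTangent]

theorem norm_alphaTangent (d s : ℝ) : ‖alphaTangent d s‖ = 1 := by
  rw [← sq_eq_sq₀ (norm_nonneg _) zero_le_one, norm_sq_vec3]
  simp [alphaTangent]

theorem upperSpeed_of_abs_le (hs : |s| ≤ Real.arcsin τ) : upperSpeed τ s = claspSpeed τ s :=
  if_pos hs

theorem upperSpeed_of_le_abs (hτ : τ ∈ Ioc 0 1) (hs : Real.arcsin τ ≤ |s|) :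
    upperSpeed τ s = 1 := by
  rcases hs.lt_or_eq with hs | hs
  · exact if_neg hs.not_ge
  · rw [upperSpeed_of_abs_le hs.ge, claspSpeed, Real.abs_sin_eq_sin_abs_of_abs_le_pi
      (by linarith [Real.arcsin_le_pi_div_two τ, Real.pi_pos]), ← hs, sin_arcsin_self hτ,
      claspXDeriv_self]

theorem upperSpeed_pos (hτ : τ ∈ Ioc 0 1) (hs : s ≠ 0) : 0 < upperSpeed τ s := by
  unfold upperSpeed
  split_ifs with h
  · exact claspSpeed_pos hτ hs h
  · exact one_pos

theorem hasDerivAt_gammaX (hτ : τ ∈ Ioc 0 1) (hs : |s| ≠ Real.arcsin τ) :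
    HasDerivAt (gammaX τ) (upperSpeed τ s * Real.cos (clamp (Real.arcsin τ) s)) s := by
  have hderiv {c : ℝ} (hc : HasDerivAt (clamp (Real.arcsin τ)) c s) :=
    ((hasDerivAt_claspX_sin hτ _).comp s hc).add
      (((hasDerivAt_id s).sub hc).mul_const √(1 - τ ^ 2))
  rcases hs.lt_or_gt with h | h
  · refine (hderiv (hasDerivAt_clamp_of_abs_lt h)).congr_deriv ?_
    rw [upperSpeed_of_abs_le h.le, clamp_of_abs_le h.le]
    ring
  · refine (hderiv (hasDerivAt_clamp_of_lt_abs (arcsin_pos hτ).le h)).congr_deriv ?_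
    rw [upperSpeed_of_le_abs hτ h.le, cos_clamp_of_le_abs (arcsin_pos hτ) h.le, Real.cos_arcsin]
    ring

theorem hasDerivAt_gammaHeight (hτ : τ ∈ Ioc 0 1) (hs : |s| ≠ Real.arcsin τ) :
    HasDerivAt (gammaHeight τ) (upperSpeed τ s * Real.sin (clamp (Real.arcsin τ) s)) s := by
  have hderiv {c c' : ℝ} (hc : HasDerivAt (clamp (Real.arcsin τ)) c s)
      (hc' : HasDerivAt (fun s => |s - clamp (Real.arcsin τ) s|) c' s) :=
    ((hasDerivAt_claspZ hτ _).comp s hc).add (hc'.mul_const τ)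
  rcases hs.lt_or_gt with h | h
  · refine (hderiv (hasDerivAt_clamp_of_abs_lt h)
      (hasDerivAt_abs_sub_clamp_of_abs_lt h)).congr_deriv ?_
    rw [upperSpeed_of_abs_le h.le, clamp_of_abs_le h.le]
    ring
  · refine (hderiv (hasDerivAt_clamp_of_lt_abs (arcsin_pos hτ).le h)
      (hasDerivAt_abs_sub_clamp_of_lt_abs (arcsin_pos hτ) h)).congr_deriv ?_
    rw [upperSpeed_of_le_abs hτ h.le, sin_clamp_of_le_abs (arcsin_pos hτ) h.le, sin_arcsin_self hτ]
    ring

theorem hasDerivAt_gammaPath (hτ : τ ∈ Ioc 0 1) (d : ℝ) (hs : |s| ≠ Real.arcsin τ) :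
    HasDerivAt (gammaPath τ d) (upperSpeed τ s • gammaTangent τ s) s := by
  rw [funext (gammaPath_eq hτ d), gammaTangent, smul_vec3, mul_zero]
  exact hasDerivAt_vec3 (hasDerivAt_const s 0) (hasDerivAt_gammaX hτ hs)
    ((hasDerivAt_gammaHeight hτ hs).const_add _)

theorem hasDerivAt_alphaX (hτ : τ ∈ Ioc 0 1) (hs : |s| ≠ Real.arcsin τ)
    (hs' : |s| ≠ Real.pi / 2) :
    HasDerivAt (alphaX τ) (upperSpeed τ s * Real.cos (clamp (Real.pi / 2) s)) s := by
  have hle := Real.arcsin_le_pi_div_two τ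
  have hderiv {c c' : ℝ} (hc : HasDerivAt (clamp (Real.arcsin τ)) c s)
      (hc' : HasDerivAt (clamp (Real.pi / 2)) c' s) :=
    (((hasDerivAt_claspX_sin hτ _).comp s hc).add ((Real.hasDerivAt_sin _).comp s hc')).sub
      ((Real.hasDerivAt_sin _).comp s hc)
  rcases hs.lt_or_gt with h | h
  · have h' := h.trans_le hle
    refine (hderiv (hasDerivAt_clamp_of_abs_lt h) (hasDerivAt_clamp_of_abs_lt h')).congr_deriv ?_
    rw [upperSpeed_of_abs_le h.le, clamp_of_abs_le h.le, clamp_of_abs_le h'.le]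
    ring
  have hclamp := hasDerivAt_clamp_of_lt_abs (arcsin_pos hτ).le h
  rw [upperSpeed_of_le_abs hτ h.le]
  rcases hs'.lt_or_gt with h' | h'
  · refine (hderiv hclamp (hasDerivAt_clamp_of_abs_lt h')).congr_deriv ?_
    ring
  · refine (hderiv hclamp (hasDerivAt_clamp_of_lt_abs Real.pi_div_two_pos.le h')).congr_deriv ?_
    rw [cos_clamp_of_le_abs Real.pi_div_two_pos h'.le, Real.cos_pi_div_two]
    ring

theorem hasDerivAt_alphaHeight (hτ : τ ∈ Ioc 0 1) (hs : |s| ≠ Real.arcsin τ)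
    (hs' : |s| ≠ Real.pi / 2) :
    HasDerivAt (alphaHeight τ) (upperSpeed τ s * -Real.sin (clamp (Real.pi / 2) s)) s := by
  have hle := Real.arcsin_le_pi_div_two τ
  have hderiv {c c' c'' : ℝ} (hc : HasDerivAt (clamp (Real.arcsin τ)) c s)
      (hc' : HasDerivAt (clamp (Real.pi / 2)) c' s)
      (hc'' : HasDerivAt (fun s => |s - clamp (Real.pi / 2) s|) c'' s) :=
    (((((hasDerivAt_claspZ hτ _).comp s hc).const_sub (claspGap τ)).add
      ((Real.hasDerivAt_cos _).comp s hc')).sub ((Real.hasDerivAt_cos _).comp s hc)).sub hc''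
  rcases hs.lt_or_gt with h | h
  · have h' := h.trans_le hle
    refine (hderiv (hasDerivAt_clamp_of_abs_lt h) (hasDerivAt_clamp_of_abs_lt h')
      (hasDerivAt_abs_sub_clamp_of_abs_lt h')).congr_deriv ?_
    rw [upperSpeed_of_abs_le h.le, clamp_of_abs_le h.le, clamp_of_abs_le h'.le]
    ring
  have hclamp := hasDerivAt_clamp_of_lt_abs (arcsin_pos hτ).le h
  rw [upperSpeed_of_le_abs hτ h.le]
  rcases hs'.lt_or_gt with h' | h'
  · refine (hderiv hclamp (hasDerivAt_clamp_of_abs_lt h')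
      (hasDerivAt_abs_sub_clamp_of_abs_lt h')).congr_deriv ?_
    ring
  · refine (hderiv hclamp (hasDerivAt_clamp_of_lt_abs Real.pi_div_two_pos.le h')
      (hasDerivAt_abs_sub_clamp_of_lt_abs Real.pi_div_two_pos h')).congr_deriv ?_
    rw [sin_clamp_of_le_abs Real.pi_div_two_pos h'.le, Real.sin_pi_div_two]
    ring

theorem hasDerivAt_alphaUpper (hτ : τ ∈ Ioc 0 1) (d : ℝ) (hs : |s| ≠ Real.arcsin τ)
    (hs' : |s| ≠ Real.pi / 2) :
    HasDerivAt (alphaUpper τ d) (upperSpeed τ s •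
      !₂[Real.cos (clamp (Real.pi / 2) s), 0, -Real.sin (clamp (Real.pi / 2) s)]) s := by
  rw [funext (alphaUpper_eq hτ d), smul_vec3, mul_zero]
  exact hasDerivAt_vec3 (hasDerivAt_alphaX hτ hs hs') (hasDerivAt_const s 0)
    ((hasDerivAt_alphaHeight hτ hs hs').const_add _)

theorem alphaAngle_of_le (hd : 0 ≤ d) (h : s ≤ alphaHalf d) :
    alphaAngle d s = clamp (Real.pi / 2) s := by
  rw [alphaAngle, clamp_of_le_neg Real.pi_div_two_pos.le (s := s - 2 * alphaHalf d)
    (by linarith [pi_div_two_le_alphaHalf hd]), neg_add_cancel_right]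

theorem alphaAngle_of_ge (hd : 0 ≤ d) (h : alphaHalf d ≤ s) :
    alphaAngle d s = Real.pi - clamp (Real.pi / 2) (2 * alphaHalf d - s) := by
  rw [alphaAngle, clamp_of_le Real.pi_div_two_pos.le ((pi_div_two_le_alphaHalf hd).trans h),
    ← neg_sub (2 * alphaHalf d), clamp_neg Real.pi_div_two_pos]
  ring

theorem hasDerivAt_alphaPath (hτ : τ ∈ Ioc 0 1) (hd : 0 ≤ d) (hs : s ≠ alphaHalf d)
    (hclasp : |s| ≠ Real.arcsin τ) (hcircle : |s| ≠ Real.pi / 2)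
    (hclasp' : |2 * alphaHalf d - s| ≠ Real.arcsin τ)
    (hcircle' : |2 * alphaHalf d - s| ≠ Real.pi / 2) :
    HasDerivAt (alphaPath τ d) (alphaSpeed τ d s • alphaTangent d s) s := by
  rcases hs.lt_or_gt with h | h
  · rw [alphaSpeed, if_pos h, alphaTangent, alphaAngle_of_le hd h.le]
    refine (hasDerivAt_alphaUpper hτ d hclasp hcircle).congr_of_eventuallyEq ?_
    filter_upwards [eventually_lt_nhds h] with x hx using alphaPath_of_le hx.le
  · rw [alphaSpeed, if_neg h.not_gt, alphaTangent, alphaAngle_of_ge hd h.le]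
    have hrefl : alphaPath τ d =ᶠ[𝓝 s] fun s => reflZ (alphaUpper τ d (2 * alphaHalf d - s)) := by
      filter_upwards [eventually_gt_nhds h] with x hx using alphaPath_of_ge hτ hd hx.le
    refine ((hasDerivAt_reflZ ((hasDerivAt_alphaUpper hτ d hclasp' hcircle').scomp s
      ((hasDerivAt_id s).const_sub _))).congr_of_eventuallyEq hrefl).congr_deriv ?_
    rw [reflZ_smul, reflZ_smul, reflZ_vec3, Real.cos_pi_sub, Real.sin_pi_sub]
    ext i
    fin_cases i <;> simp

theorem ae_abs_sub_ne (a r : ℝ) : ∀ᵐ s : ℝ, |s - a| ≠ r := by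
  filter_upwards [Measure.ae_ne volume (a + r), Measure.ae_ne volume (a - r)] with s hadd hsub h
  rcases eq_or_eq_neg_of_abs_eq h with h | h
  · exact hadd (by linarith)
  · exact hsub (by linarith)

theorem ae_hasDerivAt_gammaPath (hτ : τ ∈ Ioc 0 1) (d : ℝ) :
    ∀ᵐ s : ℝ, 0 < upperSpeed τ s ∧
      HasDerivAt (gammaPath τ d) (upperSpeed τ s • gammaTangent τ s) s := by
  filter_upwards [Measure.ae_ne volume 0, ae_abs_sub_ne 0 (Real.arcsin τ)] with s hne hclasp
  rw [sub_zero] at hclasp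
  exact ⟨upperSpeed_pos hτ hne, hasDerivAt_gammaPath hτ d hclasp⟩

theorem ae_hasDerivAt_alphaPath (hτ : τ ∈ Ioc 0 1) (hd : 0 ≤ d) :
    ∀ᵐ s : ℝ, 0 < alphaSpeed τ d s ∧
      HasDerivAt (alphaPath τ d) (alphaSpeed τ d s • alphaTangent d s) s := by
  filter_upwards [Measure.ae_ne volume 0, Measure.ae_ne volume (2 * alphaHalf d),
    Measure.ae_ne volume (alphaHalf d), ae_abs_sub_ne 0 (Real.arcsin τ),
    ae_abs_sub_ne 0 (Real.pi / 2), ae_abs_sub_ne (2 * alphaHalf d) (Real.arcsin τ),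
    ae_abs_sub_ne (2 * alphaHalf d) (Real.pi / 2)]
    with s htip htip' hhalf hclasp hcircle hclasp' hcircle'
  rw [sub_zero] at hclasp hcircle
  rw [abs_sub_comm] at hclasp' hcircle'
  refine ⟨?_, hasDerivAt_alphaPath hτ hd hhalf hclasp hcircle hclasp' hcircle'⟩
  unfold alphaSpeed
  split_ifs
  · exact upperSpeed_pos hτ htip
  · exact upperSpeed_pos hτ (sub_ne_zero.2 htip'.symm)

end Curves

/-! ### Distances between the components -/

section Distances

variable {τ c d s t : ℝ}

theorem sq_sqrt_one_sub_sq (hτ : τ ∈ Ioc 0 1) : √(1 - τ ^ 2) ^ 2 = 1 - τ ^ 2 :=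
  Real.sq_sqrt (sub_nonneg.2 (pow_le_one₀ hτ.1.le hτ.2))

theorem abs_arcsin_self (hτ : τ ∈ Ioc 0 1) : |Real.arcsin τ| = Real.arcsin τ :=
  abs_of_pos (arcsin_pos hτ)

theorem cos_mem_Icc_of_abs_mem_Icc (hs : |s| ∈ Icc (Real.arcsin τ) (Real.pi / 2)) (hτ : 0 ≤ τ) :
    Real.cos s ∈ Icc 0 √(1 - τ ^ 2) := by
  rw [← Real.cos_arcsin, ← Real.cos_abs s]
  exact ⟨Real.cos_nonneg_of_neg_pi_div_two_le_of_le (by linarith [abs_nonneg s, Real.pi_pos]) hs.2,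
    Real.cos_le_cos_of_nonneg_of_le_pi (Real.arcsin_nonneg.2 hτ) (by linarith [hs.2, Real.pi_pos])
      hs.1⟩

theorem gammaHeight_pos (hτ : τ ∈ Ioc 0 1) (hs : s ≠ 0) : 0 < gammaHeight τ s := by
  have hpos {r : ℝ} (hr : r ∈ Ioc 0 (Real.arcsin τ)) : 0 < claspZ τ r := by
    rw [← claspZ_zero τ]
    exact strictMonoOn_claspZ hτ ⟨le_rfl, (arcsin_pos hτ).le⟩ ⟨hr.1.le, hr.2⟩ hr.1
  rcases le_total |s| (Real.arcsin τ) with h | h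
  · rw [gammaHeight_of_abs_le h, ← claspZ_abs hτ]
    exact hpos ⟨abs_pos.2 hs, h⟩
  · rw [gammaHeight_of_le_abs hτ h]
    exact add_pos_of_pos_of_nonneg (hpos ⟨arcsin_pos hτ, le_rfl⟩)
      (mul_nonneg (sub_nonneg.2 h) hτ.1.le)

theorem gammaHeight_zero (hτ : τ ∈ Ioc 0 1) : gammaHeight τ 0 = 0 := by
  rw [gammaHeight_of_abs_le (by simpa using (arcsin_pos hτ).le), claspZ_zero]

theorem gammaHeight_nonneg (hτ : τ ∈ Ioc 0 1) (s : ℝ) : 0 ≤ gammaHeight τ s := by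
  rcases eq_or_ne s 0 with rfl | hs
  · exact (gammaHeight_zero hτ).ge
  · exact (gammaHeight_pos hτ hs).le

theorem gammaX_sq_of_le_abs (hτ : τ ∈ Ioc 0 1) (h : Real.arcsin τ ≤ |s|) :
    gammaX τ s ^ 2 = (τ + (|s| - Real.arcsin τ) * √(1 - τ ^ 2)) ^ 2 := by
  have hs : s ≠ 0 := abs_pos.1 ((arcsin_pos hτ).trans_le h)
  rw [gammaX_of_le_abs hτ h, mul_pow]
  rcases hs.lt_or_gt with hs | hs
  · simp [sign_neg hs]
  · simp [sign_pos hs]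

theorem one_le_sq_dist_clasp_gamma (hτ : τ ∈ Ioc 0 1) (hs : |s| ≤ Real.arcsin τ) (t : ℝ) :
    1 ≤ claspX τ (Real.sin s) ^ 2 + gammaX τ t ^ 2 +
      (claspGap τ - claspZ τ s - gammaHeight τ t) ^ 2 := by
  rcases le_total |t| (Real.arcsin τ) with ht | ht
  · rw [gammaX_of_abs_le ht, gammaHeight_of_abs_le ht]
    exact one_le_claspDistSq hτ hs ht
  · have hend := one_le_claspDistSq hτ hs (abs_arcsin_self hτ).le
    rw [claspDistSq, claspX_sin_arcsin hτ, claspZ_arcsin_eq] at hend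
    rw [gammaX_sq_of_le_abs hτ ht, gammaHeight_of_le_abs hτ ht, claspZ_arcsin_eq]
    set l := |t| - Real.arcsin τ
    have hprod : 0 ≤ l * τ * claspZ τ s :=
      mul_nonneg (mul_nonneg (sub_nonneg.2 ht) hτ.1.le) (claspZ_nonneg hτ hs)
    nlinarith [sq_nonneg l, sq_sqrt_one_sub_sq hτ]

theorem one_le_sq_dist_alpha_gamma (hτ : τ ∈ Ioc 0 1) (s t : ℝ) :
    1 ≤ alphaX τ s ^ 2 + gammaX τ t ^ 2 + (alphaHeight τ s - gammaHeight τ t) ^ 2 := by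
  rcases le_total |s| (Real.arcsin τ) with hθ | hθ
  · rw [alphaX_of_abs_le hθ, alphaHeight_of_abs_le hθ]
    exact one_le_sq_dist_clasp_gamma hτ hθ t
  rcases le_total |s| (Real.pi / 2) with hπ | hπ
  · rw [alphaX_of_abs_mem_Icc hτ ⟨hθ, hπ⟩, alphaHeight_of_abs_mem_Icc hτ ⟨hθ, hπ⟩]
    have hend := one_le_sq_dist_clasp_gamma hτ (abs_arcsin_self hτ).le t
    rw [claspX_sin_arcsin hτ, claspZ_arcsin_eq, sub_sub_cancel] at hend
    have hcos := mul_le_mul_of_nonneg_left (cos_mem_Icc_of_abs_mem_Icc ⟨hθ, hπ⟩ hτ.1.le).2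
      (gammaHeight_nonneg hτ t)
    nlinarith [Real.sin_sq_add_cos_sq s, sq_sqrt_one_sub_sq hτ]
  · have hone : alphaX τ s ^ 2 = 1 := by
      rw [alphaX_of_le_abs hτ hπ]
      rcases (abs_pos.1 (Real.pi_div_two_pos.trans_le hπ)).lt_or_gt with hs | hs
      · simp [sign_neg hs]
      · simp [sign_pos hs]
    rw [hone, add_assoc]
    exact le_add_of_nonneg_right (by positivity)

theorem alphaHeight_mem_Icc (hτ : τ ∈ Ioc 0 1) (hd : 0 ≤ d) (hs : |s| ≤ alphaHalf d) :
    alphaHeight τ s ∈ Icc (-(d / 2)) (claspGap τ) := by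
  have hgap := claspZ_nonneg hτ (abs_arcsin_self hτ).le
  rw [claspZ_arcsin_eq] at hgap
  have hsqrt := Real.sqrt_nonneg (1 - τ ^ 2)
  rcases le_total |s| (Real.arcsin τ) with hθ | hθ
  · have hle := claspZ_le hτ hθ
    rw [claspZ_arcsin_eq] at hle
    rw [alphaHeight_of_abs_le hθ]
    constructor <;> linarith [claspZ_nonneg hτ hθ]
  rcases le_total |s| (Real.pi / 2) with hπ | hπ
  · have hcos := cos_mem_Icc_of_abs_mem_Icc ⟨hθ, hπ⟩ hτ.1.le
    rw [alphaHeight_of_abs_mem_Icc hτ ⟨hθ, hπ⟩]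
    constructor <;> linarith [hcos.1, hcos.2]
  · rw [alphaHalf] at hs
    rw [alphaHeight_of_le_abs hτ hπ]
    constructor <;> linarith

theorem exists_alphaPath_eq_alphaUpper (hτ : τ ∈ Ioc 0 1) (hd : 0 ≤ d)
    (hs : s ∈ Icc (-alphaHalf d) (3 * alphaHalf d)) :
    ∃ s', |s'| ≤ alphaHalf d ∧
      (alphaPath τ d s = alphaUpper τ d s' ∨ alphaPath τ d s = reflZ (alphaUpper τ d s')) := by
  rcases le_total s (alphaHalf d) with h | h
  · exact ⟨s, abs_le.2 ⟨hs.1, h⟩, Or.inl (alphaPath_of_le h)⟩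
  · exact ⟨2 * alphaHalf d - s, abs_le.2 ⟨by linarith [hs.2], by linarith⟩,
      Or.inr (alphaPath_of_ge hτ hd h)⟩

theorem one_le_dist_alpha_gamma (hτ : τ ∈ Ioc 0 1) (hd : 0 ≤ d)
    (hs : s ∈ Icc (-alphaHalf d) (3 * alphaHalf d)) (t : ℝ) :
    1 ≤ dist (alphaPath τ d s) (gammaPath τ d t) := by
  obtain ⟨s', hs', h⟩ := exists_alphaPath_eq_alphaUpper hτ hd hs
  have hupper := one_le_sq_dist_alpha_gamma hτ s' t
  rw [← one_le_sq_iff₀ dist_nonneg, dist_sq_vec3]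
  rcases h with h | h <;> rw [h, gammaPath_eq hτ, alphaUpper_eq hτ]
  · simpa using hupper
  · have hα : 0 ≤ d / 2 + alphaHeight τ s' := by linarith [(alphaHeight_mem_Icc hτ hd hs').1]
    have hγ : 0 ≤ d / 2 + gammaHeight τ t := by linarith [gammaHeight_nonneg hτ t]
    simp only [reflZ, Matrix.cons_val]
    nlinarith [mul_nonneg hα hγ]

theorem one_le_dist_alpha_beta (hτ : τ ∈ Ioc 0 1) (hd : 0 ≤ d)
    (hs : s ∈ Icc (-alphaHalf d) (3 * alphaHalf d)) (t : ℝ) :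
    1 ≤ dist (alphaPath τ d s) (reflZ (gammaPath τ d t)) := by
  rw [dist_reflZ_right, ← alphaPath_reflect hτ hd]
  exact one_le_dist_alpha_gamma hτ hd ⟨by linarith [hs.2], by linarith [hs.1]⟩ t

theorem add_gammaHeight_le_dist_beta_gamma (hτ : τ ∈ Ioc 0 1) (d s t : ℝ) :
    d + gammaHeight τ s + gammaHeight τ t ≤ dist (reflZ (gammaPath τ d s)) (gammaPath τ d t) := by
  refine le_of_sq_le_sq ?_ dist_nonneg
  rw [dist_sq_vec3, gammaPath_eq hτ, gammaPath_eq hτ]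
  simp only [reflZ, Matrix.cons_val]
  nlinarith [sq_nonneg (gammaX τ s - gammaX τ t)]

theorem one_le_dist_beta_gamma (hτ : τ ∈ Ioc 0 1) (hd : 1 ≤ d) (s t : ℝ) :
    1 ≤ dist (reflZ (gammaPath τ d s)) (gammaPath τ d t) := by
  linarith [add_gammaHeight_le_dist_beta_gamma hτ d s t, gammaHeight_nonneg hτ s,
    gammaHeight_nonneg hτ t]

theorem chainedClasp_one_le_dist (hτ : τ ∈ Ioc 0 1) (hd : 1 ≤ d) {i j : Fin 3}
    (hij : i ≠ j) (hs : s ∈ ((chainedClasp τ d c).strand i).dom)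
    (ht : t ∈ ((chainedClasp τ d c).strand j).dom) :
    1 ≤ dist (((chainedClasp τ d c).strand i).path s) (((chainedClasp τ d c).strand j).path t) := by
  have hd' : 0 ≤ d := zero_le_one.trans hd
  fin_cases i <;> fin_cases j
  · exact absurd rfl hij
  · exact one_le_dist_alpha_beta hτ hd' hs t
  · exact one_le_dist_alpha_gamma hτ hd' hs t
  · exact (one_le_dist_alpha_beta hτ hd' ht s).trans_eq (dist_comm _ _)
  · exact absurd rfl hij
  · exact one_le_dist_beta_gamma hτ hd s t
  · exact (one_le_dist_alpha_gamma hτ hd' ht s).trans_eq (dist_comm _ _)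
  · exact (one_le_dist_beta_gamma hτ hd t s).trans_eq (dist_comm _ _)
  · exact absurd rfl hij

end Distances

/-! ### Walls -/

section Walls

variable {τ c d s σ ρ : ℝ} {n p v : E3}

theorem inner_wallNormal (τ σ ρ : ℝ) (p : E3) :
    ⟪wallNormal τ σ ρ, p⟫ = σ * √(1 - τ ^ 2) * p 1 + ρ * τ * p 2 := by
  simp [inner_vec3, wallNormal]

theorem inner_wallNormal_self (hτ : τ ∈ Ioc 0 1) (hσ : |σ| = 1) (hρ : |ρ| = 1) :
    ⟪wallNormal τ σ ρ, wallNormal τ σ ρ⟫ = 1 := by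
  rw [← sq_eq_sq₀ (abs_nonneg _) zero_le_one, sq_abs] at hσ hρ
  rw [inner_wallNormal]
  simp only [wallNormal, Matrix.cons_val]
  linear_combination √(1 - τ ^ 2) ^ 2 * hσ + τ ^ 2 * hρ + sq_sqrt_one_sub_sq hτ

theorem mem_wallPlane (hn : ⟪n, n⟫ = 1) (hp : ⟪n, p⟫ = c) : p ∈ wallPlane n c := by
  rw [wallPlane, AffineSubspace.mem_mk', vsub_eq_sub,
    Submodule.mem_orthogonal_singleton_iff_inner_right,
    inner_sub_right, real_inner_smul_right, hn, hp, mul_one, sub_self]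

theorem inner_eq_zero_of_mem_direction_wallPlane (h : v ∈ (wallPlane n c).direction) :
    ⟪n, v⟫ = 0 := by
  rwa [wallPlane, AffineSubspace.direction_mk',
    Submodule.mem_orthogonal_singleton_iff_inner_right] at h

theorem contDiff_wallFun (n : E3) (c : ℝ) : ContDiff ℝ 1 (wallFun n c) :=
  contDiff_const.sub (contDiff_const.inner ℝ contDiff_id)

theorem fderiv_wallFun_ne_zero (hn : n ≠ 0) (c : ℝ) (p : E3) : fderiv ℝ (wallFun n c) p ≠ 0 := by
  have h : HasFDerivAt (wallFun n c) (-innerSL ℝ n) p := (innerSL ℝ n).hasFDerivAt.const_sub c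
  rw [h.fderiv, neg_ne_zero, ← norm_ne_zero_iff, innerSL_apply_norm]
  exact norm_ne_zero_iff.2 hn

theorem wallFun_nonneg (hτ : 0 ≤ τ) (hσ : |σ| = 1) (hρ : |ρ| = 1)
    (hp : |p 1| * √(1 - τ ^ 2) + τ * |p 2| ≤ c) : 0 ≤ wallFun (wallNormal τ σ ρ) c p := by
  have hmul {ε : ℝ} (hε : |ε| = 1) (x : ℝ) : ε * x ≤ |x| :=
    (le_abs_self _).trans_eq (by rw [abs_mul, hε, one_mul])
  rw [wallFun, inner_wallNormal]
  nlinarith [mul_le_mul_of_nonneg_right (hmul hσ (p 1)) (Real.sqrt_nonneg (1 - τ ^ 2)),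
    mul_le_mul_of_nonneg_right (hmul hρ (p 2)) hτ]

theorem exists_obstacle_eq (τ d c : ℝ) (j : Fin 4) : ∃ σ ρ : ℝ, |σ| = 1 ∧ |ρ| = 1 ∧
    (chainedClasp τ d c).obstacle j = wallFun (wallNormal τ σ ρ) c := by
  have hone : |(1 : ℝ)| = 1 := abs_one
  have hneg : |(-1 : ℝ)| = 1 := by rw [abs_neg, abs_one]
  fin_cases j
  · exact ⟨-1, -1, hneg, hneg, rfl⟩
  · exact ⟨1, -1, hone, hneg, rfl⟩
  · exact ⟨-1, 1, hneg, hone, rfl⟩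
  · exact ⟨1, 1, hone, hone, rfl⟩

theorem abs_claspX_le (hτ : τ ∈ Ioc 0 1) {u : ℝ} (hu : |u| ≤ τ) : |claspX τ u| ≤ τ := by
  have hratio : claspRatio τ |u| ≤ 1 := by
    rw [claspRatio, div_le_one (claspRatio_denom_pos hτ ⟨abs_nonneg u, hu.trans hτ.2⟩)]
    exact sub_le_sub_left (mul_le_of_le_one_left (sq_nonneg _)
      (pow_le_one₀ (abs_nonneg u) (hu.trans hτ.2))) 1
  rw [claspX_eq_mul_sqrt_claspRatio, abs_mul, abs_of_nonneg (Real.sqrt_nonneg _)]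
  exact (mul_le_of_le_one_right (abs_nonneg u) (Real.sqrt_le_one.2 hratio)).trans hu

theorem abs_sin_le_of_abs_le_arcsin (hs : |s| ≤ Real.arcsin τ) : |Real.sin s| ≤ τ := by
  rw [Real.abs_sin_eq_sin_abs_of_abs_le_pi
    (by linarith [Real.arcsin_le_pi_div_two τ, Real.pi_pos])]
  exact (sin_mem_Icc_of_mem_Icc_arcsin ⟨abs_nonneg s, hs⟩).2

theorem gammaPath_within_walls (hτ : τ ∈ Ioc 0 1) (he : 0 ≤ endLength τ d c)
    (hs : |s| ≤ Real.arcsin τ + endLength τ d c) :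
    |gammaX τ s| * √(1 - τ ^ 2) + τ * (d / 2 + gammaHeight τ s) ≤ c := by
  have hsqrt := sq_sqrt_one_sub_sq hτ
  rw [endLength] at hs he
  rcases le_total |s| (Real.arcsin τ) with h | h
  · have hX := mul_le_mul_of_nonneg_right (abs_claspX_le hτ (abs_sin_le_of_abs_le_arcsin h))
      (Real.sqrt_nonneg (1 - τ ^ 2))
    have hZ := mul_le_mul_of_nonneg_left (claspZ_le hτ h) hτ.1.le
    rw [claspZ_arcsin_eq] at hZ
    rw [gammaX_of_abs_le h, gammaHeight_of_abs_le h]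
    linarith
  · have hX : |gammaX τ s| = τ + (|s| - Real.arcsin τ) * √(1 - τ ^ 2) := by
      rw [← sq_eq_sq₀ (abs_nonneg _) (add_nonneg hτ.1.le
        (mul_nonneg (sub_nonneg.2 h) (Real.sqrt_nonneg _))), sq_abs, gammaX_sq_of_le_abs hτ h]
    rw [hX, gammaHeight_of_le_abs hτ h, claspZ_arcsin_eq]
    nlinarith

theorem alphaUpper_within_walls (hτ : τ ∈ Ioc 0 1) (hd : 0 ≤ d) (he : 0 ≤ endLength τ d c)
    (hs : |s| ≤ alphaHalf d) : τ * |d / 2 + alphaHeight τ s| ≤ c := by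
  have hheight := alphaHeight_mem_Icc hτ hd hs
  rw [abs_of_nonneg (by linarith [hheight.1])]
  rw [endLength] at he
  nlinarith [mul_le_mul_of_nonneg_left hheight.2 hτ.1.le]

theorem chainedClasp_within_walls (hτ : τ ∈ Ioc 0 1) (hd : 0 ≤ d) (he : 0 ≤ endLength τ d c)
    {i : Fin 3} (hs : s ∈ ((chainedClasp τ d c).strand i).dom) :
    |((chainedClasp τ d c).strand i).path s 1| * √(1 - τ ^ 2) +
      τ * |((chainedClasp τ d c).strand i).path s 2| ≤ c := by
  have hγ (hs : s ∈ Icc (-(Real.arcsin τ + endLength τ d c)) (Real.arcsin τ + endLength τ d c)) :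
      |gammaX τ s| * √(1 - τ ^ 2) + τ * |d / 2 + gammaHeight τ s| ≤ c := by
    rw [abs_of_nonneg (a := _ + _) (by linarith [gammaHeight_nonneg hτ s])]
    exact gammaPath_within_walls hτ he (abs_le.2 ⟨hs.1, hs.2⟩)
  fin_cases i
  · change |alphaPath τ d s 1| * _ + τ * |alphaPath τ d s 2| ≤ c
    obtain ⟨s', hs', h⟩ := exists_alphaPath_eq_alphaUpper hτ hd hs
    have hα := alphaUpper_within_walls hτ hd he hs'
    rcases h with h | h <;> rw [h, alphaUpper_eq hτ]
    · simpa only [Matrix.cons_val, abs_zero, zero_mul, zero_add] using hα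
    · simpa only [reflZ_vec3, Matrix.cons_val, abs_neg, abs_zero, zero_mul, zero_add] using hα
  · change |reflZ (gammaPath τ d s) 1| * _ + τ * |reflZ (gammaPath τ d s) 2| ≤ c
    rw [gammaPath_eq hτ, reflZ_vec3]
    simpa only [Matrix.cons_val, abs_neg] using hγ hs
  · change |gammaPath τ d s 1| * _ + τ * |gammaPath τ d s 2| ≤ c
    rw [gammaPath_eq hτ]
    exact hγ hs

theorem gammaX_neg (hτ : τ ∈ Ioc 0 1) (s : ℝ) : gammaX τ (-s) = -gammaX τ s := by
  rw [gammaX, gammaX, clamp_neg (arcsin_pos hτ), Real.sin_neg, claspX_neg]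
  ring

theorem gammaHeight_neg (hτ : τ ∈ Ioc 0 1) (s : ℝ) : gammaHeight τ (-s) = gammaHeight τ s := by
  rw [gammaHeight, gammaHeight, clamp_neg (arcsin_pos hτ), claspZ_neg hτ, ← neg_sub', abs_neg]

theorem gammaPath_end_on_wall (hτ : τ ∈ Ioc 0 1) (he : 0 ≤ endLength τ d c) :
    √(1 - τ ^ 2) * gammaX τ (Real.arcsin τ + endLength τ d c) +
      τ * (d / 2 + gammaHeight τ (Real.arcsin τ + endLength τ d c)) = c := by
  have hpos : 0 < Real.arcsin τ + endLength τ d c := add_pos_of_pos_of_nonneg (arcsin_pos hτ) he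
  have hle : Real.arcsin τ ≤ |Real.arcsin τ + endLength τ d c| := by
    rw [abs_of_pos hpos]
    exact le_add_of_nonneg_right he
  rw [gammaX_of_le_abs hτ hle, gammaHeight_of_le_abs hτ hle, sign_pos hpos, abs_of_pos hpos,
    add_sub_cancel_left, claspZ_arcsin_eq, SignType.coe_one]
  have hend : endLength τ d c = c - τ * (d / 2 + claspGap τ) := rfl
  linear_combination hend + endLength τ d c * sq_sqrt_one_sub_sq hτ

end Walls

/-! ### The chained clasp is a generalized link -/

section Validity

variable {τ c d : ℝ}

theorem isLip_path (hτ : τ ∈ Ioc 0 1) (hd : 0 ≤ d) (c : ℝ) (i : Fin 3) :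
    IsLip ((chainedClasp τ d c).strand i).path := by
  fin_cases i
  · exact isLip_alphaPath hτ hd
  · exact (isLip_gammaPath hτ d).reflZ
  · exact isLip_gammaPath hτ d

/-- The unit tangent vectors of the components. -/
def linkTangent (τ d : ℝ) : Fin 3 → ℝ → E3 :=
  ![alphaTangent d, fun s => reflZ (gammaTangent τ s), gammaTangent τ]

theorem ae_hasDerivAt_path (hτ : τ ∈ Ioc 0 1) (hd : 0 ≤ d) (c : ℝ) (i : Fin 3) :
    ∀ᵐ s : ℝ, ∃ v : ℝ, 0 < v ∧
      HasDerivAt ((chainedClasp τ d c).strand i).path (v • linkTangent τ d i s) s := by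
  fin_cases i
  · filter_upwards [ae_hasDerivAt_alphaPath hτ hd] with s hs using ⟨_, hs⟩
  · filter_upwards [ae_hasDerivAt_gammaPath hτ d] with s hs
    exact ⟨_, hs.1, (hasDerivAt_reflZ hs.2).congr_deriv (reflZ_smul _ _)⟩
  · filter_upwards [ae_hasDerivAt_gammaPath hτ d] with s hs using ⟨_, hs⟩

theorem norm_linkTangent (τ d : ℝ) (i : Fin 3) (s : ℝ) : ‖linkTangent τ d i s‖ = 1 := by
  fin_cases i
  · exact norm_alphaTangent d s
  · exact (norm_reflZ _).trans (norm_gammaTangent τ s)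
  · exact norm_gammaTangent τ s

theorem isLip_linkTangent (τ d : ℝ) (i : Fin 3) : IsLip (linkTangent τ d i) := by
  fin_cases i
  · exact isLip_alphaTangent d
  · exact (isLip_gammaTangent τ).reflZ
  · exact isLip_gammaTangent τ

theorem chainedClasp_left_lt_right (hτ : τ ∈ Ioc 0 1) (hd : 0 ≤ d) (he : 0 ≤ endLength τ d c)
    (i : Fin 3) : ((chainedClasp τ d c).strand i).left < ((chainedClasp τ d c).strand i).right := by
  have harc : 0 < Real.arcsin τ + endLength τ d c := add_pos_of_pos_of_nonneg (arcsin_pos hτ) he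
  have hhalf := alphaHalf_pos hd
  fin_cases i
  · exact (show -alphaHalf d < 3 * alphaHalf d by linarith)
  · exact neg_lt_self harc
  · exact neg_lt_self harc

theorem alphaPath_closes (hτ : τ ∈ Ioc 0 1) (hd : 0 ≤ d) :
    alphaPath τ d (-alphaHalf d) = alphaPath τ d (3 * alphaHalf d) := by
  have hhalf := alphaHalf_pos hd
  have habs : |-alphaHalf d| = alphaHalf d := by rw [abs_neg, abs_of_pos hhalf]
  have hle : Real.pi / 2 ≤ |-alphaHalf d| := (pi_div_two_le_alphaHalf hd).trans_eq habs.symm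
  have hheight : d / 2 + alphaHeight τ (-alphaHalf d) = 0 := by
    rw [alphaHeight_of_le_abs hτ hle, habs, alphaHalf]
    ring
  rw [show 3 * alphaHalf d = 2 * alphaHalf d - -alphaHalf d by ring, alphaPath_reflect hτ hd,
    alphaPath_of_le (by linarith), alphaUpper_eq hτ, hheight, reflZ_vec3, neg_zero]

theorem chainedClasp_left_mem (hτ : τ ∈ Ioc 0 1) (he : 0 ≤ endLength τ d c) (i : Fin 3)
    (hi : ¬ ((chainedClasp τ d c).strand i).isClosed) :
    ((chainedClasp τ d c).strand i).path ((chainedClasp τ d c).strand i).left ∈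
      ((chainedClasp τ d c).strand i).leftPlane := by
  have hend := gammaPath_end_on_wall hτ he
  fin_cases i
  · exact absurd trivial hi
  all_goals
    refine mem_wallPlane (inner_wallNormal_self hτ (by norm_num) (by norm_num)) ?_
    rw [inner_wallNormal]
  · change _ * reflZ (gammaPath τ d (-_)) 1 + _ * reflZ (gammaPath τ d (-_)) 2 = c
    rw [gammaPath_eq hτ, gammaX_neg hτ, gammaHeight_neg hτ, reflZ_vec3]
    simp only [Matrix.cons_val]
    linear_combination hend
  · change _ * gammaPath τ d (-_) 1 + _ * gammaPath τ d (-_) 2 = c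
    rw [gammaPath_eq hτ, gammaX_neg hτ, gammaHeight_neg hτ]
    simp only [Matrix.cons_val]
    linear_combination hend

theorem chainedClasp_right_mem (hτ : τ ∈ Ioc 0 1) (he : 0 ≤ endLength τ d c) (i : Fin 3)
    (hi : ¬ ((chainedClasp τ d c).strand i).isClosed) :
    ((chainedClasp τ d c).strand i).path ((chainedClasp τ d c).strand i).right ∈
      ((chainedClasp τ d c).strand i).rightPlane := by
  have hend := gammaPath_end_on_wall hτ he
  fin_cases i
  · exact absurd trivial hi
  all_goals
    refine mem_wallPlane (inner_wallNormal_self hτ (by norm_num) (by norm_num)) ?_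
    rw [inner_wallNormal]
  · set r := Real.arcsin τ + endLength τ d c
    change _ * reflZ (gammaPath τ d r) 1 + _ * reflZ (gammaPath τ d r) 2 = c
    rw [gammaPath_eq hτ, reflZ_vec3]
    simp only [Matrix.cons_val]
    linear_combination hend
  · set r := Real.arcsin τ + endLength τ d c
    change _ * gammaPath τ d r 1 + _ * gammaPath τ d r 2 = c
    rw [gammaPath_eq hτ]
    simp only [Matrix.cons_val]
    linear_combination hend

theorem chainedClasp_isValid (hτ : τ ∈ Ioc 0 1) (hd : 1 ≤ d) (he : 0 ≤ endLength τ d c) :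
    (chainedClasp τ d c).IsValid where
  left_lt_right := chainedClasp_left_lt_right hτ (zero_le_one.trans hd) he
  lipschitz i := (isLip_path hτ (zero_le_one.trans hd) c i).imp fun _ h => h.lipschitzOnWith
  regular i := by
    filter_upwards [ae_hasDerivAt_path hτ (zero_le_one.trans hd) c i] with s ⟨v, hv, h⟩ _
    rw [h.deriv]
    exact smul_ne_zero hv.ne' (norm_ne_zero_iff.1 (by simp [norm_linkTangent]))
  closes_up i hi := by
    fin_cases i
    · exact alphaPath_closes hτ (zero_le_one.trans hd)
    · exact hi.elim
    · exact hi.elim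
  left_mem := chainedClasp_left_mem hτ he
  right_mem := chainedClasp_right_mem hτ he
  disjoint i j hij := by
    rw [Set.disjoint_left]
    rintro _ ⟨s, hs, rfl⟩ ⟨t, ht, h⟩
    have hdist := chainedClasp_one_le_dist hτ hd hij hs ht
    rw [h, dist_self] at hdist
    exact not_le.2 zero_lt_one hdist
  contDiff_obstacle j := by
    obtain ⟨σ, ρ, -, -, h⟩ := exists_obstacle_eq τ d c j
    exact h ▸ contDiff_wallFun _ _
  regular_obstacle j p _ := by
    obtain ⟨σ, ρ, hσ, hρ, h⟩ := exists_obstacle_eq τ d c j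
    rw [h]
    exact fderiv_wallFun_ne_zero (inner_self_ne_zero.1
      ((inner_wallNormal_self hτ hσ hρ).trans_ne one_ne_zero)) c p
  avoids j i s hs := by
    obtain ⟨σ, ρ, hσ, hρ, h⟩ := exists_obstacle_eq τ d c j
    rw [h]
    exact wallFun_nonneg hτ.1.le hσ hρ
      (chainedClasp_within_walls hτ (zero_le_one.trans hd) he hs)

end Validity

/-! ### Struts -/

section Struts

variable {τ c d s t : ℝ}

/-- The difference of two points in contact in the upper clasp: one on `α`, where the tangent has
angle `s`, and one on `γ`, where it has angle `t`, with `|sin s| + |sin t| = τ`. -/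
def contactVec (τ s t : ℝ) : E3 :=
  !₂[claspX τ (Real.sin s), -claspX τ (Real.sin t), contactHeight τ (Real.sin s) (Real.sin t)]

theorem claspX_abs_sq (τ u : ℝ) : claspX τ |u| ^ 2 = claspX τ u ^ 2 := by
  rcases abs_choice u with h | h <;> rw [h]
  rw [claspX_neg, neg_sq]

theorem contactHeight_abs (τ u v : ℝ) : contactHeight τ |u| |v| = contactHeight τ u v := by
  rw [contactHeight, contactHeight, claspX_abs_sq, claspX_abs_sq]

theorem claspZ_arcsin_abs_sin (hτ : τ ∈ Ioc 0 1) (hs : |s| ≤ Real.arcsin τ) :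
    claspZ τ (Real.arcsin |Real.sin s|) = claspZ τ s := by
  rw [Real.abs_sin_eq_sin_abs_of_abs_le_pi
    (by linarith [Real.arcsin_le_pi_div_two τ, Real.pi_pos]),
    arcsin_sin_of_mem_Icc_arcsin ⟨abs_nonneg s, hs⟩, claspZ_abs hτ]

theorem norm_contactVec (hτ : τ ∈ Ioc 0 1) (hst : |Real.sin s| + |Real.sin t| = τ) :
    ‖contactVec τ s t‖ = 1 := by
  have hsq := claspX_sq_add_claspX_sq_add_contactHeight_sq hτ (abs_nonneg _) (abs_nonneg _) hst
  rw [claspX_abs_sq, claspX_abs_sq, contactHeight_abs] at hsq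
  rw [← sq_eq_sq₀ (norm_nonneg _) zero_le_one, norm_sq_vec3]
  simpa [contactVec] using hsq

theorem alphaPath_sub_gammaPath (hτ : τ ∈ Ioc 0 1) (hd : 0 ≤ d) (hs : |s| ≤ Real.arcsin τ)
    (ht : |t| ≤ Real.arcsin τ) (hst : |Real.sin s| + |Real.sin t| = τ) :
    alphaPath τ d s - gammaPath τ d t = contactVec τ s t := by
  have hle : s ≤ alphaHalf d := (le_abs_self s).trans
    (hs.trans ((Real.arcsin_le_pi_div_two τ).trans (pi_div_two_le_alphaHalf hd)))
  have hgap := claspGap_eq hτ (abs_nonneg _) (abs_nonneg _) hst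
  rw [claspZ_arcsin_abs_sin hτ hs, claspZ_arcsin_abs_sin hτ ht, contactHeight_abs] at hgap
  rw [alphaPath_of_le hle, alphaUpper_eq hτ, gammaPath_eq hτ, alphaX_of_abs_le hs,
    alphaHeight_of_abs_le hs, gammaX_of_abs_le ht, gammaHeight_of_abs_le ht, hgap, contactVec]
  ext i
  fin_cases i
  · simp
  · simp
  · simp only [PiLp.sub_apply, Fin.reduceFinMk, Matrix.cons_val]
    ring

theorem gammaPath_zero (hτ : τ ∈ Ioc 0 1) (d : ℝ) : gammaPath τ d 0 = !₂[0, 0, d / 2] := by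
  rw [gammaPath_eq hτ, gammaHeight_zero hτ, gammaX_of_abs_le (by simpa using (arcsin_pos hτ).le),
    Real.sin_zero, claspX_zero, add_zero]

theorem alphaPath_sub_tip (hτ : τ ∈ Ioc 0 1) (hd : 0 ≤ d)
    (hs : |s| ∈ Icc (Real.arcsin τ) (Real.pi / 2)) :
    alphaPath τ d s - gammaPath τ d 0 = !₂[Real.sin s, 0, Real.cos s] := by
  rw [gammaPath_zero hτ,
    alphaPath_of_le ((le_abs_self s).trans (hs.2.trans (pi_div_two_le_alphaHalf hd))),
    alphaUpper_eq hτ, alphaX_of_abs_mem_Icc hτ hs, alphaHeight_of_abs_mem_Icc hτ hs]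
  ext i
  fin_cases i <;> simp

theorem norm_sin_cos (s : ℝ) : ‖(!₂[Real.sin s, 0, Real.cos s] : E3)‖ = 1 := by
  rw [← sq_eq_sq₀ (norm_nonneg _) zero_le_one, norm_sq_vec3]
  simp

theorem mem_dom_alpha (hd : 0 ≤ d) (τ c : ℝ) (hs : |s| ≤ Real.pi / 2) :
    s ∈ ((chainedClasp τ d c).strand 0).dom :=
  have hs' := abs_le.1 (hs.trans (pi_div_two_le_alphaHalf hd))
  ⟨hs'.1, show s ≤ 3 * alphaHalf d by linarith [alphaHalf_pos hd]⟩

theorem reflect_mem_dom_alpha (hs : s ∈ ((chainedClasp τ d c).strand 0).dom) :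
    2 * alphaHalf d - s ∈ ((chainedClasp τ d c).strand 0).dom := by
  obtain ⟨hl, hr⟩ : -alphaHalf d ≤ s ∧ s ≤ 3 * alphaHalf d := hs
  exact ⟨show -alphaHalf d ≤ _ by linarith, show _ ≤ 3 * alphaHalf d by linarith⟩

theorem mem_dom_beta (he : 0 ≤ endLength τ d c) (hs : |s| ≤ Real.arcsin τ) :
    s ∈ ((chainedClasp τ d c).strand 1).dom :=
  abs_le.1 (hs.trans (le_add_of_nonneg_right he))

theorem mem_dom_gamma (he : 0 ≤ endLength τ d c) (hs : |s| ≤ Real.arcsin τ) :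
    s ∈ ((chainedClasp τ d c).strand 2).dom :=
  mem_dom_beta he hs

theorem chainedClasp_gThi (hτ : τ ∈ Ioc 0 1) (hd : 1 ≤ d) (he : 0 ≤ endLength τ d c) :
    (chainedClasp τ d c).gThi = 1 := by
  have hθ := (abs_arcsin_self hτ).le
  have hzero : |(0 : ℝ)| ≤ Real.arcsin τ := abs_zero.trans_le (arcsin_pos hτ).le
  have hsin : |Real.sin (Real.arcsin τ)| + |Real.sin 0| = τ := by
    rw [sin_arcsin_self hτ, Real.sin_zero, abs_zero, add_zero, abs_of_pos hτ.1]
  refine IsLeast.csInf_eq ⟨⟨0, 2, by decide, Real.arcsin τ,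
    mem_dom_alpha (zero_le_one.trans hd) τ c (hθ.trans (Real.arcsin_le_pi_div_two τ)), 0,
    mem_dom_gamma he hzero, ?_⟩, ?_⟩
  · change 1 = dist (alphaPath τ d _) (gammaPath τ d _)
    rw [dist_eq_norm, alphaPath_sub_gammaPath hτ (zero_le_one.trans hd) hθ hzero hsin,
      norm_contactVec hτ hsin]
  · rintro r ⟨i, j, hij, s, hs, t, ht, rfl⟩
    exact chainedClasp_one_le_dist hτ hd hij hs ht

end Struts

/-! ### The balance of forces in a clasp -/

theorem integral_symm_interval {f : ℝ → ℝ} {r : ℝ} (hr : 0 ≤ r) (hf : ContinuousOn f (Icc (-r) r)) :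
    ∫ s in -r..r, f s = ∫ s in (0 : ℝ)..r, (f s + f (-s)) := by
  have hleft : IntervalIntegrable f volume (-r) 0 :=
    (hf.mono (Icc_subset_Icc_right hr)).intervalIntegrable_of_Icc (by linarith)
  have hright : IntervalIntegrable f volume 0 r :=
    (hf.mono (Icc_subset_Icc_left (by linarith))).intervalIntegrable_of_Icc hr
  have hflip : IntervalIntegrable (fun s => f (-s)) volume 0 r := by
    simpa using ((IntervalIntegrable.iff_comp_neg (by finiteness)).1 hleft).symm
  rw [← intervalIntegral.integral_add_adjacent_intervals hleft hright,
    intervalIntegral.integral_add hright hflip, intervalIntegral.integral_comp_neg, neg_zero,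
    add_comm]

/-- The pairing of a vector field `ξ` with a density `N` at `s`, combined with that at the mirror
image `-s`. -/
def symmPairing (ξ N : ℝ → E3) (s : ℝ) : ℝ := ⟪ξ s, N s⟫ + ⟪ξ (-s), N (-s)⟫

theorem continuousOn_symmPairing {ξ N : ℝ → E3} {r : ℝ} (hξ : ContinuousOn ξ (Icc (-r) r))
    (hN : Continuous N) : ContinuousOn (symmPairing ξ N) (Icc 0 r) := by
  have h : ContinuousOn (fun s => ⟪ξ s, N s⟫) (Icc (-r) r) := hξ.inner hN.continuousOn
  exact (h.mono fun s hs => ⟨by linarith [hs.1, hs.2], hs.2⟩).add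
    (h.comp continuous_neg.continuousOn fun s hs =>
      ⟨by linarith [hs.2], by linarith [hs.1, hs.2]⟩)

theorem integral_inner_eq_integral_symmPairing {r R : ℝ} (hr : 0 ≤ r) (hrR : r ≤ R)
    {ξ T N : ℝ → E3} (hξ : ContinuousOn ξ (Icc (-R) R)) (hN : Continuous N)
    (hT : ∀ s, |s| < r → T s = N s) (hT' : ∀ s, r < |s| → |s| < R → T s = 0) :
    ∫ s in Icc (-R) R, ⟪ξ s, T s⟫ = ∫ s in (0 : ℝ)..r, symmPairing ξ N s := by
  have hsub : Icc (-r) r ⊆ Icc (-R) R := Icc_subset_Icc (by linarith) hrR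
  have hinside : ∀ᵐ s : ℝ, s ∈ Icc (-r) r → ⟪ξ s, T s⟫ = ⟪ξ s, N s⟫ := by
    filter_upwards [ae_abs_sub_ne 0 r] with s hne hs
    rw [sub_zero] at hne
    rw [hT s (lt_of_le_of_ne (abs_le.2 hs) hne)]
  have houtside : ∀ᵐ s : ℝ, s ∈ Icc (-R) R \ Icc (-r) r → ⟪ξ s, T s⟫ = 0 := by
    filter_upwards [ae_abs_sub_ne 0 R] with s hne hs
    rw [sub_zero] at hne
    rw [hT' s (lt_of_not_ge fun h => hs.2 (abs_le.1 h)) (lt_of_le_of_ne (abs_le.2 hs.1) hne),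
      inner_zero_right]
  rw [setIntegral_eq_of_subset_of_ae_sdiff_eq_zero nullMeasurableSet_Icc hsub houtside,
    setIntegral_congr_ae measurableSet_Icc hinside, integral_Icc_eq_integral_Ioc,
    ← intervalIntegral.integral_of_le (by linarith),
    integral_symm_interval hr ((hξ.mono hsub).inner hN.continuousOn)]
  rfl

section ArcsinSubstitution

variable {τ : ℝ} (hτ : τ ∈ Ioc 0 1)
include hτ

theorem hasDerivAt_arcsin_of_mem_Ioo {x : ℝ} (hx : x ∈ Ioo (min 0 τ) (max 0 τ)) :
    HasDerivAt Real.arcsin (1 / √(1 - x ^ 2)) x := by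
  rw [min_eq_left hτ.1.le, max_eq_right hτ.1.le] at hx
  exact Real.hasDerivAt_arcsin (by linarith [hx.1]) (by linarith [hx.2, hτ.2])

theorem intervalIntegrable_one_div_sqrt :
    IntervalIntegrable (fun u : ℝ => 1 / √(1 - u ^ 2)) volume 0 τ :=
  intervalIntegral.intervalIntegrable_deriv_of_nonneg Real.continuous_arcsin.continuousOn
    (fun _ hx => hasDerivAt_arcsin_of_mem_Ioo hτ hx) fun _ _ => by positivity

variable {g : ℝ → ℝ} (hg : ContinuousOn g (Icc 0 (Real.arcsin τ)))
include hg

theorem intervalIntegrable_comp_arcsin_div_sqrt :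
    IntervalIntegrable (fun u => g (Real.arcsin u) / √(1 - u ^ 2)) volume 0 τ := by
  simp only [div_eq_mul_one_div (g _)]
  refine (intervalIntegrable_one_div_sqrt hτ).continuousOn_mul ?_
  rw [uIcc_of_le hτ.1.le]
  exact hg.comp Real.continuous_arcsin.continuousOn fun u hu => arcsin_mem_Icc_arcsin hu

theorem integral_comp_arcsin_div_sqrt :
    ∫ u in (0 : ℝ)..τ, g (Real.arcsin u) / √(1 - u ^ 2) = ∫ s in (0 : ℝ)..Real.arcsin τ, g s := by
  have himage : Real.arcsin '' uIcc 0 τ ⊆ Icc 0 (Real.arcsin τ) := by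
    rw [uIcc_of_le hτ.1.le]
    rintro _ ⟨u, hu, rfl⟩
    exact arcsin_mem_Icc_arcsin hu
  have hint : IntegrableOn (fun u => (g ∘ Real.arcsin) u * (1 / √(1 - u ^ 2))) (uIcc 0 τ) := by
    have h := intervalIntegrable_comp_arcsin_div_sqrt hτ hg
    rw [intervalIntegrable_iff_integrableOn_Icc_of_le hτ.1.le, ← uIcc_of_le hτ.1.le] at h
    exact h.congr_fun (fun u _ => div_eq_mul_one_div _ _) measurableSet_uIcc
  have hsubst := intervalIntegral.integral_comp_mul_deriv''' Real.continuous_arcsin.continuousOn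
    (fun x hx => (hasDerivAt_arcsin_of_mem_Ioo hτ hx).hasDerivWithinAt)
    (hg.mono ((image_mono Ioo_subset_Icc_self).trans himage))
    (hg.integrableOn_Icc.mono_set himage) hint
  simpa only [Function.comp_apply, ← div_eq_mul_one_div, Real.arcsin_zero] using hsubst

end ArcsinSubstitution

/-- The derivative of the unit tangent of `α` with respect to its angle. -/
def alphaNormal (s : ℝ) : E3 := !₂[-Real.sin s, 0, -Real.cos s]

/-- The derivative of the unit tangent of `γ` with respect to its angle. -/
def gammaNormal (s : ℝ) : E3 := !₂[0, -Real.sin s, Real.cos s]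

theorem continuous_alphaNormal : Continuous alphaNormal := by
  unfold alphaNormal
  fun_prop

theorem continuous_gammaNormal : Continuous gammaNormal := by
  unfold gammaNormal
  fun_prop

theorem symmPairing_alphaNormal (η : ℝ → E3) (s : ℝ) : symmPairing η alphaNormal s =
    -(Real.sin s * (η s 0 - η (-s) 0)) - Real.cos s * (η s 2 + η (-s) 2) := by
  simp only [symmPairing, alphaNormal, inner_vec3, Real.sin_neg, Real.cos_neg,
    Matrix.cons_val]
  ring

theorem symmPairing_gammaNormal (ζ : ℝ → E3) (t : ℝ) : symmPairing ζ gammaNormal t =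
    -(Real.sin t * (ζ t 1 - ζ (-t) 1)) + Real.cos t * (ζ t 2 + ζ (-t) 2) := by
  simp only [symmPairing, gammaNormal, inner_vec3, Real.sin_neg, Real.cos_neg,
    Matrix.cons_val]
  ring

theorem contactHeight_neg_left (τ u v : ℝ) : contactHeight τ (-u) v = contactHeight τ u v := by
  rw [contactHeight, contactHeight, claspX_neg, neg_sq]

theorem contactHeight_neg_right (τ u v : ℝ) : contactHeight τ u (-v) = contactHeight τ u v := by
  rw [contactHeight, contactHeight, claspX_neg, neg_sq]

section Contact

variable {τ p : ℝ} (hτ : τ ∈ Ioc 0 1)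

section

variable {u v : ℝ} (hu : 0 < u) (hv : 0 < v) (huv : u + v = τ)
include hτ hu hv huv

theorem inv_contactHeight_le :
    (contactHeight τ u v)⁻¹ ≤ 2 * ((√(1 - u ^ 2))⁻¹ + (√(1 - v ^ 2))⁻¹) := by
  wlog huv' : u ≤ v generalizing u v
  · rw [contactHeight_comm, add_comm (√(1 - u ^ 2))⁻¹]
    exact this hv hu (by rwa [add_comm]) (le_of_not_ge huv')
  have hA : 2⁻¹ ≤ √(1 - u ^ 2) := Real.le_sqrt_of_sq_le (by nlinarith [hτ.2])
  have hB : 0 < √(1 - v ^ 2) :=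
    Real.sqrt_pos.2 (sub_pos.2 (pow_lt_one₀ hv.le (by linarith [hτ.2]) two_ne_zero))
  have hA0 : 0 < √(1 - u ^ 2) := by linarith
  calc (contactHeight τ u v)⁻¹ ≤ (√(1 - u ^ 2) * √(1 - v ^ 2))⁻¹ :=
        inv_anti₀ (mul_pos hA0 hB) (sqrt_mul_sqrt_le_contactHeight hτ hu.le hv.le huv)
    _ = (√(1 - u ^ 2))⁻¹ * (√(1 - v ^ 2))⁻¹ := mul_inv _ _
    _ ≤ 2 * (√(1 - v ^ 2))⁻¹ := by
        gcongr
        exact inv_le_of_inv_le₀ (by norm_num) hA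
    _ ≤ 2 * ((√(1 - u ^ 2))⁻¹ + (√(1 - v ^ 2))⁻¹) := by
        gcongr
        exact le_add_of_nonneg_left (inv_nonneg.2 hA0.le)

/-- The struts that join the four points in contact transmit equal forces, which balance the
curvature forces. -/
theorem contact_balance_eq (η ζ : ℝ → E3) :
    symmPairing η alphaNormal (Real.arcsin u) / √(1 - u ^ 2) +
        symmPairing ζ gammaNormal (Real.arcsin v) / √(1 - v ^ 2) =
      -(2 * contactHeight τ u v)⁻¹ *
        (⟪contactVec τ (Real.arcsin u) (Real.arcsin v),
            η (Real.arcsin u) - ζ (Real.arcsin v)⟫ +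
          ⟪contactVec τ (Real.arcsin u) (-Real.arcsin v),
            η (Real.arcsin u) - ζ (-Real.arcsin v)⟫ +
          ⟪contactVec τ (-Real.arcsin u) (Real.arcsin v),
            η (-Real.arcsin u) - ζ (Real.arcsin v)⟫ +
          ⟪contactVec τ (-Real.arcsin u) (-Real.arcsin v),
            η (-Real.arcsin u) - ζ (-Real.arcsin v)⟫) := by
  have hsin_u : Real.sin (Real.arcsin u) = u :=
    Real.sin_arcsin (by linarith) (by linarith [hτ.2])
  have hsin_v : Real.sin (Real.arcsin v) = v :=
    Real.sin_arcsin (by linarith) (by linarith [hτ.2])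
  have htan_u := div_sqrt_eq_claspX_div_contactHeight hτ hu hv huv
  have htan_v := div_sqrt_eq_claspX_div_contactHeight hτ hv hu (by rwa [add_comm])
  rw [contactHeight_comm] at htan_v
  have hH := contactHeight_pos hτ hu hv huv
  have hA : √(1 - u ^ 2) ≠ 0 :=
    (Real.sqrt_pos.2 (sub_pos.2 (pow_lt_one₀ hu.le (by linarith [hτ.2]) two_ne_zero))).ne'
  have hB : √(1 - v ^ 2) ≠ 0 :=
    (Real.sqrt_pos.2 (sub_pos.2 (pow_lt_one₀ hv.le (by linarith [hτ.2]) two_ne_zero))).ne'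
  simp only [symmPairing_alphaNormal, symmPairing_gammaNormal, contactVec, inner_vec3,
    Real.sin_neg, Real.cos_arcsin, hsin_u, hsin_v, PiLp.sub_apply, claspX_neg,
    contactHeight_neg_left, contactHeight_neg_right, Matrix.cons_val]
  generalize η (Real.arcsin u) = η₁, η (-Real.arcsin u) = η₂, ζ (Real.arcsin v) = ζ₁,
    ζ (-Real.arcsin v) = ζ₂
  calc _ = -(u / √(1 - u ^ 2) * (η₁ 0 - η₂ 0)) - (η₁ 2 + η₂ 2) +
        (-(v / √(1 - v ^ 2) * (ζ₁ 1 - ζ₂ 1)) + (ζ₁ 2 + ζ₂ 2)) := by field_simp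
    _ = _ := by
      rw [htan_u, htan_v]
      field_simp
      ring

theorem contact_balance {η ζ : ℝ → E3} (hp : p ≤ 0)
    (hstrut : ∀ s t, |s| ≤ Real.arcsin τ → |t| ≤ Real.arcsin τ → |Real.sin s| + |Real.sin t| = τ →
      p ≤ ⟪contactVec τ s t, η s - ζ t⟫) :
    symmPairing η alphaNormal (Real.arcsin u) / √(1 - u ^ 2) +
        symmPairing ζ gammaNormal (Real.arcsin v) / √(1 - v ^ 2) ≤
      -(p * 4) / √(1 - u ^ 2) + -(p * 4) / √(1 - v ^ 2) := by
  have hmem_u := arcsin_mem_Icc_arcsin (τ := τ) ⟨hu.le, by linarith⟩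
  have hmem_v := arcsin_mem_Icc_arcsin (τ := τ) ⟨hv.le, by linarith⟩
  have hstrut' : ∀ s t, |s| = Real.arcsin u → |t| = Real.arcsin v →
      p ≤ ⟪contactVec τ s t, η s - ζ t⟫ := by
    intro s t hs ht
    refine hstrut s t (hs.trans_le hmem_u.2) (ht.trans_le hmem_v.2) ?_
    rw [Real.abs_sin_eq_sin_abs_of_abs_le_pi (hs.trans_le hmem_u.2 |>.trans <| by
        linarith [Real.arcsin_le_pi_div_two τ, Real.pi_pos]),
      Real.abs_sin_eq_sin_abs_of_abs_le_pi (ht.trans_le hmem_v.2 |>.trans <| by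
        linarith [Real.arcsin_le_pi_div_two τ, Real.pi_pos]), hs, ht,
      Real.sin_arcsin (by linarith) (by linarith [hτ.2]),
      Real.sin_arcsin (by linarith) (by linarith [hτ.2]), huv]
  have habs_u := abs_of_nonneg hmem_u.1
  have habs_v := abs_of_nonneg hmem_v.1
  rw [contact_balance_eq hτ hu hv huv]
  have hH := contactHeight_pos hτ hu hv huv
  calc _ ≤ -(2 * contactHeight τ u v)⁻¹ * (p + p + p + p) := by
        refine mul_le_mul_of_nonpos_left ?_ (neg_nonpos.2 (by positivity))
        gcongr <;> apply hstrut' <;> simpa only [abs_neg]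
    _ = -(2 * p) * (contactHeight τ u v)⁻¹ := by
        field_simp
        ring
    _ ≤ -(2 * p) * (2 * ((√(1 - u ^ 2))⁻¹ + (√(1 - v ^ 2))⁻¹)) :=
        mul_le_mul_of_nonneg_left (inv_contactHeight_le hτ hu hv huv) (by linarith)
    _ = _ := by ring

end

variable {η ζ : ℝ → E3}
include hτ

theorem circle_balance (hη : ContinuousOn (symmPairing η alphaNormal) (Icc 0 (Real.pi / 2)))
    {w : E3} (hcirc : ∀ s, |s| ∈ Icc (Real.arcsin τ) (Real.pi / 2) →
      p ≤ ⟪!₂[Real.sin s, 0, Real.cos s], η s - w⟫) :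
    ∫ s in Real.arcsin τ..Real.pi / 2, symmPairing η alphaNormal s ≤
      -(p * (Real.pi - 2 * Real.arcsin τ)) - 2 * (1 - τ) * w 2 := by
  have hθ := arcsin_pos hτ
  have hπ := Real.arcsin_le_pi_div_two τ
  have hpointwise : ∀ s ∈ Ioo (Real.arcsin τ) (Real.pi / 2),
      symmPairing η alphaNormal s ≤ -(2 * p) - 2 * w 2 * Real.cos s := by
    intro s hs
    have habs : |s| ∈ Icc (Real.arcsin τ) (Real.pi / 2) := by
      rw [abs_of_pos (hθ.trans hs.1)]
      exact Ioo_subset_Icc_self hs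
    have hright := hcirc s habs
    have hleft := hcirc (-s) (by rwa [abs_neg])
    simp only [inner_vec3, PiLp.sub_apply, Real.sin_neg, Real.cos_neg, Matrix.cons_val]
      at hright hleft
    rw [symmPairing_alphaNormal]
    linarith
  calc ∫ s in Real.arcsin τ..Real.pi / 2, symmPairing η alphaNormal s
      ≤ ∫ s in Real.arcsin τ..Real.pi / 2, (-(2 * p) - 2 * w 2 * Real.cos s) :=
        intervalIntegral.integral_mono_on_of_le_Ioo hπ
          ((hη.mono (Icc_subset_Icc_left hθ.le)).intervalIntegrable_of_Icc hπ)
          (Continuous.intervalIntegrable (by fun_prop) _ _) hpointwise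
    _ = -(p * (Real.pi - 2 * Real.arcsin τ)) - 2 * (1 - τ) * w 2 := by
        rw [intervalIntegral.integral_sub intervalIntegrable_const
            (Continuous.intervalIntegrable (by fun_prop) _ _),
          intervalIntegral.integral_const, intervalIntegral.integral_const_mul, integral_cos,
          Real.sin_pi_div_two, sin_arcsin_self hτ, smul_eq_mul]
        ring

theorem contact_balance_integral (hp : p ≤ 0)
    (hη : ContinuousOn (symmPairing η alphaNormal) (Icc 0 (Real.arcsin τ)))
    (hζ : ContinuousOn (symmPairing ζ gammaNormal) (Icc 0 (Real.arcsin τ)))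
    (hstrut : ∀ s t, |s| ≤ Real.arcsin τ → |t| ≤ Real.arcsin τ → |Real.sin s| + |Real.sin t| = τ →
      p ≤ ⟪contactVec τ s t, η s - ζ t⟫) :
    (∫ s in (0 : ℝ)..Real.arcsin τ, symmPairing η alphaNormal s) +
      ∫ s in (0 : ℝ)..Real.arcsin τ, symmPairing ζ gammaNormal s ≤
      -(p * (8 * Real.arcsin τ)) := by
  have hconst : ContinuousOn (fun _ : ℝ => -(p * 4)) (Icc 0 (Real.arcsin τ)) := continuousOn_const
  have hflip : ∀ {f : ℝ → ℝ}, IntervalIntegrable f volume 0 τ →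
      IntervalIntegrable (fun u => f (τ - u)) volume 0 τ := fun hf => by
    simpa using (hf.comp_sub_left τ).symm
  have hflip_integral : ∀ f : ℝ → ℝ, ∫ u in (0 : ℝ)..τ, f (τ - u) = ∫ u in (0 : ℝ)..τ, f u := by
    intro f
    rw [intervalIntegral.integral_comp_sub_left, sub_self, sub_zero]
  have hintη := intervalIntegrable_comp_arcsin_div_sqrt hτ hη
  have hintζ := intervalIntegrable_comp_arcsin_div_sqrt hτ hζ
  have hint := intervalIntegrable_comp_arcsin_div_sqrt hτ hconst
  rw [← integral_comp_arcsin_div_sqrt hτ hη, ← integral_comp_arcsin_div_sqrt hτ hζ,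
    ← hflip_integral fun u => symmPairing ζ gammaNormal (Real.arcsin u) / √(1 - u ^ 2),
    ← intervalIntegral.integral_add hintη (hflip hintζ)]
  calc _ ≤ ∫ u in (0 : ℝ)..τ, (-(p * 4) / √(1 - u ^ 2) + -(p * 4) / √(1 - (τ - u) ^ 2)) :=
        intervalIntegral.integral_mono_on_of_le_Ioo hτ.1.le (hintη.add (hflip hintζ))
          (hint.add (hflip hint)) fun u hu =>
            contact_balance hτ hu.1 (sub_pos.2 hu.2) (add_sub_cancel u τ) hp hstrut
    _ = -(p * (8 * Real.arcsin τ)) := by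
        rw [intervalIntegral.integral_add hint (hflip hint),
          hflip_integral fun u => -(p * 4) / √(1 - u ^ 2), integral_comp_arcsin_div_sqrt hτ hconst,
          intervalIntegral.integral_const, smul_eq_mul]
        ring

theorem clasp_balance (hp : p ≤ 0)
    (hη : ContinuousOn η (Icc (-(Real.pi / 2)) (Real.pi / 2)))
    (hζ : ContinuousOn ζ (Icc (-Real.arcsin τ) (Real.arcsin τ)))
    (hstrut : ∀ s t, |s| ≤ Real.arcsin τ → |t| ≤ Real.arcsin τ → |Real.sin s| + |Real.sin t| = τ →
      p ≤ ⟪contactVec τ s t, η s - ζ t⟫)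
    (hcirc : ∀ s, |s| ∈ Icc (Real.arcsin τ) (Real.pi / 2) →
      p ≤ ⟪!₂[Real.sin s, 0, Real.cos s], η s - ζ 0⟫) :
    (∫ s in (0 : ℝ)..Real.pi / 2, symmPairing η alphaNormal s) +
      ∫ s in (0 : ℝ)..Real.arcsin τ, symmPairing ζ gammaNormal s ≤
      -(p * (6 * Real.arcsin τ + Real.pi)) - 2 * (1 - τ) * ζ 0 2 := by
  have hθ := (arcsin_pos hτ).le
  have hπ := Real.arcsin_le_pi_div_two τ
  have hη' := continuousOn_symmPairing hη continuous_alphaNormal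
  have hηclasp := hη'.mono (Icc_subset_Icc_right hπ)
  have hcontact := contact_balance_integral hτ hp hηclasp
    (continuousOn_symmPairing hζ continuous_gammaNormal) hstrut
  have hcircle := circle_balance hτ hη' hcirc
  rw [← intervalIntegral.integral_add_adjacent_intervals (hηclasp.intervalIntegrable_of_Icc hθ)
    ((hη'.mono (Icc_subset_Icc_left hθ)).intervalIntegrable_of_Icc hπ)]
  linarith

end Contact

/-! ### The curvature force -/

section TangentDerivatives

variable {τ d s : ℝ}

theorem hasDerivAt_gammaTangent_of_abs_lt (hs : |s| < Real.arcsin τ) :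
    HasDerivAt (gammaTangent τ) (gammaNormal s) s := by
  have h := hasDerivAt_clamp_of_abs_lt hs
  refine (hasDerivAt_vec3 (hasDerivAt_const s 0) h.cos h.sin).congr_deriv ?_
  rw [clamp_of_abs_le hs.le, gammaNormal, mul_one, mul_one]

theorem hasDerivAt_gammaTangent_of_lt_abs (hτ : τ ∈ Ioc 0 1) (hs : Real.arcsin τ < |s|) :
    HasDerivAt (gammaTangent τ) 0 s := by
  have h := hasDerivAt_clamp_of_lt_abs (arcsin_pos hτ).le hs
  refine (hasDerivAt_vec3 (hasDerivAt_const s 0) h.cos h.sin).congr_deriv ?_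
  simp only [mul_zero]
  exact (vec3_eq 0 0 0).trans (by simp only [zero_smul, add_zero])

theorem hasDerivAt_alphaAngle (hd : 0 ≤ d) (hs : s < alphaHalf d) {k : ℝ}
    (h : HasDerivAt (clamp (Real.pi / 2)) k s) : HasDerivAt (alphaAngle d) k s :=
  h.congr_of_eventuallyEq <| by
    filter_upwards [Iio_mem_nhds hs] with x hx using alphaAngle_of_le hd (le_of_lt hx)

theorem hasDerivAt_alphaTangent_of_abs_lt (hd : 0 ≤ d) (hs : |s| < Real.pi / 2) :
    HasDerivAt (alphaTangent d) (alphaNormal s) s := by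
  have hs' : s < alphaHalf d :=
    (le_abs_self s).trans_lt (hs.trans_le (pi_div_two_le_alphaHalf hd))
  have h := hasDerivAt_alphaAngle hd hs' (hasDerivAt_clamp_of_abs_lt hs)
  refine (hasDerivAt_vec3 h.cos (hasDerivAt_const s 0) h.sin.neg).congr_deriv ?_
  rw [alphaAngle_of_le hd hs'.le, clamp_of_abs_le hs.le, alphaNormal, mul_one, mul_one]

theorem hasDerivAt_alphaTangent_of_lt_abs (hd : 0 ≤ d) (hs : Real.pi / 2 < |s|)
    (hs' : |s| < alphaHalf d) : HasDerivAt (alphaTangent d) 0 s := by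
  have h := hasDerivAt_alphaAngle hd ((le_abs_self s).trans_lt hs')
    (hasDerivAt_clamp_of_lt_abs Real.pi_div_two_pos.le hs)
  refine (hasDerivAt_vec3 h.cos (hasDerivAt_const s 0) h.sin.neg).congr_deriv ?_
  simp only [mul_zero, neg_zero]
  exact (vec3_eq 0 0 0).trans (by simp only [zero_smul, add_zero])

theorem alphaTangent_reflect (d s : ℝ) :
    alphaTangent d (2 * alphaHalf d - s) = -reflZ (alphaTangent d s) := by
  have h : alphaAngle d (2 * alphaHalf d - s) = Real.pi - alphaAngle d s := by
    rw [alphaAngle, alphaAngle, sub_sub_cancel_left, ← neg_sub s,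
      clamp_neg Real.pi_div_two_pos, clamp_neg Real.pi_div_two_pos]
    ring
  rw [alphaTangent, alphaTangent, h, Real.cos_pi_sub, Real.sin_pi_sub, reflZ_vec3,
    neg_vec3, neg_zero, neg_neg]

theorem hasDerivAt_alphaTangent_reflect {v : E3} (h : HasDerivAt (alphaTangent d) v s) :
    HasDerivAt (alphaTangent d) (reflZ v) (2 * alphaHalf d - s) := by
  have hreflect : alphaTangent d = fun x => -reflZ (alphaTangent d (2 * alphaHalf d - x)) := by
    funext x
    rw [← alphaTangent_reflect, sub_sub_cancel]
  have hcomp : HasDerivAt (fun x => alphaTangent d (2 * alphaHalf d - x)) (-v)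
      (2 * alphaHalf d - s) :=
    HasDerivAt.comp_const_sub _ _ (by rwa [sub_sub_cancel])
  rw [hreflect]
  exact (hasDerivAt_reflZ hcomp).neg.congr_deriv (by rw [reflZ_neg, neg_neg])

end TangentDerivatives

section Boundary

variable {τ d c l : ℝ}

theorem gammaTangent_right (hτ : τ ∈ Ioc 0 1) (hl : 0 ≤ l) :
    gammaTangent τ (Real.arcsin τ + l) = wallNormal τ 1 1 := by
  rw [gammaTangent, clamp_of_le (arcsin_pos hτ).le (by linarith), sin_arcsin_self hτ,
    Real.cos_arcsin, wallNormal, one_mul, one_mul]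

theorem gammaTangent_left (hτ : τ ∈ Ioc 0 1) (hl : 0 ≤ l) :
    gammaTangent τ (-(Real.arcsin τ + l)) = -wallNormal τ (-1) 1 := by
  rw [gammaTangent, clamp_of_le_neg (arcsin_pos hτ).le (by linarith), Real.sin_neg, Real.cos_neg,
    sin_arcsin_self hτ, Real.cos_arcsin, wallNormal, neg_vec3, neg_zero, one_mul,
    neg_one_mul, neg_neg]

theorem reflZ_wallNormal (τ σ ρ : ℝ) : reflZ (wallNormal τ σ ρ) = wallNormal τ σ (-ρ) := by
  rw [wallNormal, wallNormal, reflZ_vec3, neg_mul]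

theorem alphaTangent_closes (hd : 0 ≤ d) :
    alphaTangent d (3 * alphaHalf d) = alphaTangent d (-alphaHalf d) := by
  have hhalf := alphaHalf_pos hd
  have hup : alphaTangent d (-alphaHalf d) = !₂[0, 0, 1] := by
    rw [alphaTangent, alphaAngle_of_le hd (by linarith), clamp_of_le_neg Real.pi_div_two_pos.le
      (neg_le_neg (pi_div_two_le_alphaHalf hd)), Real.cos_neg, Real.sin_neg, Real.cos_pi_div_two,
      Real.sin_pi_div_two, neg_neg]
  rw [show 3 * alphaHalf d = 2 * alphaHalf d - -alphaHalf d by ring, alphaTangent_reflect, hup,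
    reflZ_vec3, neg_vec3, neg_zero, neg_neg]

theorem boundary_term_eq_zero (hτ : τ ∈ Ioc 0 1) (hd : 0 ≤ d) (he : 0 ≤ endLength τ d c)
    {ξ : Fin 3 → ℝ → E3} (hξ : (chainedClasp τ d c).Compatible ξ) (i : Fin 3) :
    ⟪ξ i ((chainedClasp τ d c).strand i).right,
        linkTangent τ d i ((chainedClasp τ d c).strand i).right⟫ -
      ⟪ξ i ((chainedClasp τ d c).strand i).left,
        linkTangent τ d i ((chainedClasp τ d c).strand i).left⟫ = 0 := by
  obtain ⟨-, hclosed, harc⟩ := hξ i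
  fin_cases i
  · have hends : ξ 0 (-alphaHalf d) = ξ 0 (3 * alphaHalf d) := hclosed trivial
    change ⟪ξ 0 (3 * alphaHalf d), alphaTangent d (3 * alphaHalf d)⟫ -
      ⟪ξ 0 (-alphaHalf d), alphaTangent d (-alphaHalf d)⟫ = 0
    rw [hends, alphaTangent_closes hd, sub_self]
  · obtain ⟨hleft, hright⟩ := harc id
    change ⟪ξ 1 (Real.arcsin τ + endLength τ d c),
        reflZ (gammaTangent τ (Real.arcsin τ + endLength τ d c))⟫ -
      ⟪ξ 1 (-(Real.arcsin τ + endLength τ d c)),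
        reflZ (gammaTangent τ (-(Real.arcsin τ + endLength τ d c)))⟫ = 0
    rw [gammaTangent_left hτ he, gammaTangent_right hτ he, reflZ_neg, inner_neg_right,
      reflZ_wallNormal, reflZ_wallNormal, real_inner_comm, sub_neg_eq_add,
      real_inner_comm (wallNormal τ (-1) (-1))]
    exact (congrArg₂ (· + ·) (inner_eq_zero_of_mem_direction_wallPlane hright)
      (inner_eq_zero_of_mem_direction_wallPlane hleft)).trans (add_zero 0)
  · obtain ⟨hleft, hright⟩ := harc id
    change ⟪ξ 2 (Real.arcsin τ + endLength τ d c),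
        gammaTangent τ (Real.arcsin τ + endLength τ d c)⟫ -
      ⟪ξ 2 (-(Real.arcsin τ + endLength τ d c)),
        gammaTangent τ (-(Real.arcsin τ + endLength τ d c))⟫ = 0
    rw [gammaTangent_left hτ he, gammaTangent_right hτ he, inner_neg_right, real_inner_comm,
      sub_neg_eq_add, real_inner_comm (wallNormal τ (-1) 1)]
    exact (congrArg₂ (· + ·) (inner_eq_zero_of_mem_direction_wallPlane hright)
      (inner_eq_zero_of_mem_direction_wallPlane hleft)).trans (add_zero 0)

end Boundary

section Force

variable {τ d c : ℝ}

/-- The measure on the parameter interval of the component `i` with respect to which its curvature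
force is represented by the density `linkNormal τ d i`. -/
def linkMeasure (τ d c : ℝ) (i : Fin 3) : Measure ℝ :=
  volume.restrict ((chainedClasp τ d c).strand i).dom

/-- The derivative of the unit tangent vector, which is the density of the curvature force. -/
def linkNormal (τ d : ℝ) (i : Fin 3) : ℝ → E3 := deriv (linkTangent τ d i)

theorem forcePairing_eq_sum (τ d c : ℝ) (ξ : Fin 3 → ℝ → E3) :
    (chainedClasp τ d c).forcePairing (linkMeasure τ d c) (linkNormal τ d) ξ =
      ∑ i, ∫ s in ((chainedClasp τ d c).strand i).dom, ⟪ξ i s, linkNormal τ d i s⟫ := by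
  refine Finset.sum_congr rfl fun i _ => ?_
  rw [linkMeasure, Measure.restrict_restrict (by exact measurableSet_Icc), inter_self]

theorem chainedClasp_isCurvatureForce (hτ : τ ∈ Ioc 0 1) (hd : 0 ≤ d)
    (he : 0 ≤ endLength τ d c) :
    (chainedClasp τ d c).IsCurvatureForce (linkMeasure τ d c) (linkNormal τ d) := by
  refine ⟨fun i => ⟨isFiniteMeasure_restrict.2 measure_Icc_lt_top.ne, ?_⟩, fun ξ hξ hlip => ?_⟩
  · obtain ⟨K, hK⟩ := isLip_linkTangent τ d i
    exact integrableOn_deriv_of_lipschitzOnWith_Icc hK.lipschitzOnWith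
  have hlength : ∀ i, HasDerivAt (fun t => (((chainedClasp τ d c).vary ξ t).strand i).length)
      (-∫ s in ((chainedClasp τ d c).strand i).dom, ⟪ξ i s, linkNormal τ d i s⟫) 0 := by
    intro i
    obtain ⟨Kc, hc⟩ := isLip_path hτ hd c i
    obtain ⟨KT, hT⟩ := isLip_linkTangent τ d i
    obtain ⟨Kξ, hKξ⟩ := hlip i
    have h := hasDerivAt_integral_norm_deriv_vary (chainedClasp_left_lt_right hτ hd he i).le
      hc.lipschitzOnWith hT (norm_linkTangent τ d i)
      ((ae_hasDerivAt_path hτ hd c i).mono fun s h _ => h) hKξ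
    rw [boundary_term_eq_zero hτ hd he hξ, zero_sub] at h
    exact h
  rw [forcePairing_eq_sum, ← Finset.sum_neg_distrib]
  exact HasDerivAt.fun_sum fun i _ => hlength i

theorem integral_gamma (hτ : τ ∈ Ioc 0 1) (he : 0 ≤ endLength τ d c) {ζ : ℝ → E3}
    (hζ : ContinuousOn ζ ((chainedClasp τ d c).strand 2).dom) :
    ∫ s in ((chainedClasp τ d c).strand 2).dom, ⟪ζ s, linkNormal τ d 2 s⟫ =
      ∫ s in (0 : ℝ)..Real.arcsin τ, symmPairing ζ gammaNormal s :=
  integral_inner_eq_integral_symmPairing (arcsin_pos hτ).le (le_add_of_nonneg_right he) hζ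
    continuous_gammaNormal (fun _ hs => (hasDerivAt_gammaTangent_of_abs_lt hs).deriv)
    fun _ hs _ => (hasDerivAt_gammaTangent_of_lt_abs hτ hs).deriv

theorem continuous_reflZ : Continuous reflZ := reflZEquiv.continuous

theorem symmPairing_reflZ (ξ N : ℝ → E3) :
    symmPairing (fun s => reflZ (ξ s)) N = symmPairing ξ fun s => reflZ (N s) := by
  funext s
  rw [symmPairing, symmPairing, inner_reflZ_right, inner_reflZ_right]

theorem integral_beta (hτ : τ ∈ Ioc 0 1) (he : 0 ≤ endLength τ d c) {ζ : ℝ → E3}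
    (hζ : ContinuousOn ζ ((chainedClasp τ d c).strand 1).dom) :
    ∫ s in ((chainedClasp τ d c).strand 1).dom, ⟪ζ s, linkNormal τ d 1 s⟫ =
      ∫ s in (0 : ℝ)..Real.arcsin τ, symmPairing (fun s => reflZ (ζ s)) gammaNormal s := by
  rw [symmPairing_reflZ]
  exact integral_inner_eq_integral_symmPairing (arcsin_pos hτ).le (le_add_of_nonneg_right he) hζ
    (continuous_reflZ.comp continuous_gammaNormal)
    (fun _ hs => (hasDerivAt_reflZ (hasDerivAt_gammaTangent_of_abs_lt hs)).deriv)
    fun _ hs _ => (hasDerivAt_reflZ (hasDerivAt_gammaTangent_of_lt_abs hτ hs)).deriv.trans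
      (map_zero reflZEquiv)

theorem integral_alpha (hd : 0 ≤ d) {η : ℝ → E3}
    (hη : ContinuousOn η ((chainedClasp τ d c).strand 0).dom) :
    ∫ s in ((chainedClasp τ d c).strand 0).dom, ⟪η s, linkNormal τ d 0 s⟫ =
      (∫ s in (0 : ℝ)..Real.pi / 2, symmPairing η alphaNormal s) +
        ∫ s in (0 : ℝ)..Real.pi / 2,
          symmPairing (fun s => reflZ (η (2 * alphaHalf d - s))) alphaNormal s := by
  have hhalf := alphaHalf_pos hd
  have hpi := pi_div_two_le_alphaHalf hd
  have hη : ContinuousOn η (Icc (-alphaHalf d) (3 * alphaHalf d)) := hη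
  have hreflect :
      ContinuousOn (fun s => η (2 * alphaHalf d - s)) (Icc (-alphaHalf d) (alphaHalf d)) :=
    hη.comp (by fun_prop) fun s hs => ⟨by linarith [hs.2], by linarith [hs.1]⟩
  obtain ⟨K, hK⟩ := isLip_alphaTangent d
  have hint (a b : ℝ) (ha : -alphaHalf d ≤ a) (hab : a ≤ b) (hb : b ≤ 3 * alphaHalf d) :
      IntervalIntegrable (fun s => ⟪η s, deriv (alphaTangent d) s⟫) volume a b :=
    (intervalIntegrable_iff_integrableOn_Icc_of_le hab).2 <|
      (integrableOn_inner_deriv hη hK.lipschitzOnWith).mono_set (Icc_subset_Icc ha hb)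
  have hupper := integral_inner_eq_integral_symmPairing Real.pi_div_two_pos.le hpi
    (hη.mono (Icc_subset_Icc_right (by linarith))) continuous_alphaNormal
    (fun _ hs => (hasDerivAt_alphaTangent_of_abs_lt hd hs).deriv)
    fun _ hs hs' => (hasDerivAt_alphaTangent_of_lt_abs hd hs hs').deriv
  have hlower := integral_inner_eq_integral_symmPairing
    (T := fun s => deriv (alphaTangent d) (2 * alphaHalf d - s)) Real.pi_div_two_pos.le hpi
    hreflect (continuous_reflZ.comp continuous_alphaNormal)
    (fun _ hs => (hasDerivAt_alphaTangent_reflect (hasDerivAt_alphaTangent_of_abs_lt hd hs)).deriv)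
    fun _ hs hs' => (hasDerivAt_alphaTangent_reflect
      (hasDerivAt_alphaTangent_of_lt_abs hd hs hs')).deriv.trans (map_zero reflZEquiv)
  rw [integral_Icc_eq_integral_Ioc, ← intervalIntegral.integral_of_le (by linarith)]
    at hupper hlower
  have hsub := intervalIntegral.integral_comp_sub_left (a := -alphaHalf d) (b := alphaHalf d)
    (fun s => ⟪η s, deriv (alphaTangent d) s⟫) (2 * alphaHalf d)
  rw [symmPairing_reflZ, ← hupper]
  refine Eq.trans ?_ (congrArg _ (hsub.symm.trans hlower))
  rw [show 2 * alphaHalf d - alphaHalf d = alphaHalf d by ring,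
    show 2 * alphaHalf d - -alphaHalf d = 3 * alphaHalf d by ring,
    intervalIntegral.integral_add_adjacent_intervals (hint _ _ le_rfl (by linarith) (by linarith))
      (hint _ _ (by linarith) (by linarith) le_rfl),
    intervalIntegral.integral_of_le (by linarith), ← integral_Icc_eq_integral_Ioc]
  rfl

end Force

/-! ### Strong criticality -/

section Criticality

variable {τ c d p : ℝ} {ξ : Fin 3 → ℝ → E3}

theorem le_inner_of_norm_eq_one (hτ : τ ∈ Ioc 0 1) (hd : 1 ≤ d) (he : 0 ≤ endLength τ d c)
    (hrate : (chainedClasp τ d c).IsStrutRateBound ξ p) {i j : Fin 3} {s t : ℝ} (hij : i ≠ j)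
    (hs : s ∈ ((chainedClasp τ d c).strand i).dom) (ht : t ∈ ((chainedClasp τ d c).strand j).dom)
    (hnorm :
      ‖((chainedClasp τ d c).strand i).path s - ((chainedClasp τ d c).strand j).path t‖ = 1) :
    p ≤ ⟪((chainedClasp τ d c).strand i).path s - ((chainedClasp τ d c).strand j).path t,
      ξ i s - ξ j t⟫ := by
  have h := hrate i j s t hij hs ht
  rwa [chainedClasp_gThi hτ hd he, mul_one, dist_eq_norm, imp_iff_right hnorm] at h

theorem upper_clasp_balance (hτ : τ ∈ Ioc 0 1) (hd : 1 ≤ d) (he : 0 ≤ endLength τ d c)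
    (hp : p ≤ 0) (hξ : ∀ i, ContinuousOn (ξ i) ((chainedClasp τ d c).strand i).dom)
    (hrate : (chainedClasp τ d c).IsStrutRateBound ξ p) :
    (∫ s in (0 : ℝ)..Real.pi / 2, symmPairing (ξ 0) alphaNormal s) +
      ∫ s in (0 : ℝ)..Real.arcsin τ, symmPairing (ξ 2) gammaNormal s ≤
      -(p * (6 * Real.arcsin τ + Real.pi)) - 2 * (1 - τ) * ξ 2 0 2 := by
  have hd' : 0 ≤ d := zero_le_one.trans hd
  refine clasp_balance hτ hp ((hξ 0).mono fun s hs => mem_dom_alpha hd' τ c (abs_le.2 hs))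
    ((hξ 2).mono fun s hs => mem_dom_gamma he (abs_le.2 hs)) (fun s t hs ht hst => ?_)
    fun s hs => ?_
  · have hdiff := alphaPath_sub_gammaPath hτ hd' hs ht hst
    rw [← hdiff]
    exact le_inner_of_norm_eq_one hτ hd he hrate (by decide)
      (mem_dom_alpha hd' τ c (hs.trans (Real.arcsin_le_pi_div_two τ))) (mem_dom_gamma he ht)
      ((congrArg norm hdiff).trans (norm_contactVec hτ hst))
  · have hdiff := alphaPath_sub_tip hτ hd' hs
    rw [← hdiff]
    exact le_inner_of_norm_eq_one hτ hd he hrate (by decide) (mem_dom_alpha hd' τ c hs.2)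
      (mem_dom_gamma he (abs_zero.trans_le (arcsin_pos hτ).le))
      ((congrArg norm hdiff).trans (norm_sin_cos s))

theorem lower_clasp_balance (hτ : τ ∈ Ioc 0 1) (hd : 1 ≤ d) (he : 0 ≤ endLength τ d c)
    (hp : p ≤ 0) (hξ : ∀ i, ContinuousOn (ξ i) ((chainedClasp τ d c).strand i).dom)
    (hrate : (chainedClasp τ d c).IsStrutRateBound ξ p) :
    (∫ s in (0 : ℝ)..Real.pi / 2,
        symmPairing (fun s => reflZ (ξ 0 (2 * alphaHalf d - s))) alphaNormal s) +
      ∫ s in (0 : ℝ)..Real.arcsin τ, symmPairing (fun s => reflZ (ξ 1 s)) gammaNormal s ≤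
      -(p * (6 * Real.arcsin τ + Real.pi)) + 2 * (1 - τ) * ξ 1 0 2 := by
  have hd' : 0 ≤ d := zero_le_one.trans hd
  have hdiff_refl (s t : ℝ) : alphaPath τ d (2 * alphaHalf d - s) - reflZ (gammaPath τ d t) =
      reflZ (alphaPath τ d s - gammaPath τ d t) := by
    rw [alphaPath_reflect hτ hd', reflZ_sub]
  have hα {s : ℝ} (hs : |s| ≤ Real.pi / 2) :
      2 * alphaHalf d - s ∈ ((chainedClasp τ d c).strand 0).dom :=
    reflect_mem_dom_alpha (mem_dom_alpha hd' τ c hs)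
  rw [show 2 * (1 - τ) * ξ 1 0 2 = -(2 * (1 - τ) * reflZ (ξ 1 0) 2) by simp [reflZ],
    ← sub_eq_add_neg]
  refine clasp_balance hτ hp
    (continuous_reflZ.comp_continuousOn ((hξ 0).comp (by fun_prop) fun s hs => hα (abs_le.2 hs)))
    (continuous_reflZ.comp_continuousOn ((hξ 1).mono fun s hs => mem_dom_beta he (abs_le.2 hs)))
    (fun s t hs ht hst => ?_) fun s hs => ?_
  · have hdiff := alphaPath_sub_gammaPath hτ hd' hs ht hst
    rw [← reflZ_sub, inner_reflZ_right, ← hdiff, ← hdiff_refl]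
    refine le_inner_of_norm_eq_one hτ hd he hrate (by decide)
      (hα (hs.trans (Real.arcsin_le_pi_div_two τ))) (mem_dom_beta he ht)
      ((congrArg norm (hdiff_refl s t)).trans ?_)
    rw [norm_reflZ, hdiff, norm_contactVec hτ hst]
  · have hdiff := alphaPath_sub_tip hτ hd' hs
    rw [← reflZ_sub, inner_reflZ_right, ← hdiff, ← hdiff_refl]
    refine le_inner_of_norm_eq_one hτ hd he hrate (by decide) (hα hs.2)
      (mem_dom_beta he (abs_zero.trans_le (arcsin_pos hτ).le))
      ((congrArg norm (hdiff_refl s 0)).trans ?_)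
    rw [norm_reflZ, hdiff, norm_sin_cos]

theorem tip_sub_tip (hτ : τ ∈ Ioc 0 1) (d : ℝ) :
    gammaPath τ d 0 - reflZ (gammaPath τ d 0) = !₂[0, 0, d] := by
  rw [gammaPath_zero hτ, reflZ_vec3]
  ext i
  fin_cases i <;> simp

theorem norm_vertical_one : ‖(!₂[0, 0, 1] : E3)‖ = 1 := by
  rw [← sq_eq_sq₀ (norm_nonneg _) zero_le_one, norm_sq_vec3]
  simp

theorem le_tip_rate (hτ : τ ∈ Ioc 0 1) (he : 0 ≤ endLength τ 1 c)
    (hrate : (chainedClasp τ 1 c).IsStrutRateBound ξ p) : p ≤ ξ 2 0 2 - ξ 1 0 2 := by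
  have htip : |(0 : ℝ)| ≤ Real.arcsin τ := abs_zero.trans_le (arcsin_pos hτ).le
  have h : p ≤ ⟪gammaPath τ 1 0 - reflZ (gammaPath τ 1 0), ξ 2 0 - ξ 1 0⟫ :=
    le_inner_of_norm_eq_one hτ le_rfl he hrate (by decide) (mem_dom_gamma he htip)
      (mem_dom_beta he htip) ((congrArg norm (tip_sub_tip hτ 1)).trans norm_vertical_one)
  rw [tip_sub_tip hτ, inner_vec3] at h
  simpa using h

theorem forcePairing_eq (hτ : τ ∈ Ioc 0 1) (hd : 0 ≤ d) (he : 0 ≤ endLength τ d c)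
    (hξ : ∀ i, ContinuousOn (ξ i) ((chainedClasp τ d c).strand i).dom) :
    (chainedClasp τ d c).forcePairing (linkMeasure τ d c) (linkNormal τ d) ξ =
      ((∫ s in (0 : ℝ)..Real.pi / 2, symmPairing (ξ 0) alphaNormal s) +
        ∫ s in (0 : ℝ)..Real.arcsin τ, symmPairing (ξ 2) gammaNormal s) +
      ((∫ s in (0 : ℝ)..Real.pi / 2,
          symmPairing (fun s => reflZ (ξ 0 (2 * alphaHalf d - s))) alphaNormal s) +
        ∫ s in (0 : ℝ)..Real.arcsin τ, symmPairing (fun s => reflZ (ξ 1 s)) gammaNormal s) := by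
  rw [forcePairing_eq_sum, Fin.sum_univ_three, integral_alpha hd (hξ 0),
    integral_beta hτ he (hξ 1), integral_gamma hτ he (hξ 2)]
  ring

/-- A bound for the total mass of the strut measure that balances the curvature force. -/
def strutMass (τ : ℝ) : ℝ := 2 * (6 * Real.arcsin τ + Real.pi) + 2 * (1 - τ)

theorem strutMass_pos (hτ : τ ∈ Ioc 0 1) : 0 < strutMass τ := by
  have hθ := arcsin_pos hτ
  have hgap : 0 ≤ 1 - τ := sub_nonneg.2 hτ.2
  unfold strutMass
  positivity

/-- The strut between the tips carries the mass `2 * (1 - τ)`; for `τ = 1` each of the two clasps is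
balanced on its own. -/
theorem forcePairing_le (hτ : τ ∈ Ioc 0 1) (hd : 1 ≤ d) (hd1 : τ < 1 → d = 1)
    (he : 0 ≤ endLength τ d c) (hp : p ≤ 0)
    (hξ : ∀ i, ContinuousOn (ξ i) ((chainedClasp τ d c).strand i).dom)
    (hrate : (chainedClasp τ d c).IsStrutRateBound ξ p) :
    (chainedClasp τ d c).forcePairing (linkMeasure τ d c) (linkNormal τ d) ξ ≤
      -(p * strutMass τ) := by
  have hupper := upper_clasp_balance hτ hd he hp hξ hrate
  have hlower := lower_clasp_balance hτ hd he hp hξ hrate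
  have htips : (1 - τ) * p ≤ (1 - τ) * (ξ 2 0 2 - ξ 1 0 2) := by
    rcases hτ.2.lt_or_eq with hlt | rfl
    · obtain rfl := hd1 hlt
      exact mul_le_mul_of_nonneg_left (le_tip_rate hτ he hrate) (sub_nonneg.2 hτ.2)
    · simp only [sub_self, zero_mul, le_refl]
  rw [forcePairing_eq hτ (zero_le_one.trans hd) he hξ, strutMass]
  linarith

theorem chainedClasp_isStronglyCritical (hτ : τ ∈ Ioc 0 1) (hd : 1 ≤ d) (hd1 : τ < 1 → d = 1)
    (he : 0 ≤ endLength τ d c) : (chainedClasp τ d c).IsStronglyCritical := by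
  have hd' : 0 ≤ d := zero_le_one.trans hd
  have hM := strutMass_pos hτ
  have hgThi := chainedClasp_gThi hτ hd he
  have hvalid := chainedClasp_isValid hτ hd he
  refine ⟨linkMeasure τ d c, linkNormal τ d, chainedClasp_isCurvatureForce hτ hd' he,
    1 / strutMass τ, one_div_pos.2 hM, fun ξ hξ hlen => ?_⟩
  have hpath i : ContinuousOn ((chainedClasp τ d c).strand i).path
      ((chainedClasp τ d c).strand i).dom := (hvalid.lipschitz i).choose_spec.continuousOn
  have hcont i := (hξ i).1
  obtain ⟨p, hp, hrate⟩ := GeneralizedLink.exists_hasDerivWithinAt_gThi hpath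
    (hgThi.symm ▸ one_pos) hcont
  obtain ⟨q, hq⟩ := GeneralizedLink.exists_hasDerivWithinAt_obstacleMin hpath
    hvalid.contDiff_obstacle hcont
  refine ⟨p, q, hp, hq, (min_le_left p q).trans ?_⟩
  have hrate' : (chainedClasp τ d c).IsStrutRateBound ξ (min p 0) := fun i j s t hij hs ht hst =>
    (mul_le_mul_of_nonneg_right (min_le_left p 0) (hgThi.symm ▸ zero_le_one)).trans
      (hrate i j s t hij hs ht hst)
  have hforce := forcePairing_le hτ hd hd1 he (min_le_right p 0) hcont hrate'
  have hmin : min p 0 ≤ -(1 / strutMass τ) := by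
    rw [← neg_div, le_div_iff₀ hM]
    linarith
  exact (min_le_iff.1 hmin).resolve_right (neg_neg_of_pos (one_div_pos.2 hM)).not_ge

end Criticality

section TipStrut

variable {τ c : ℝ}

/-- The pair formed by the tips of `β` and `γ`. -/
def tipPair (τ c : ℝ) : E3 × E3 :=
  (((chainedClasp τ 1 c).strand 1).path 0, ((chainedClasp τ 1 c).strand 2).path 0)

theorem tipPair_mem_gStrut (hτ : τ ∈ Ioc 0 1) (he : 0 ≤ endLength τ 1 c) :
    tipPair τ c ∈ (chainedClasp τ 1 c).gStrut := by
  have htip : |(0 : ℝ)| ≤ Real.arcsin τ := abs_zero.trans_le (arcsin_pos hτ).le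
  refine ⟨1, 2, by decide, 0, mem_dom_beta he htip, 0, mem_dom_gamma he htip, rfl, ?_⟩
  change dist (reflZ (gammaPath τ 1 0)) (gammaPath τ 1 0) = _
  rw [chainedClasp_gThi hτ le_rfl he, dist_comm, dist_eq_norm, tip_sub_tip hτ, norm_vertical_one]

theorem eq_zero_of_dist_beta_gamma_eq_one (hτ : τ ∈ Ioc 0 1) {s t : ℝ}
    (hst : dist (reflZ (gammaPath τ 1 s)) (gammaPath τ 1 t) = 1) : s = 0 ∧ t = 0 := by
  have hdist := add_gammaHeight_le_dist_beta_gamma hτ 1 s t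
  have hs := gammaHeight_nonneg hτ s
  have ht := gammaHeight_nonneg hτ t
  constructor <;> by_contra hne <;> linarith [gammaHeight_pos hτ hne]

theorem eq_tipPair_of_mem_gStrut (hτ : τ ∈ Ioc 0 1) (he : 0 ≤ endLength τ 1 c) {p : E3 × E3}
    (hp : p ∈ (chainedClasp τ 1 c).gStrut) (hdist : dist p (tipPair τ c) < 1) :
    p = tipPair τ c := by
  have htip : |(0 : ℝ)| ≤ Real.arcsin τ := abs_zero.trans_le (arcsin_pos hτ).le
  obtain ⟨i, j, -, s, hs, t, ht, rfl, hst⟩ := hp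
  have hlt := max_lt_iff.1 hdist
  have hi : i = 1 := by
    by_contra h
    have hfar := chainedClasp_one_le_dist hτ le_rfl h hs (mem_dom_beta he htip)
    exact hlt.1.not_ge hfar
  have hj : j = 2 := by
    by_contra h
    have hfar := chainedClasp_one_le_dist hτ le_rfl h ht (mem_dom_gamma he htip)
    exact hlt.2.not_ge hfar
  subst hi hj
  have hst' : dist (reflZ (gammaPath τ 1 s)) (gammaPath τ 1 t) = 1 :=
    hst.trans (chainedClasp_gThi hτ le_rfl he)
  obtain ⟨hs0, ht0⟩ := eq_zero_of_dist_beta_gamma_eq_one hτ hst'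
  rw [hs0, ht0, tipPair]

end TipStrut

/-! ### Lengths -/

section Lengths

variable {τ c d : ℝ}

theorem continuous_upperSpeed (hτ : τ ∈ Ioc 0 1) : Continuous (upperSpeed τ) :=
  Continuous.if_le (continuous_claspSpeed hτ) continuous_const continuous_abs continuous_const
    fun _ hs => (upperSpeed_of_abs_le hs.le).symm.trans (upperSpeed_of_le_abs hτ hs.ge)

/-- The length of a clasp arc. -/
def claspLength (τ : ℝ) : ℝ := ∫ s in -Real.arcsin τ..Real.arcsin τ, claspSpeed τ s

theorem integral_upperSpeed (hτ : τ ∈ Ioc 0 1) {R : ℝ} (hR : Real.arcsin τ ≤ R) :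
    ∫ s in -R..R, upperSpeed τ s = claspLength τ + 2 * (R - Real.arcsin τ) := by
  have hθ := (arcsin_pos hτ).le
  have hint (a b : ℝ) : IntervalIntegrable (upperSpeed τ) volume a b :=
    (continuous_upperSpeed hτ).intervalIntegrable a b
  have hclasp : ∫ s in -Real.arcsin τ..Real.arcsin τ, upperSpeed τ s = claspLength τ :=
    intervalIntegral.integral_congr fun s hs => by
      rw [uIcc_of_le (by linarith)] at hs
      exact upperSpeed_of_abs_le (abs_le.2 hs)
  have hleft : ∫ s in -R..-Real.arcsin τ, upperSpeed τ s = ∫ s in -R..-Real.arcsin τ, 1 :=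
    intervalIntegral.integral_congr fun s hs => by
      rw [uIcc_of_le (by linarith)] at hs
      exact upperSpeed_of_le_abs hτ (le_abs.2 (Or.inr (le_neg.1 hs.2)))
  have hright : ∫ s in Real.arcsin τ..R, upperSpeed τ s = ∫ s in Real.arcsin τ..R, 1 :=
    intervalIntegral.integral_congr fun s hs => by
      rw [uIcc_of_le hR] at hs
      exact upperSpeed_of_le_abs hτ (le_abs.2 (Or.inl hs.1))
  rw [← intervalIntegral.integral_add_adjacent_intervals (hint _ (Real.arcsin τ)) (hint _ R),
    ← intervalIntegral.integral_add_adjacent_intervals (hint _ (-Real.arcsin τ)) (hint _ _),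
    hclasp, hleft, hright, intervalIntegral.integral_const, intervalIntegral.integral_const,
    smul_eq_mul, smul_eq_mul]
  ring

theorem length_eq_integral {C : Strand} (hC : C.left ≤ C.right) {v : ℝ → ℝ} {T : ℝ → E3}
    (hT : ∀ s, ‖T s‖ = 1) (h : ∀ᵐ s : ℝ, 0 < v s ∧ HasDerivAt C.path (v s • T s) s) :
    C.length = ∫ s in C.left..C.right, v s := by
  rw [Strand.length, Strand.dom, integral_Icc_eq_integral_Ioc,
    ← intervalIntegral.integral_of_le hC]
  refine intervalIntegral.integral_congr_ae ?_
  filter_upwards [h] with s ⟨hpos, hderiv⟩ _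
  rw [hderiv.deriv, norm_smul, hT, mul_one, Real.norm_of_nonneg hpos.le]

theorem length_gamma (hτ : τ ∈ Ioc 0 1) (hd : 0 ≤ d) (he : 0 ≤ endLength τ d c) :
    ((chainedClasp τ d c).strand 2).length = claspLength τ + 2 * endLength τ d c := by
  rw [length_eq_integral (chainedClasp_left_lt_right hτ hd he 2).le (norm_gammaTangent τ)
    (ae_hasDerivAt_gammaPath hτ d)]
  exact (integral_upperSpeed hτ (le_add_of_nonneg_right he)).trans (by rw [add_sub_cancel_left])

theorem length_beta (hτ : τ ∈ Ioc 0 1) (hd : 0 ≤ d) (he : 0 ≤ endLength τ d c) :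
    ((chainedClasp τ d c).strand 1).length = claspLength τ + 2 * endLength τ d c := by
  have hderiv : ∀ᵐ s : ℝ, 0 < upperSpeed τ s ∧ HasDerivAt (fun s => reflZ (gammaPath τ d s))
      (upperSpeed τ s • reflZ (gammaTangent τ s)) s :=
    (ae_hasDerivAt_gammaPath hτ d).mono fun s hs =>
      ⟨hs.1, (hasDerivAt_reflZ hs.2).congr_deriv (reflZ_smul _ _)⟩
  rw [length_eq_integral (chainedClasp_left_lt_right hτ hd he 1).le
    (fun s => (norm_reflZ _).trans (norm_gammaTangent τ s)) hderiv]
  exact (integral_upperSpeed hτ (le_add_of_nonneg_right he)).trans (by rw [add_sub_cancel_left])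

theorem alphaSpeed_eq_upperSpeed_min (τ d s : ℝ) :
    alphaSpeed τ d s = upperSpeed τ (min s (2 * alphaHalf d - s)) := by
  unfold alphaSpeed
  split_ifs with h
  · rw [min_eq_left (by linarith)]
  · rw [min_eq_right (by linarith)]

theorem length_alpha (hτ : τ ∈ Ioc 0 1) (hd : 0 ≤ d) (he : 0 ≤ endLength τ d c) :
    ((chainedClasp τ d c).strand 0).length =
      2 * (claspLength τ + 2 * (alphaHalf d - Real.arcsin τ)) := by
  have hhalf := alphaHalf_pos hd
  have hint (a b : ℝ) : IntervalIntegrable (alphaSpeed τ d) volume a b := by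
    rw [funext (alphaSpeed_eq_upperSpeed_min τ d)]
    exact ((continuous_upperSpeed hτ).comp (by fun_prop)).intervalIntegrable a b
  have hupper : ∫ s in -alphaHalf d..alphaHalf d, alphaSpeed τ d s =
      ∫ s in -alphaHalf d..alphaHalf d, upperSpeed τ s :=
    intervalIntegral.integral_congr fun s hs => by
      rw [uIcc_of_le (by linarith)] at hs
      simp only [alphaSpeed_eq_upperSpeed_min]
      rw [min_eq_left (by linarith [hs.2])]
  have hlower : ∫ s in alphaHalf d..3 * alphaHalf d, alphaSpeed τ d s =
      ∫ s in -alphaHalf d..alphaHalf d, upperSpeed τ s := by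
    trans ∫ s in alphaHalf d..3 * alphaHalf d, upperSpeed τ (2 * alphaHalf d - s)
    · refine intervalIntegral.integral_congr fun s hs => ?_
      rw [uIcc_of_le (by linarith)] at hs
      simp only [alphaSpeed_eq_upperSpeed_min]
      rw [min_eq_right (by linarith [hs.1])]
    · rw [intervalIntegral.integral_comp_sub_left (upperSpeed τ)]
      ring_nf
  rw [length_eq_integral (chainedClasp_left_lt_right hτ hd he 0).le (norm_alphaTangent d)
    (ae_hasDerivAt_alphaPath hτ hd)]
  change ∫ s in -alphaHalf d..3 * alphaHalf d, alphaSpeed τ d s = _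
  rw [← intervalIntegral.integral_add_adjacent_intervals (hint _ (alphaHalf d)) (hint _ _), hupper,
    hlower, integral_upperSpeed hτ
      ((Real.arcsin_le_pi_div_two τ).trans (pi_div_two_le_alphaHalf hd)), ← two_mul]

theorem length_chainedClasp (hτ : τ ∈ Ioc 0 1) (hd : 0 ≤ d) (he : 0 ≤ endLength τ d c) :
    (chainedClasp τ d c).length =
      4 * claspLength τ + 4 * (c + alphaHalf d - τ * (d / 2 + claspGap τ) - Real.arcsin τ) := by
  rw [GeneralizedLink.length, Fin.sum_univ_three, length_alpha hτ hd he, length_beta hτ hd he,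
    length_gamma hτ hd he, endLength]
  ring

end Lengths

end

theorem theorem6p1 :
    -- slanted ends: the tips of `β` and `γ` are at distance one
    (∀ τ c : ℝ, 0 < τ → τ < 1 → 0 ≤ endLength τ 1 c →
      (chainedClasp τ 1 c).IsValid ∧
      (chainedClasp τ 1 c).gThi = 1 ∧
      (chainedClasp τ 1 c).IsStronglyCritical ∧
      -- the strut between the tips is isolated
      (let tips : E3 × E3 :=
        (((chainedClasp τ 1 c).strand 1).path 0, ((chainedClasp τ 1 c).strand 2).path 0)
       tips ∈ (chainedClasp τ 1 c).gStrut ∧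
       ∃ r : ℝ, 0 < r ∧ ∀ p ∈ (chainedClasp τ 1 c).gStrut, dist p tips < r → p = tips)) ∧
    -- vertical ends: a one-parameter family, for a fixed floor and a fixed ceiling
    (∀ c d : ℝ, 1 ≤ d → 0 ≤ endLength 1 d c →
      (chainedClasp 1 d c).IsValid ∧
      (chainedClasp 1 d c).gThi = 1 ∧
      (chainedClasp 1 d c).IsStronglyCritical) ∧
    -- in this family the total length is constant, whereas the length of `α` varies
    (∀ c d d' : ℝ, 1 ≤ d → 0 ≤ endLength 1 d c → 1 ≤ d' → 0 ≤ endLength 1 d' c →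
      (chainedClasp 1 d c).length = (chainedClasp 1 d' c).length ∧
      ((chainedClasp 1 d' c).strand 0).length - ((chainedClasp 1 d c).strand 0).length
        = 2 * (d' - d)) := by
  have hone : (1 : ℝ) ∈ Ioc 0 1 := ⟨one_pos, le_rfl⟩
  refine ⟨fun τ c h0 h1 he => ?_, fun c d hd he => ?_, fun c d d' hd he hd' he' => ⟨?_, ?_⟩⟩
  · have hτ : τ ∈ Ioc 0 1 := ⟨h0, h1.le⟩
    exact ⟨chainedClasp_isValid hτ le_rfl he, chainedClasp_gThi hτ le_rfl he,
      chainedClasp_isStronglyCritical hτ le_rfl (fun _ => rfl) he, tipPair_mem_gStrut hτ he,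
      1, one_pos, fun p hp hdist => eq_tipPair_of_mem_gStrut hτ he hp hdist⟩
  · exact ⟨chainedClasp_isValid hone hd he, chainedClasp_gThi hone hd he,
      chainedClasp_isStronglyCritical hone hd (fun h => absurd h (lt_irrefl _)) he⟩
  · rw [length_chainedClasp hone (zero_le_one.trans hd) he,
      length_chainedClasp hone (zero_le_one.trans hd') he', alphaHalf, alphaHalf]
    ring
  · rw [length_alpha hone (zero_le_one.trans hd) he,
      length_alpha hone (zero_le_one.trans hd') he', alphaHalf, alphaHalf]
    ring
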